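/- Let $n\ge 0$ be an integer and let $Y(n)$ be the Yangian of $\mathfrak{gl}_n(\mathbb C)$: the unital associative $\mathbb C$-algebra generated by elements $t_{ij}^{(k)}$ ($1\le i,j\le n$, $k\ge1$) subject to $$R(u-v)T_1(u)T_2(v)=T_2(v)T_1(u)R(u-v),\qquad R(u)=1-\frac{P}{u},$$ where $P$ is the flip of $\mathbb C^n\otimes\mathbb C^n$, $T(u)=(t_{ij}(u))_{i,j=1}^n$, and $t_{ij}(u)=\delta_{ij}+\sum_{k\ge1}t_{ij}^{(k)}u^{-k}$. For a matrix $X$ with entries in an algebra, $X_s$ denotes $X$ acting in the $s$-th factor of $(\mathbb C^n)^{\otimes k}$; $A_k=\frac1{k!}\sum_{\sigma\in S_k}\operatorname{sgn}(\sigma)\,\sigma$ is the antisymmetrizer on $(\mathbb C^n)^{\otimes k}$; and $\det X=\sum_\sigma \operatorname{sgn}(\sigma)\,x_{1\sigma(1)}\cdots x_{k\sigma(k)}$ is the row determinant. For $f\in Y(n)[[u^{-1}]]$ and $a\in\mathbb Z$, the series $f(u+a)$ is obtained by expanding each $(u+a)^{-k}$ in powers of $u^{-1}$. Let $\tau^{-1}$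 be a formal variable with $\tau^{-1}f(u)=f(u-1)\tau^{-1}$; the generating functions below are formal power series in $\tau^{-1}$ with coefficients in $Y(n)[[u^{-1}]]$, multiplied by this rule. Put $$e_k(u)=\operatorname{tr}\bigl(A_kT_1(u)T_2(u-1)\cdots T_k(u-k+1)\bigr),\qquad p^-_k(u)=\operatorname{tr}\bigl(T(u)T(u-1)\cdots T(u-k+1)\bigr),$$ $$e_k(u,\tau)=\operatorname{tr}\bigl(A_k\,(T(u)\tau^{-1})_1\cdots(T(u)\tau^{-1})_k\bigr),\qquad E(u,\tau)=\sum_{k=0}^n(-1)^ke_k(u,\tau).$$ For $m\ge0$ define $h^-_m(u)$ by $m!\,h^-_m(u)=\det(x_{ij})_{1\le i,j\le m}$, where $x_{ij}=p^-_{i-j+1}(u+i-1)$ for $j\le i$, $x_{i,i+1}=-i$, and $x_{ij}=0$ for $j>i+1$ (so $h_0^-=1$); put $h^-_m=0$ for $m<0$. Let $h^-_m(u,\tau)=\tau^{-m}h^-_m(u)$ and $H^-(u,\tau)=\sum_{l\ge0}h^-_l(u,\tau)$. Let the Bethe subalgebra be the subalgebra of $Y(n)$ generated by all the coefficients of the series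 $b_k(u)=\operatorname{tr}\bigl(A_nT_1(u)\cdots T_k(u-k+1)\bigr)$, $1\le k\le n$, where the trace is over $(\mathbb C^n)^{\otimes n}$. Then: (a) $E(u,\tau)\,H^-(u+1,\tau)=1$. (b) For all $k\ge0$ the coefficients of $h^-_k(u)$ belong to the Bethe subalgebra, and the coefficients of all the series $h^-_k(u)$, $k\ge 0$, commute with each other. Moreover, for every $k\ge0$, $$e_k(u)=\det\bigl(h^-_{j-i+1}(u-j+1)\bigr)_{1\le i,j\le k}.$$ -/

import Mathlib

noncomputable section

namespace YangianBethe

open PowerSeries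

/-! ### Shifts of the spectral parameter

A formal series `f(u) = ∑ f_k u^{-k}` with coefficients in a (noncommutative) ring `A` is the
element `∑ f_k X^k` of `A⟦X⟧`, i.e. `X = u⁻¹`. -/

/-- The expansion of `(u + a)⁻¹ = u⁻¹ ∑_d (-a)^d u^{-d}` in powers of `X = u⁻¹`. -/
def invShift (a : ℤ) : ℤ⟦X⟧ := X * PowerSeries.mk fun d => (-a) ^ d

/-- The coefficient of `u^{-m}` in the expansion of `(u + a)^{-k}`. -/
def shiftCoeff (a : ℤ) (k m : ℕ) : ℤ := coeff m (invShift a ^ k)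

theorem shiftCoeff_of_lt (a : ℤ) {k m : ℕ} (h : m < k) : shiftCoeff a k m = 0 := by
  rw [shiftCoeff, invShift, mul_pow, coeff_X_pow_mul', if_neg (by omega)]

theorem shiftCoeff_zero (a : ℤ) (m : ℕ) : shiftCoeff a 0 m = if m = 0 then 1 else 0 := by
  rw [shiftCoeff, pow_zero, coeff_one]

theorem shiftCoeff_add (a : ℤ) (i j m : ℕ) :
    shiftCoeff a (i + j) m =
      ∑ q ∈ Finset.HasAntidiagonal.antidiagonal m, shiftCoeff a i q.1 * shiftCoeff a j q.2 := by
  simp only [shiftCoeff, pow_add, coeff_mul]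

section Shift

variable {A : Type*} [Ring A]

/-- `f(u) ↦ f(u + a)`: each `u^{-k}` is replaced by the expansion of `(u + a)^{-k}`. -/
def shiftFun (a : ℤ) (f : A⟦X⟧) : A⟦X⟧ :=
  PowerSeries.mk fun m => ∑ k ∈ Finset.range (m + 1), shiftCoeff a k m • coeff k f

theorem coeff_shiftFun (a : ℤ) (f : A⟦X⟧) {m N : ℕ} (h : m ≤ N) :
    coeff m (shiftFun a f) = ∑ k ∈ Finset.range (N + 1), shiftCoeff a k m • coeff k f := by
  rw [shiftFun, coeff_mk]
  refine Finset.sum_subset (Finset.range_mono (by omega)) fun k _ hk => ?_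
  rw [shiftCoeff_of_lt a (by simpa using hk), zero_smul]

theorem shiftFun_one (a : ℤ) : shiftFun a (1 : A⟦X⟧) = 1 := by
  ext m
  rw [coeff_shiftFun a _ le_rfl, Finset.sum_eq_single 0]
  · simp [shiftCoeff_zero, coeff_one]
  · intro k _ hk
    simp [coeff_one, hk]
  · simp

theorem shiftFun_mul (a : ℤ) (f g : A⟦X⟧) :
    shiftFun a (f * g) = shiftFun a f * shiftFun a g := by
  ext m
  have hR : coeff m (shiftFun a f * shiftFun a g) =
      ∑ i ∈ Finset.range (m + 1), ∑ j ∈ Finset.range (m + 1),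
        shiftCoeff a (i + j) m • (coeff i f * coeff j g) := by
    rw [coeff_mul]
    have : ∀ q ∈ Finset.HasAntidiagonal.antidiagonal m,
        coeff q.1 (shiftFun a f) * coeff q.2 (shiftFun a g) =
        ∑ i ∈ Finset.range (m + 1), ∑ j ∈ Finset.range (m + 1),
          (shiftCoeff a i q.1 * shiftCoeff a j q.2) • (coeff i f * coeff j g) := by
      intro q hq
      have hq' := Finset.HasAntidiagonal.mem_antidiagonal.mp hq
      rw [coeff_shiftFun a f (show q.1 ≤ m by omega), coeff_shiftFun a g (show q.2 ≤ m by omega),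
        Finset.sum_mul_sum]
      refine Finset.sum_congr rfl fun i _ => Finset.sum_congr rfl fun j _ => ?_
      rw [smul_mul_smul_comm]
    rw [Finset.sum_congr rfl this, Finset.sum_comm]
    refine Finset.sum_congr rfl fun i _ => ?_
    rw [Finset.sum_comm]
    refine Finset.sum_congr rfl fun j _ => ?_
    rw [← Finset.sum_smul, ← shiftCoeff_add]
  rw [hR, coeff_shiftFun a _ le_rfl, ← Finset.sum_product']
  simp only [coeff_mul, Finset.smul_sum]
  rw [Finset.sum_sigma']
  symm
  refine Finset.sum_subset_zero_on_sdiff (s₁ := (Finset.range (m + 1) ×ˢ Finset.range (m + 1)).filter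
    fun q => q.1 + q.2 ≤ m) (Finset.filter_subset _ _) ?_ (fun _ _ => rfl) |>.symm.trans ?_
  · intro q hq
    simp only [Finset.mem_sdiff, Finset.mem_filter, not_and, not_le] at hq
    rw [shiftCoeff_of_lt a (hq.2 hq.1), zero_smul]
  · refine Finset.sum_bij' (fun q _ => ⟨q.1 + q.2, q⟩) (fun p _ => p.2) ?_ ?_ ?_ ?_ ?_
    · intro q hq
      simp only [Finset.mem_filter, Finset.mem_product, Finset.mem_range] at hq
      simp only [Finset.mem_sigma, Finset.mem_range, Finset.HasAntidiagonal.mem_antidiagonal, and_true]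
      omega
    · rintro ⟨k, q⟩ hq
      simp only [Finset.mem_sigma, Finset.mem_range, Finset.HasAntidiagonal.mem_antidiagonal] at hq
      simp only [Finset.mem_filter, Finset.mem_product, Finset.mem_range]
      omega
    · intro q _
      rfl
    · rintro ⟨k, q⟩ hq
      simp only [Finset.mem_sigma, Finset.mem_range, Finset.HasAntidiagonal.mem_antidiagonal] at hq
      obtain ⟨_, rfl⟩ := hq
      rfl
    · intro q _
      rfl

variable [Algebra ℂ A]

/-- The shift `f(u) ↦ f(u + a)` as an endomorphism of the `ℂ`-algebra `A⟦u⁻¹⟧`. -/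
def shift (a : ℤ) : A⟦X⟧ →ₐ[ℂ] A⟦X⟧ :=
  AlgHom.ofLinearMap
    { toFun := shiftFun a
      map_add' := fun f g => by
        ext m
        simp [shiftFun, Finset.sum_add_distrib]
      map_smul' := fun c f => by
        ext m
        simp only [shiftFun, coeff_mk, coeff_smul, RingHom.id_apply, Finset.smul_sum]
        exact Finset.sum_congr rfl fun k _ => smul_comm _ _ _ }
    (shiftFun_one a) (shiftFun_mul a)

end Shift

/-! ### Skew power series -/

/-- Formal series `∑_{k ≥ 0} b_k y^k` with coefficients in `B`, written on the left, and with
multiplication determined by `y b = φ(b) y`. -/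
@[ext]
structure SkewSeries {B : Type*} [Ring B] [Algebra ℂ B] (φ : B →ₐ[ℂ] B) where
  coeff : ℕ → B

namespace SkewSeries

variable {B : Type*} [Ring B] [Algebra ℂ B] {φ : B →ₐ[ℂ] B}

instance : Zero (SkewSeries φ) := ⟨⟨fun _ => 0⟩⟩
instance : One (SkewSeries φ) := ⟨⟨fun k => if k = 0 then 1 else 0⟩⟩
instance : Add (SkewSeries φ) := ⟨fun F G => ⟨fun k => F.coeff k + G.coeff k⟩⟩
instance : Neg (SkewSeries φ) := ⟨fun F => ⟨fun k => -F.coeff k⟩⟩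
instance : SMul ℂ (SkewSeries φ) := ⟨fun c F => ⟨fun k => c • F.coeff k⟩⟩

/-- `(∑ b_i y^i)(∑ c_j y^j) = ∑ b_i φ^i(c_j) y^{i+j}`. -/
instance : Mul (SkewSeries φ) :=
  ⟨fun F G => ⟨fun m => ∑ q ∈ Finset.HasAntidiagonal.antidiagonal m, F.coeff q.1 * (φ ^ q.1) (G.coeff q.2)⟩⟩

@[simp] theorem coeff_zero (k : ℕ) : (0 : SkewSeries φ).coeff k = 0 := rfl
@[simp] theorem coeff_one (k : ℕ) : (1 : SkewSeries φ).coeff k = if k = 0 then 1 else 0 := rfl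
@[simp] theorem coeff_add (F G : SkewSeries φ) (k : ℕ) :
    (F + G).coeff k = F.coeff k + G.coeff k := rfl
@[simp] theorem coeff_neg (F : SkewSeries φ) (k : ℕ) : (-F).coeff k = -F.coeff k := rfl
@[simp] theorem coeff_smul (c : ℂ) (F : SkewSeries φ) (k : ℕ) :
    (c • F).coeff k = c • F.coeff k := rfl
theorem coeff_mul (F G : SkewSeries φ) (m : ℕ) :
    (F * G).coeff m =
      ∑ q ∈ Finset.HasAntidiagonal.antidiagonal m, F.coeff q.1 * (φ ^ q.1) (G.coeff q.2) := rfl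

instance : AddCommGroup (SkewSeries φ) where
  add_assoc F G H := by ext k; simp [add_assoc]
  zero_add F := by ext k; simp
  add_zero F := by ext k; simp
  add_comm F G := by ext k; simp [add_comm]
  neg_add_cancel F := by ext k; simp
  nsmul := nsmulRec
  zsmul := zsmulRec

instance : Ring (SkewSeries φ) where
  __ := (inferInstance : AddCommGroup (SkewSeries φ))
  left_distrib F G H := by
    ext k; simp [coeff_mul, mul_add, Finset.sum_add_distrib]
  right_distrib F G H := by
    ext k; simp [coeff_mul, add_mul, Finset.sum_add_distrib]
  zero_mul F := by ext k; simp [coeff_mul]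
  mul_zero F := by ext k; simp [coeff_mul]
  mul_assoc F G H := by
    ext m
    simp only [coeff_mul, map_sum, map_mul, Finset.sum_mul, Finset.mul_sum]
    rw [Finset.sum_sigma', Finset.sum_sigma']
    refine Finset.sum_nbij' (fun ⟨⟨_, j⟩, ⟨k, l⟩⟩ => ⟨(k, l + j), (l, j)⟩)
      (fun ⟨⟨i, _⟩, ⟨k, l⟩⟩ => ⟨(i + k, l), (i, k)⟩) ?_ ?_ ?_ ?_ ?_
    · rintro ⟨⟨i, j⟩, ⟨k, l⟩⟩ h
      simp only [Finset.mem_sigma, Finset.HasAntidiagonal.mem_antidiagonal] at h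
      exact Finset.mem_sigma.mpr ⟨Finset.HasAntidiagonal.mem_antidiagonal.mpr
        (show k + (l + j) = m by omega), Finset.HasAntidiagonal.mem_antidiagonal.mpr rfl⟩
    · rintro ⟨⟨i, j⟩, ⟨k, l⟩⟩ h
      simp only [Finset.mem_sigma, Finset.HasAntidiagonal.mem_antidiagonal] at h
      exact Finset.mem_sigma.mpr ⟨Finset.HasAntidiagonal.mem_antidiagonal.mpr
        (show i + k + l = m by omega), Finset.HasAntidiagonal.mem_antidiagonal.mpr rfl⟩
    · rintro ⟨⟨i, j⟩, ⟨k, l⟩⟩ h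
      simp only [Finset.mem_sigma, Finset.HasAntidiagonal.mem_antidiagonal] at h
      obtain ⟨_, rfl⟩ := h
      rfl
    · rintro ⟨⟨i, j⟩, ⟨k, l⟩⟩ h
      simp only [Finset.mem_sigma, Finset.HasAntidiagonal.mem_antidiagonal] at h
      obtain ⟨_, rfl⟩ := h
      rfl
    · rintro ⟨⟨i, j⟩, ⟨k, l⟩⟩ h
      simp only [Finset.mem_sigma, Finset.HasAntidiagonal.mem_antidiagonal] at h
      obtain ⟨_, rfl⟩ := h
      rw [mul_assoc, pow_add]
      rfl
  one_mul F := by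
    ext m
    rw [coeff_mul, Finset.sum_eq_single (0, m)]
    · simp
    · rintro ⟨i, j⟩ h hne
      have : i ≠ 0 := by
        rintro rfl
        simp only [Finset.HasAntidiagonal.mem_antidiagonal, zero_add] at h
        exact hne (by rw [h])
      simp [this]
    · simp
  mul_one F := by
    ext m
    rw [coeff_mul, Finset.sum_eq_single (m, 0)]
    · simp
    · rintro ⟨i, j⟩ h hne
      have : j ≠ 0 := by
        rintro rfl
        simp only [Finset.HasAntidiagonal.mem_antidiagonal, add_zero] at h
        exact hne (by rw [h])
      simp [this]
    · simp

instance : Module ℂ (SkewSeries φ) where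
  one_smul F := by ext k; simp
  mul_smul c d F := by ext k; simp [mul_smul]
  smul_zero c := by ext k; simp
  smul_add c F G := by ext k; simp
  add_smul c d F := by ext k; simp [add_smul]
  zero_smul F := by ext k; simp

instance : Algebra ℂ (SkewSeries φ) :=
  Algebra.ofModule
    (fun c F G => by ext m; simp [coeff_mul, Finset.smul_sum])
    (fun c F G => by ext m; simp [coeff_mul, Finset.smul_sum])

/-- An element of `B` as a constant series. -/
def const (b : B) : SkewSeries φ := ⟨fun k => if k = 0 then b else 0⟩

/-- The variable `y`. -/
def var : SkewSeries φ := ⟨fun k => if k = 1 then 1 else 0⟩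

/-- The infinite sum `∑_l F_l` of series `F_l` which involve only the powers `y^k`, `k ≥ l`. -/
def formalSum (F : ℕ → SkewSeries φ) : SkewSeries φ :=
  ⟨fun m => ∑ l ∈ Finset.range (m + 1), (F l).coeff m⟩

end SkewSeries

/-! ### Matrices over noncommutative algebras -/

section Matrices

variable {A : Type*} [Ring A] {n : ℕ}

/-- The row determinant `∑_σ sgn(σ) x_{1σ(1)} ⋯ x_{kσ(k)}`. -/
def rdet {k : ℕ} (M : Matrix (Fin k) (Fin k) A) : A :=
  ∑ σ : Equiv.Perm (Fin k), (Equiv.Perm.sign σ : ℤ) • (List.ofFn fun i => M i (σ i)).prod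

/-- `End(ℂⁿ)^{⊗k} ⊗ A`, as matrices over `A` in the basis `e_I = e_{I 0} ⊗ ⋯ ⊗ e_{I (k-1)}`
of `(ℂⁿ)^{⊗k}`. -/
abbrev TensorEnd (n k : ℕ) (A : Type*) := Matrix (Fin k → Fin n) (Fin k → Fin n) A

/-- `X_s = ∑_{ij} 1 ⊗ ⋯ ⊗ E_{ij} ⊗ ⋯ ⊗ 1 ⊗ x_{ij}`, with `E_{ij}` in the tensor factor `s`. -/
def leg {k : ℕ} (s : Fin k) (M : Matrix (Fin n) (Fin n) A) : TensorEnd n k A :=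
  Matrix.of fun I J => if ∀ t, t ≠ s → I t = J t then M (I s) (J s) else 0

/-- The action of a permutation on the tensor factors, `e_J ↦ e_{J ∘ σ⁻¹}`. -/
def permOp {k : ℕ} (σ : Equiv.Perm (Fin k)) : TensorEnd n k A :=
  Matrix.of fun I J => if I = J ∘ σ.symm then 1 else 0

/-- The antisymmetrizer `A_k = (1/k!) ∑_σ sgn(σ) σ`. -/
def antisymmetrizer [Algebra ℂ A] (k : ℕ) : TensorEnd n k A :=
  ((k.factorial : ℂ)⁻¹) • ∑ σ : Equiv.Perm (Fin k), (Equiv.Perm.sign σ : ℤ) • permOp σ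

/-- `tr (A_k X(1)_1 X(2)_2 ⋯ X(k)_k)`. -/
def antisymTrace [Algebra ℂ A] {k : ℕ} (M : Fin k → Matrix (Fin n) (Fin n) A) : A :=
  Matrix.trace (antisymmetrizer k * (List.ofFn fun s => leg s (M s)).prod)

end Matrices

/-! ### The Yangian -/

/-- The free algebra on the symbols `t_{ij}^{(k)}`, `k ≥ 1`; the triple `(i, j, k)` stands for
`t_{ij}^{(k+1)}`. -/
abbrev FreeT (n : ℕ) := FreeAlgebra ℂ (Fin n × Fin n × ℕ)

/-- The matrix `T^{(k)} = (t_{ij}^{(k)})`, with `T^{(0)} = 1`. -/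
def freeT (n : ℕ) : ℕ → Matrix (Fin n) (Fin n) (FreeT n)
  | 0 => 1
  | k + 1 => Matrix.of fun i j => FreeAlgebra.ι ℂ (i, j, k)

/-- The relation `R(u - v) T_1(u) T_2(v) = T_2(v) T_1(u) R(u - v)`, `R(u) = 1 - P/u`, after
multiplication by `u - v`: the entries of the coefficients of `u^{-r} v^{-s}`, `r, s ≥ 0`, in
`(u - v - P) T_1(u) T_2(v) = T_2(v) T_1(u) (u - v - P)`.
(The coefficients of `u v^{-s}` and `u^{-r} v` agree automatically because `T^{(0)} = 1`.) -/
inductive YangianRel (n : ℕ) : FreeT n → FreeT n → Prop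
  | rtt (r s : ℕ) (I J : Fin 2 → Fin n) : YangianRel n
      ((leg 0 (freeT n (r + 1)) * leg 1 (freeT n s) - leg 0 (freeT n r) * leg 1 (freeT n (s + 1))
        - permOp (Equiv.swap 0 1) * leg 0 (freeT n r) * leg 1 (freeT n s) : TensorEnd n 2 _) I J)
      ((leg 1 (freeT n s) * leg 0 (freeT n (r + 1)) - leg 1 (freeT n (s + 1)) * leg 0 (freeT n r)
        - leg 1 (freeT n s) * leg 0 (freeT n r) * permOp (Equiv.swap 0 1) : TensorEnd n 2 _) I J)

/-- The Yangian `Y(n)` of `gl_n(ℂ)`. -/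
def Yangian (n : ℕ) : Type := RingQuot (YangianRel n)

instance (n : ℕ) : Ring (Yangian n) := inferInstanceAs (Ring (RingQuot (YangianRel n)))
instance (n : ℕ) : Algebra ℂ (Yangian n) := inferInstanceAs (Algebra ℂ (RingQuot (YangianRel n)))

/-- The projection of the free algebra onto the Yangian. -/
def Yangian.proj (n : ℕ) : FreeT n →ₐ[ℂ] Yangian n := RingQuot.mkAlgHom ℂ (YangianRel n)

/-- Formal series in `u⁻¹` with coefficients in the Yangian. -/
abbrev YSeries (n : ℕ) := (Yangian n)⟦X⟧

/-- The generating matrix `T(u)`, with entries `t_{ij}(u) = ∑_k t_{ij}^{(k)} u^{-k}`. -/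
def T (n : ℕ) : Matrix (Fin n) (Fin n) (YSeries n) :=
  Matrix.of fun i j => PowerSeries.mk fun k => Yangian.proj n (freeT n k i j)

/-- `T(u + a)`. -/
def Tshift (n : ℕ) (a : ℤ) : Matrix (Fin n) (Fin n) (YSeries n) := (T n).map (shift a)

/-- `e_k(u) = tr (A_k T_1(u) T_2(u-1) ⋯ T_k(u-k+1))`. -/
def e (n k : ℕ) : YSeries n := antisymTrace fun s : Fin k => Tshift n (-(s : ℤ))

/-- `p⁻_k(u) = tr (T(u) T(u-1) ⋯ T(u-k+1))`. -/
def pMinus (n k : ℕ) : YSeries n :=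
  Matrix.trace (List.ofFn fun s : Fin k => Tshift n (-(s : ℤ))).prod

/-- `b_k(u, Z) = tr (A_n T_1(u) ⋯ T_k(u-k+1) Z_{k+1} ⋯ Z_n)`. -/
def betheSeries (n : ℕ) (Z : Matrix (Fin n) (Fin n) ℂ) (k : ℕ) : YSeries n :=
  antisymTrace fun s : Fin n =>
    if (s : ℕ) < k then Tshift n (-(s : ℤ)) else Z.map (algebraMap ℂ (YSeries n))

/-- The Bethe subalgebra of `Y(n)` attached to `Z`, generated by all coefficients of the series
`b_k(u, Z)`, `1 ≤ k ≤ n`. -/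
def betheSubalgebra (n : ℕ) (Z : Matrix (Fin n) (Fin n) ℂ) : Subalgebra ℂ (Yangian n) :=
  Algebra.adjoin ℂ {y | ∃ k r : ℕ, 1 ≤ k ∧ k ≤ n ∧ y = coeff r (betheSeries n Z k)}

/-- The Hessenberg matrix with rows `i = 0, …, m-1`: the entries are `p⁻_{i-j+1}(u+i)` for `j ≤ i`,
`-(i+1)` for `j = i+1`, and `0` beyond. -/
def hessenberg (n m : ℕ) : Matrix (Fin m) (Fin m) (YSeries n) :=
  Matrix.of fun i j =>
    if (j : ℕ) ≤ i then shift ((i : ℕ) : ℤ) (pMinus n (i - j + 1))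
    else if (j : ℕ) = i + 1 then -(((i : ℕ) + 1 : ℕ) : YSeries n) else 0

/-- `h⁻_m(u)`, defined by `m! h⁻_m(u) = rdet (hessenberg matrix)`. -/
def hMinus (n m : ℕ) : YSeries n := ((m.factorial : ℂ)⁻¹) • rdet (hessenberg n m)

/-- `h⁻_m(u)` for an integer index, zero for `m < 0`. -/
def hMinusInt (n : ℕ) : ℤ → YSeries n
  | Int.ofNat m => hMinus n m
  | Int.negSucc _ => 0

/-! ### The shift variable -/

/-- Formal series in `τ⁻¹` with coefficients in `Y(n)⟦u⁻¹⟧` on the left, where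
`τ⁻¹ f(u) = f(u-1) τ⁻¹`. -/
abbrev TauSeries (n : ℕ) := SkewSeries (shift (A := Yangian n) (-1))

/-- The element `τ⁻¹`. -/
def tauInv (n : ℕ) : TauSeries n := SkewSeries.var

/-- `e_k(u, τ) = tr (A_k (T(u) τ⁻¹)^{[k]})`, where `X^{[k]} = X_1 ⋯ X_k`. -/
def eTau (n k : ℕ) : TauSeries n :=
  antisymTrace fun _ : Fin k => Matrix.of fun i j => SkewSeries.const (T n i j) * tauInv n

/-- The universal differential operator `E(u, τ) = ∑_{k=0}^n (-1)^k e_k(u, τ)`. -/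
def E (n : ℕ) : TauSeries n := ∑ k ∈ Finset.range (n + 1), (-1) ^ k * eTau n k

/-- `h⁻_m(u + a, τ) = τ^{-m} h⁻_m(u + a)`. -/
def hTau (n m : ℕ) (a : ℤ) : TauSeries n :=
  tauInv n ^ m * SkewSeries.const (shift a (hMinus n m))

/-- `H⁻(u + a, τ) = ∑_{l ≥ 0} h⁻_l(u + a, τ)`. -/
def HMinus (n : ℕ) (a : ℤ) : TauSeries n := SkewSeries.formalSum fun l => hTau n l a

end YangianBethe

end

/-! The R-matrix 1 - P/u becomes 1 - P at u = 1, so the defining relation with v = u - 1 makes A_k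
T_1(u)⋯T_k(u-k+1) antisymmetric on the right as well as on the left (`RTT_T`,
`altEntry_comp_right`).

Commutativity: e_k(u)e_l(v) is a trace over two blocks of k and l tensor factors. The product of all
R(u-v-i+j) acting between the blocks exchanges the two operator products, respects
antisymmetrization inside each block by the Yang–Baxter equation, and is invertible up to a scalar
that is not a zero divisor. Conjugating under the trace gives e_k(u)e_l(v) = e_l(v)e_k(u)
(`antisymTrace_mul_comm`, `coeff_e_commute`). Tracing out the idle factors shows that b_k is a
nonzero multiple of e_k (`exists_betheSeries_eq`), so the Bethe subalgebra is commutative and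
contains the coefficients of every e_k.

Newton's identities: expanding the antisymmetrizer over the image of the last index yields j(-1)^j
e_j(u) = -∑_{t<j} (-1)^t e_t(u) p⁻_{j-t}(u-t) (`newton`). Solved for p⁻_j, they place its
coefficients in the Bethe subalgebra (`exists_lift_pMinus`).

The rest is classical algebra over a commutative ring, where row determinants are ordinary ones. The
Hessenberg determinant satisfies m h_m(u) = ∑_{q<m} p_{m-q}(u+m-1) h_q(u) (`nsmul_complete`).
Together with Newton this gives ∑_j (-1)^j e_j(u) h_{m-j}(u+1-m) = 0 for m > 0
(`sum_elementary_mul_complete`), which is the coefficient of τ^{-m} in (a). Solving this recursion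
for e_m produces the determinant in (b) (`elementary_eq_leadingMinor`). -/

noncomputable section
namespace YangianBethe
open PowerSeries

/-! ### The shift automorphisms -/

section ShiftLemmas

variable {A : Type*} [Ring A]

/-- Since u + a = u(1 + a u⁻¹), this characterizes (u + a)⁻¹ and replaces computations with the
geometric series. -/
theorem one_add_mul_invShift (a : ℤ) : (1 + (a : ℤ⟦X⟧) * X) * invShift a = X := by
  have key : (1 + (a : ℤ⟦X⟧) * X) * PowerSeries.mk (fun d => (-a) ^ d) = 1 := by
    have hC : (a : ℤ⟦X⟧) = C a := by simp
    ext m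
    rw [add_mul, one_mul, hC, mul_assoc, map_add, coeff_C_mul]
    cases m with
    | zero => simp
    | succ m => simp [coeff_succ_X_mul, coeff_one, pow_succ]; ring
  rw [invShift, mul_left_comm, key, mul_one]

theorem shiftFun_zero (a : ℤ) : shiftFun a (0 : A⟦X⟧) = 0 := by
  ext m; simp [shiftFun]

theorem shiftFun_add (a : ℤ) (f g : A⟦X⟧) :
    shiftFun a (f + g) = shiftFun a f + shiftFun a g := by
  ext m; simp [shiftFun, Finset.sum_add_distrib]

/-- `f(u) ↦ f(u + a)` as a ring endomorphism. -/
def shiftHom (a : ℤ) : A⟦X⟧ →+* A⟦X⟧ where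
  toFun := shiftFun a
  map_one' := shiftFun_one a
  map_mul' := shiftFun_mul a
  map_zero' := shiftFun_zero a
  map_add' := shiftFun_add a

theorem shiftFun_X (a : ℤ) : shiftFun a (X : A⟦X⟧) = (invShift a).map (Int.castRingHom A) := by
  ext m
  rw [coeff_shiftFun a _ (Nat.le_succ m), Finset.sum_eq_single 1]
  · simp [shiftCoeff]
  · intro k _ hk
    simp [coeff_X, hk]
  · simp

theorem one_add_mul_shiftFun_X (a : ℤ) :
    (1 + (a : A⟦X⟧) * X) * shiftFun a (X : A⟦X⟧) = X := by
  have h := congrArg (PowerSeries.map (Int.castRingHom A)) (one_add_mul_invShift a)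
  simpa [shiftFun_X] using h

/-- Both sides become u⁻¹ after multiplication by 1 + (a+b)u⁻¹, which can be cancelled in the domain
ℤ⟦X⟧. -/
theorem shiftFun_invShift (a b : ℤ) : shiftFun a (invShift b) = invShift (a + b) := by
  have h1 := congrArg (shiftHom a) (one_add_mul_invShift b)
  have h2 := one_add_mul_shiftFun_X (A := ℤ) a
  have h3 := one_add_mul_invShift (a + b)
  change shiftHom a _ = shiftHom a X at h1
  change _ * shiftHom a X = X at h2
  change shiftHom a (invShift b) = _
  simp only [map_mul, map_add, map_one, map_intCast] at h1
  have hne : (1 + ((a + b : ℤ) : ℤ⟦X⟧) * X) ≠ 0 := by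
    intro h
    rw [h, zero_mul] at h3
    exact X_ne_zero h3.symm
  apply mul_left_cancel₀ hne
  rw [h3]
  push_cast
  linear_combination (1 + (a : ℤ⟦X⟧) * X) * h1 + (1 - b * shiftHom a (invShift b)) * h2

/-- The expansion coefficients of (u + a)^{-k} are universal integers, so the composition law of
shifts is proved over ℤ and then holds over any ring of coefficients. -/
theorem sum_shiftCoeff_mul (a b : ℤ) (j m : ℕ) :
    ∑ k ∈ Finset.range (m + 1), shiftCoeff a k m * shiftCoeff b j k = shiftCoeff (a + b) j m := by
  have h : shiftHom a (invShift b ^ j) = invShift (a + b) ^ j := by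
    rw [map_pow]; exact congrArg (· ^ j) (shiftFun_invShift a b)
  have := congrArg (coeff m) h
  change coeff m (shiftFun a _) = _ at this
  rw [coeff_shiftFun a _ le_rfl] at this
  simpa [shiftCoeff] using this

theorem shiftFun_shiftFun (a b : ℤ) (f : A⟦X⟧) :
    shiftFun a (shiftFun b f) = shiftFun (a + b) f := by
  ext m
  rw [coeff_shiftFun a _ le_rfl, coeff_shiftFun (a + b) _ le_rfl]
  have : ∀ k ∈ Finset.range (m + 1), shiftCoeff a k m • coeff k (shiftFun b f) =
      ∑ j ∈ Finset.range (m + 1), (shiftCoeff a k m * shiftCoeff b j k) • coeff j f := by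
    intro k hk
    rw [coeff_shiftFun b f (show k ≤ m by simpa [Nat.lt_succ_iff] using hk), Finset.smul_sum]
    simp only [mul_smul]
  rw [Finset.sum_congr rfl this, Finset.sum_comm]
  refine Finset.sum_congr rfl fun j _ => ?_
  rw [← Finset.sum_smul, sum_shiftCoeff_mul]

theorem shiftFun_id (f : A⟦X⟧) : shiftFun 0 f = f := by
  ext m
  have h : invShift 0 = X := by simpa using one_add_mul_invShift 0
  rw [coeff_shiftFun 0 _ le_rfl, Finset.sum_eq_single m]
  · simp [shiftCoeff, h]
  · intro k _ hk
    simp [shiftCoeff, h, coeff_X_pow, Ne.symm hk]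
  · simp

theorem shiftFun_map {B : Type*} [Ring B] (φ : A →+* B) (a : ℤ) (f : A⟦X⟧) :
    shiftFun a (f.map φ) = (shiftFun a f).map φ := by
  ext m
  simp [shiftFun]

theorem shiftFun_C (a : ℤ) (r : A) : shiftFun a (C r) = C r := by
  ext m
  rw [coeff_shiftFun a _ le_rfl, Finset.sum_eq_single 0]
  · by_cases h : m = 0 <;> simp [shiftCoeff_zero, coeff_C, h]
  · intro k _ hk
    simp [coeff_C, hk]
  · simp

variable [Algebra ℂ A]

theorem shift_shift (a b : ℤ) (f : A⟦X⟧) : shift a (shift b f) = shift (a + b) f :=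
  shiftFun_shiftFun a b f

@[simp] theorem shift_zero (f : A⟦X⟧) : shift 0 f = f := shiftFun_id f

theorem shift_pow (a : ℤ) (k : ℕ) (f : A⟦X⟧) : (shift a ^ k) f = shift (k * a) f := by
  induction k generalizing f with
  | zero => simp
  | succ k ih =>
    rw [pow_succ, AlgHom.mul_apply, ih, shift_shift]
    congr 2
    push_cast; ring

theorem Tshift_zero (n : ℕ) : Tshift n 0 = T n := by
  ext i j : 2; simp [Tshift]

theorem Tshift_map_shift (n : ℕ) (a b : ℤ) : (Tshift n b).map (shift a) = Tshift n (a + b) := by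
  ext i j : 2; simp [Tshift, shift_shift]

end ShiftLemmas

/-! ### Operators on tensor powers indexed by an arbitrary finite type -/

section Tensors

set_option linter.unusedSectionVars false

variable {ι κ : Type*} [Fintype ι] [DecidableEq ι] [Fintype κ] [DecidableEq κ]
variable {A : Type*} [Ring A] {n : ℕ}

/-- The matrix `M` acting in the tensor factor `s`. -/
def site (s : ι) (M : Matrix (Fin n) (Fin n) A) : Matrix (ι → Fin n) (ι → Fin n) A :=
  Matrix.of fun I J => if ∀ t, t ≠ s → I t = J t then M (I s) (J s) else 0

/-- The permutation `σ` of the tensor factors. -/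
def tensorPerm (σ : Equiv.Perm ι) : Matrix (ι → Fin n) (ι → Fin n) A :=
  Matrix.of fun I J => if I = J ∘ σ.symm then 1 else 0

theorem leg_eq_site {k : ℕ} (s : Fin k) (M : Matrix (Fin n) (Fin n) A) : leg s M = site s M := by
  ext I J
  simp only [leg, site, Matrix.of_apply]
  congr

theorem permOp_eq_tensorPerm {k : ℕ} (σ : Equiv.Perm (Fin k)) :
    (permOp σ : TensorEnd n k A) = tensorPerm σ := rfl

theorem mul_site_apply (F : Matrix (ι → Fin n) (ι → Fin n) A) (s : ι)
    (M : Matrix (Fin n) (Fin n) A) (I J : ι → Fin n) :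
    (F * site s M) I J = ∑ b, F I (Function.update J s b) * M b (J s) := by
  rw [Matrix.mul_apply]
  symm
  refine Finset.sum_of_injOn (fun b => Function.update J s b)
    (fun a _ b _ h => by simpa using congrFun h s) (fun _ _ => by simp) ?_ ?_
  · intro K _ hK
    rw [site, Matrix.of_apply, if_neg, mul_zero]
    intro h
    refine hK ⟨K s, by simp, ?_⟩
    funext t
    by_cases ht : t = s
    · subst ht; simp
    · simp [ht, h t ht]
  · intro b _
    rw [site, Matrix.of_apply, if_pos]
    · simp
    · intro t ht; simp [ht]

theorem tensorPerm_mul_apply (σ : Equiv.Perm ι) (F : Matrix (ι → Fin n) (ι → Fin n) A)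
    (I J : ι → Fin n) :
    (tensorPerm σ * F : Matrix (ι → Fin n) (ι → Fin n) A) I J = F (I ∘ σ) J := by
  rw [Matrix.mul_apply, Finset.sum_eq_single (I ∘ σ)]
  · simp [tensorPerm, Function.comp_assoc]
  · intro K _ hK
    rw [tensorPerm, Matrix.of_apply, if_neg, zero_mul]
    rintro rfl
    exact hK (by simp [Function.comp_assoc])
  · simp

theorem mul_tensorPerm_apply (σ : Equiv.Perm ι) (F : Matrix (ι → Fin n) (ι → Fin n) A)
    (I J : ι → Fin n) :
    (F * tensorPerm σ : Matrix (ι → Fin n) (ι → Fin n) A) I J = F I (J ∘ σ.symm) := by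
  rw [Matrix.mul_apply, Finset.sum_eq_single (J ∘ σ.symm)]
  · simp [tensorPerm]
  · intro K _ hK
    rw [tensorPerm, Matrix.of_apply, if_neg hK, mul_zero]
  · simp

theorem tensorPerm_one : (tensorPerm 1 : Matrix (ι → Fin n) (ι → Fin n) A) = 1 := by
  ext I J
  simp only [tensorPerm, Matrix.of_apply, Matrix.one_apply]
  rfl

theorem tensorPerm_mul (σ τ : Equiv.Perm ι) :
    (tensorPerm (σ * τ) : Matrix (ι → Fin n) (ι → Fin n) A) = tensorPerm σ * tensorPerm τ := by
  ext I J
  rw [tensorPerm_mul_apply]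
  simp only [tensorPerm, Matrix.of_apply]
  congr 1
  apply propext
  constructor
  · rintro rfl
    funext t; simp [Function.comp, Equiv.Perm.mul_def]
  · intro h
    funext t
    have := congrFun h (σ.symm t)
    simpa [Function.comp, Equiv.Perm.mul_def] using this

theorem tensorPerm_mul_site (σ : Equiv.Perm ι) (s : ι) (M : Matrix (Fin n) (Fin n) A) :
    tensorPerm σ * site s M = site (σ s) M * tensorPerm σ := by
  ext I J
  rw [tensorPerm_mul_apply, mul_tensorPerm_apply]
  simp only [site, Matrix.of_apply, Function.comp_apply, Equiv.symm_apply_apply]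
  congr 1
  apply propext
  constructor
  · intro h t ht
    simpa using h (σ.symm t) (by rintro rfl; simp at ht)
  · intro h t ht
    simpa using h (σ t) (by simpa using ht)

/-- Over a noncommutative ring the trace is not cyclic; permutation operators may be moved because
they only relabel the basis. -/
theorem trace_tensorPerm_mul (σ : Equiv.Perm ι) (F : Matrix (ι → Fin n) (ι → Fin n) A) :
    (tensorPerm σ * F).trace = (F * tensorPerm σ).trace := by
  simp only [Matrix.trace, Matrix.diag, tensorPerm_mul_apply, mul_tensorPerm_apply]
  refine Fintype.sum_equiv (σ.arrowCongr (Equiv.refl _)).symm _ _ fun I => ?_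
  congr 1
  funext t; simp

theorem site_mul_site_apply {s t : ι} (hst : s ≠ t) (M N : Matrix (Fin n) (Fin n) A)
    (I J : ι → Fin n) :
    (site s M * site t N) I J =
      if ∀ r, r ≠ s → r ≠ t → I r = J r then M (I s) (J s) * N (I t) (J t) else 0 := by
  rw [mul_site_apply, Finset.sum_eq_single (I t)]
  · simp only [site, Matrix.of_apply, Function.update_of_ne hst, ite_mul, zero_mul]
    congr 1
    apply propext
    constructor
    · intro h r hs ht
      simpa [ht] using h r hs
    · intro h r hs
      by_cases ht : r = t
      · subst ht; simp
      · simpa [ht] using h r hs ht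
  · intro b _ hb
    rw [site, Matrix.of_apply, if_neg, zero_mul]
    intro h
    exact hb (by simpa using (h t hst.symm).symm)
  · simp

/-- The entries of the relation `(c - w P) M₁ N₂ = N₂ M₁ (c - w P)`. -/
def RTT {K : Type*} [CommRing K] [Algebra K A] (c w : K) (M N : Matrix (Fin n) (Fin n) A) : Prop :=
  ∀ i j k l, c • (M i j * N k l - N k l * M i j) = w • (M k j * N i l - N k j * M i l)

/-- Both sides vanish unless the two multi-indices agree away from s and t; in that case the
identity is one instance of the entrywise relation. -/
theorem RTT.exchange {K : Type*} [CommRing K] [Algebra K A] {c w : K} {M N : Matrix (Fin n) (Fin n) A}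
    (h : RTT c w M N) {s t : ι} (hst : s ≠ t) :
    (c • 1 - w • tensorPerm (Equiv.swap s t)) * (site s M * site t N) =
      site t N * site s M * (c • 1 - w • tensorPerm (Equiv.swap s t)) := by
  rw [sub_mul, mul_sub, smul_mul_assoc, mul_smul_comm, smul_mul_assoc, mul_smul_comm, one_mul,
    mul_one]
  ext I J
  have hI : (∀ r, r ≠ s → r ≠ t → (I ∘ Equiv.swap s t) r = J r) ↔
      ∀ r, r ≠ s → r ≠ t → I r = J r :=
    forall₃_congr fun r hs ht => by simp [Equiv.swap_apply_of_ne_of_ne hs ht]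
  have hJ : (∀ r, r ≠ t → r ≠ s → I r = (J ∘ Equiv.swap s t) r) ↔
      ∀ r, r ≠ s → r ≠ t → I r = J r :=
    ⟨fun h r hs ht => by simpa [Equiv.swap_apply_of_ne_of_ne hs ht] using h r ht hs,
      fun h r ht hs => by simpa [Equiv.swap_apply_of_ne_of_ne hs ht] using h r hs ht⟩
  have hJ' : (∀ r, r ≠ t → r ≠ s → I r = J r) ↔ ∀ r, r ≠ s → r ≠ t → I r = J r :=
    ⟨fun h r hs ht => h r ht hs, fun h r ht hs => h r hs ht⟩
  rw [Matrix.sub_apply, Matrix.sub_apply, Matrix.smul_apply, Matrix.smul_apply, Matrix.smul_apply,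
    Matrix.smul_apply, tensorPerm_mul_apply, mul_tensorPerm_apply, Equiv.symm_swap,
    site_mul_site_apply hst, site_mul_site_apply hst, site_mul_site_apply hst.symm,
    site_mul_site_apply hst.symm, if_congr hI rfl rfl, if_congr hJ rfl rfl, if_congr hJ' rfl rfl]
  split_ifs
  · have := h (I s) (J s) (I t) (J t)
    rw [smul_sub, smul_sub] at this
    simp only [Function.comp_apply, Equiv.swap_apply_left, Equiv.swap_apply_right]
    rw [sub_eq_sub_iff_add_eq_add] at this ⊢
    rw [this, add_comm]
  · simp

/-! #### Tensor products of operators -/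

/-- `F ↦ F ⊗ 1`. -/
def tensorLeft : Matrix (ι → Fin n) (ι → Fin n) A →+* Matrix (ι ⊕ κ → Fin n) (ι ⊕ κ → Fin n) A :=
  ((Matrix.reindexAlgEquiv ℤ A (Equiv.sumArrowEquivProdArrow ι κ (Fin n)).symm).toRingEquiv :
      Matrix ((ι → Fin n) × (κ → Fin n)) ((ι → Fin n) × (κ → Fin n)) A →+* _).comp
    (((Matrix.compRingEquiv (ι → Fin n) (κ → Fin n) A) : _ →+* _).comp
      (Matrix.scalar (κ → Fin n)).mapMatrix)

/-- `G ↦ 1 ⊗ G`. -/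
def tensorRight : Matrix (κ → Fin n) (κ → Fin n) A →+* Matrix (ι ⊕ κ → Fin n) (ι ⊕ κ → Fin n) A :=
  ((Matrix.reindexAlgEquiv ℤ A (Equiv.sumArrowEquivProdArrow ι κ (Fin n)).symm).toRingEquiv :
      Matrix ((ι → Fin n) × (κ → Fin n)) ((ι → Fin n) × (κ → Fin n)) A →+* _).comp
    (((Matrix.compRingEquiv (ι → Fin n) (κ → Fin n) A) : _ →+* _).comp
      (Matrix.scalar (ι → Fin n)))

theorem tensorLeft_apply (F : Matrix (ι → Fin n) (ι → Fin n) A) (I J : ι ⊕ κ → Fin n) :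
    tensorLeft F I J =
      if I ∘ Sum.inr = J ∘ Sum.inr then F (I ∘ Sum.inl) (J ∘ Sum.inl) else 0 := by
  simp [tensorLeft, Matrix.compRingEquiv_apply, Matrix.comp_apply, Matrix.diagonal_apply,
    Equiv.sumArrowEquivProdArrow]

theorem tensorRight_apply (G : Matrix (κ → Fin n) (κ → Fin n) A) (I J : ι ⊕ κ → Fin n) :
    tensorRight G I J =
      if I ∘ Sum.inl = J ∘ Sum.inl then G (I ∘ Sum.inr) (J ∘ Sum.inr) else 0 := by
  simp [tensorRight, Matrix.compRingEquiv_apply, Matrix.comp_apply, Matrix.diagonal_apply,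
    Equiv.sumArrowEquivProdArrow]
  split_ifs <;> rfl

/-- The order of the factors matters over a noncommutative ring: this lemma and
`trace_tensorRight_mul_tensorLeft` produce the two products of traces that commutativity has to
identify. -/
theorem trace_tensorLeft_mul_tensorRight (F : Matrix (ι → Fin n) (ι → Fin n) A)
    (G : Matrix (κ → Fin n) (κ → Fin n) A) :
    (tensorLeft F * tensorRight G : Matrix (ι ⊕ κ → Fin n) (ι ⊕ κ → Fin n) A).trace =
      F.trace * G.trace := by
  simp only [Matrix.trace, Matrix.diag, Matrix.mul_apply, Finset.sum_mul_sum]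
  refine (Fintype.sum_equiv (Equiv.sumArrowEquivProdArrow ι κ (Fin n)) _
    (fun q => F q.1 q.1 * G q.2 q.2) fun I => ?_).trans
      (Fintype.sum_prod_type' fun a b => F a a * G b b)
  rw [Finset.sum_eq_single I]
  · simp [tensorLeft_apply, tensorRight_apply, Equiv.sumArrowEquivProdArrow]
  · intro J _ hJ
    rw [tensorLeft_apply, tensorRight_apply]
    split_ifs with h1 h2
    · refine absurd ?_ hJ
      funext t
      cases t with
      | inl t => exact congrFun h2 t
      | inr t => exact (congrFun h1 t).symm
    all_goals simp
  · simp

theorem trace_tensorRight_mul_tensorLeft (F : Matrix (ι → Fin n) (ι → Fin n) A)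
    (G : Matrix (κ → Fin n) (κ → Fin n) A) :
    (tensorRight G * tensorLeft F : Matrix (ι ⊕ κ → Fin n) (ι ⊕ κ → Fin n) A).trace =
      G.trace * F.trace := by
  simp only [Matrix.trace, Matrix.diag, Matrix.mul_apply, Finset.sum_mul_sum]
  refine (Fintype.sum_equiv (Equiv.sumArrowEquivProdArrow ι κ (Fin n)) _
    (fun q => G q.2 q.2 * F q.1 q.1) fun I => ?_).trans
      (Fintype.sum_prod_type_right' fun a b => G b b * F a a)
  rw [Finset.sum_eq_single I]
  · simp [tensorLeft_apply, tensorRight_apply, Equiv.sumArrowEquivProdArrow]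
  · intro J _ hJ
    rw [tensorLeft_apply, tensorRight_apply]
    split_ifs with h1 h2
    · refine absurd ?_ hJ
      funext t
      cases t with
      | inl t => exact (congrFun h1 t).symm
      | inr t => exact congrFun h2 t
    all_goals simp
  · simp

theorem tensorLeft_site (s : ι) (M : Matrix (Fin n) (Fin n) A) :
    tensorLeft (κ := κ) (site s M) = site (Sum.inl s) M := by
  ext I J
  simp only [tensorLeft_apply, site, Matrix.of_apply, Function.comp_apply, ← ite_and]
  congr 1
  apply propext
  constructor
  · rintro ⟨h1, h2⟩ (t | t) ht
    · exact h2 t (by rintro rfl; exact ht rfl)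
    · exact congrFun h1 t
  · intro h
    exact ⟨funext fun t => h _ (by simp), fun t ht => h _ (by simpa using ht)⟩

theorem tensorRight_site (s : κ) (M : Matrix (Fin n) (Fin n) A) :
    tensorRight (ι := ι) (site s M) = site (Sum.inr s) M := by
  ext I J
  simp only [tensorRight_apply, site, Matrix.of_apply, Function.comp_apply, ← ite_and]
  congr 1
  apply propext
  constructor
  · rintro ⟨h1, h2⟩ (t | t) ht
    · exact congrFun h1 t
    · exact h2 t (by rintro rfl; exact ht rfl)
  · intro h
    exact ⟨funext fun t => h _ (by simp), fun t ht => h _ (by simpa using ht)⟩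

theorem tensorLeft_tensorPerm (σ : Equiv.Perm ι) :
    tensorLeft (κ := κ) (tensorPerm σ : Matrix (ι → Fin n) (ι → Fin n) A) =
      tensorPerm (Equiv.Perm.sumCongr σ 1) := by
  ext I J
  simp only [tensorLeft_apply, tensorPerm, Matrix.of_apply, ← ite_and]
  congr 1
  apply propext
  constructor
  · rintro ⟨h1, h2⟩
    funext t
    cases t with
    | inl t => exact congrFun h2 t
    | inr t => exact congrFun h1 t
  · intro h
    exact ⟨funext fun t => congrFun h (Sum.inr t), funext fun t => congrFun h (Sum.inl t)⟩

theorem tensorRight_tensorPerm (σ : Equiv.Perm κ) :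
    tensorRight (ι := ι) (tensorPerm σ : Matrix (κ → Fin n) (κ → Fin n) A) =
      tensorPerm (Equiv.Perm.sumCongr 1 σ) := by
  ext I J
  simp only [tensorRight_apply, tensorPerm, Matrix.of_apply, ← ite_and]
  congr 1
  apply propext
  constructor
  · rintro ⟨h1, h2⟩
    funext t
    cases t with
    | inl t => exact congrFun h1 t
    | inr t => exact congrFun h2 t
  · intro h
    exact ⟨funext fun t => congrFun h (Sum.inl t), funext fun t => congrFun h (Sum.inr t)⟩

end Tensors

/-! ### Operators compatible with antisymmetrization -/

section Compatible

variable {E : Type*} [Ring E]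

/-- For an involution `P`, the operator `Z` maps the image of `1 + P` into itself, that is,
`Z` is compatible with passing to the quotient by the symmetric tensors. -/
def Compat (P Z : E) : Prop := (1 - P) * Z * (1 + P) = 0

/-- Operators preserving a subspace are closed under composition. Algebraically, compatibility of Y
gives (1-P)Y(1-P) = 2(1-P)Y, and the 2 is then divided out. -/
theorem Compat.mul [Algebra ℂ E] {P Y Z : E} (hY : Compat P Y) (hZ : Compat P Z) :
    Compat P (Y * Z) := by
  have h1 : (1 - P) * Y * P = -((1 - P) * Y) := by
    have := hY
    rw [Compat, mul_add, mul_one] at this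
    exact (neg_eq_of_add_eq_zero_right this).symm
  have h2 : (1 - P) * Y * ((1 - P) * Z * (1 + P)) = 0 := by rw [hZ, mul_zero]
  have h3 : (1 - P) * Y * ((1 - P) * Z * (1 + P)) =
      (2 : ℂ) • ((1 - P) * (Y * Z) * (1 + P)) := by
    calc (1 - P) * Y * ((1 - P) * Z * (1 + P))
        = ((1 - P) * Y - (1 - P) * Y * P) * (Z * (1 + P)) := by noncomm_ring
      _ = _ := by rw [h1, two_smul]; noncomm_ring
  rw [h3] at h2
  exact (smul_eq_zero.mp h2).resolve_left two_ne_zero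

theorem Compat.of_commute {P Z : E} (hP : P * P = 1) (h : Commute P Z) : Compat P Z := by
  have : (1 - P) * Z * (1 + P) = Z * (1 - P * P) + (Z * P - P * Z) * (1 + P) := by
    noncomm_ring
  rw [Compat, this, hP, h.eq]
  simp

theorem Compat.one {P : E} (hP : P * P = 1) : Compat P (1 : E) :=
  .of_commute hP (Commute.one_right P)

theorem Compat.of_exchange {P Z Z' : E} (hP : P * P = 1) (h : (1 - P) * Z = Z' * (1 - P)) :
    Compat P Z := by
  have : (1 - P) * (1 + P) = 1 - P * P := by noncomm_ring
  rw [Compat, h, mul_assoc, this, hP, sub_self, mul_zero]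

/-- Right antisymmetry of B survives multiplication by a compatible Z; this is how local
compatibility is turned into identities BZB = BZ for an antisymmetrizer B. -/
theorem Compat.mul_eq_neg [Algebra ℂ E] {P Z B : E} (h : Compat P Z) (hB : B * P = -B) :
    B * Z * P = -(B * Z) := by
  have h1 : B * (1 - P) = (2 : ℂ) • B := by rw [mul_sub, hB, two_smul]; simp
  have h2 : (2 : ℂ) • (B * Z * (1 + P)) = 0 := by
    rw [← smul_mul_assoc, ← smul_mul_assoc, ← h1, mul_assoc B, mul_assoc B, h, mul_zero]
  have h3 := (smul_eq_zero.mp h2).resolve_left two_ne_zero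
  rw [mul_add, mul_one] at h3
  exact (neg_eq_of_add_eq_zero_right h3).symm

/-- The Yang–Baxter equation at the point where the `R`-matrix degenerates to `1 - P`. -/
theorem Compat.yangBaxter {K : Type*} [CommRing K] [Algebra K E] {P Q Q' : E} (hP : P * P = 1)
    (hQ : Q * Q = 1) (h : P * Q * P = Q') (h' : Q * P * Q = Q') (c c' w : K) (hc : c = c' + w) :
    Compat P ((c • 1 - w • Q) * (c' • 1 - w • Q')) := by
  have e0 : (1 - P) * (1 + P) = 0 := by
    have : (1 - P) * (1 + P) = 1 - P * P := by noncomm_ring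
    rw [this, hP, sub_self]
  have eP : (1 - P) * P = -(1 - P) := by rw [sub_mul, one_mul, hP]; abel
  have eP' : P * (1 + P) = 1 + P := by rw [mul_add, mul_one, hP, add_comm]
  have e1 : (1 - P) * Q' * (1 + P) = -((1 - P) * Q * (1 + P)) := by
    rw [← h]
    calc (1 - P) * (P * Q * P) * (1 + P) = ((1 - P) * P) * Q * (P * (1 + P)) := by noncomm_ring
      _ = _ := by rw [eP, eP']; noncomm_ring
  have e2 : (1 - P) * (Q * Q') * (1 + P) = -((1 - P) * Q * (1 + P)) := by
    rw [← h']
    calc (1 - P) * (Q * (Q * P * Q)) * (1 + P)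
        = (1 - P) * ((Q * Q) * P * Q) * (1 + P) := by noncomm_ring
      _ = ((1 - P) * P) * Q * (1 + P) := by rw [hQ]; noncomm_ring
      _ = _ := by rw [eP]; noncomm_ring
  have e3 : (c • 1 - w • Q) * (c' • 1 - w • Q') =
      (c * c') • (1 : E) - (c * w) • Q' - (w * c') • Q + (w * w) • (Q * Q') := by
    simp only [sub_mul, mul_sub, smul_mul_assoc, mul_smul_comm, one_mul, mul_one]
    module
  rw [Compat, e3]
  have e4 : (1 - P) * ((c * c') • (1 : E) - (c * w) • Q' - (w * c') • Q + (w * w) • (Q * Q')) *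
      (1 + P) = (c * c') • ((1 - P) * (1 + P)) - (c * w) • ((1 - P) * Q' * (1 + P))
        - (w * c') • ((1 - P) * Q * (1 + P)) + (w * w) • ((1 - P) * (Q * Q') * (1 + P)) := by
    simp only [mul_add, mul_sub, add_mul, sub_mul, mul_smul_comm, smul_mul_assoc, mul_one, one_mul,
      smul_add, smul_sub]
    abel
  -- Every surviving term is a multiple of (1-P)Q(1+P); the total coefficient is w(c - c' - w) = 0.
  rw [e4, e0, e1, e2, hc]
  module

end Compatible

/-! ### Ordered products and exchange relations between blocks of operators. -/

section Exchange

variable {E : Type*} [Ring E]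

/-- The ordered product `a 0 * a 1 * ⋯ * a (k - 1)`. -/
def ordProd (a : ℕ → E) : ℕ → E
  | 0 => 1
  | k + 1 => ordProd a k * a k

/-- The reversed product `a (k - 1) * ⋯ * a 1 * a 0`. -/
def revProd (a : ℕ → E) : ℕ → E
  | 0 => 1
  | k + 1 => a k * revProd a k

theorem ordProd_commute {a : ℕ → E} {z : E} {k : ℕ} (h : ∀ s < k, Commute z (a s)) :
    Commute z (ordProd a k) := by
  induction k with
  | zero => exact Commute.one_right z
  | succ k ih => exact (ih fun s hs => h s (by omega)).mul_right (h k (by omega))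

theorem revProd_commute {a : ℕ → E} {z : E} {k : ℕ} (h : ∀ s < k, Commute z (a s)) :
    Commute z (revProd a k) := by
  induction k with
  | zero => exact Commute.one_right z
  | succ k ih => exact (h k (by omega)).mul_right (ih fun s hs => h s (by omega))

theorem ordProd_eq_ofFn (a : ℕ → E) (k : ℕ) :
    ordProd a k = (List.ofFn fun s : Fin k => a s).prod := by
  induction k with
  | zero => rfl
  | succ k ih =>
    rw [ordProd, ih, List.ofFn_succ', List.concat_eq_append, List.prod_append]
    simp

theorem Compat.ordProd_of_forall [Algebra ℂ E] {P : E} (hP : P * P = 1) {a : ℕ → E} {k : ℕ}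
    (h : ∀ s < k, Compat P (a s)) : Compat P (ordProd a k) := by
  induction k with
  | zero => exact .one hP
  | succ k ih => exact (ih fun s hs => h s (by omega)).mul (h k (by omega))

theorem Compat.revProd_of_forall [Algebra ℂ E] {P : E} (hP : P * P = 1) {a : ℕ → E} {k : ℕ}
    (h : ∀ s < k, Compat P (a s)) : Compat P (revProd a k) := by
  induction k with
  | zero => exact .one hP
  | succ k ih => exact (h k (by omega)).mul (ih fun s hs => h s (by omega))

/-- In the application P swaps positions i and i+1. The other factors commute with P, hence are
compatible, so only the adjacent pair needs an argument. -/
theorem Compat.ordProd [Algebra ℂ E] {P : E} (hP : P * P = 1) {a : ℕ → E} {i k : ℕ}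
    (hik : i + 1 < k)
    (hc : ∀ s < k, s ≠ i → s ≠ i + 1 → Commute P (a s)) (h : Compat P (a i * a (i + 1))) :
    Compat P (ordProd a k) := by
  induction k with
  | zero => omega
  | succ k ih =>
    rcases Nat.lt_or_ge (i + 1) k with hk | hk
    · exact (ih hk fun s hs => hc s (by omega)).mul
        (.of_commute hP (hc k (by omega) (by omega) (by omega)))
    · obtain rfl : k = i + 1 := by omega
      rw [YangianBethe.ordProd, YangianBethe.ordProd, mul_assoc]
      exact (Compat.of_commute hP (ordProd_commute fun s hs => hc s (by omega) (by omega)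
        (by omega))).mul h

theorem Compat.revProd [Algebra ℂ E] {P : E} (hP : P * P = 1) {a : ℕ → E} {i k : ℕ}
    (hik : i + 1 < k)
    (hc : ∀ s < k, s ≠ i → s ≠ i + 1 → Commute P (a s)) (h : Compat P (a (i + 1) * a i)) :
    Compat P (revProd a k) := by
  induction k with
  | zero => omega
  | succ k ih =>
    rcases Nat.lt_or_ge (i + 1) k with hk | hk
    · exact (Compat.of_commute hP (hc k (by omega) (by omega) (by omega))).mul
        (ih hk fun s hs => hc s (by omega))
    · obtain rfl : k = i + 1 := by omega
      rw [YangianBethe.revProd, YangianBethe.revProd, ← mul_assoc]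
      exact h.mul (Compat.of_commute hP (revProd_commute fun s hs => hc s (by omega) (by omega)
        (by omega)))

/-- Two neighbouring columns of R-matrices are regrouped this way into pairs sharing a site, the
form to which the Yang–Baxter equation applies. -/
theorem ordProd_mul_ordProd {a b : ℕ → E} {k : ℕ}
    (h : ∀ s < k, ∀ t < k, s ≠ t → Commute (a s) (b t)) :
    ordProd a k * ordProd b k = ordProd (fun s => a s * b s) k := by
  induction k with
  | zero => simp [ordProd]
  | succ k ih =>
    have hc : Commute (a k) (ordProd b k) :=
      ordProd_commute fun t ht => h k (by omega) t (by omega) (by omega)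
    rw [ordProd, ordProd, ordProd, ← ih fun s hs t ht => h s (by omega) t (by omega), mul_assoc,
      ← mul_assoc (a k), hc.eq]
    noncomm_ring

theorem revProd_mul_revProd {a b : ℕ → E} {k : ℕ}
    (h : ∀ s < k, ∀ t < k, s ≠ t → Commute (a s) (b t)) :
    revProd a k * revProd b k = revProd (fun s => a s * b s) k := by
  induction k with
  | zero => simp [revProd]
  | succ k ih =>
    have hc : Commute (b k) (revProd a k) :=
      revProd_commute fun t ht => (h t (by omega) k (by omega) (by omega)).symm
    rw [revProd, revProd, revProd, ← ih fun s hs t ht => h s (by omega) t (by omega), mul_assoc,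
      ← mul_assoc (revProd a k), ← hc.eq]
    noncomm_ring

theorem ordProd_mul_revProd {K : Type*} [CommRing K] [Algebra K E] {a b : ℕ → E} {d : ℕ → K}
    {k : ℕ} (h : ∀ s < k, a s * b s = d s • 1) :
    ordProd a k * revProd b k = (∏ s ∈ Finset.range k, d s) • 1 := by
  induction k with
  | zero => simp [ordProd, revProd]
  | succ k ih =>
    rw [ordProd, revProd, mul_assoc, ← mul_assoc (a k), h k (by omega), smul_mul_assoc, one_mul,
      mul_smul_comm, ih fun s hs => h s (by omega), smul_smul, Finset.prod_range_succ, mul_comm]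

theorem revProd_mul_ordProd {K : Type*} [CommRing K] [Algebra K E] {a b : ℕ → E} {d : ℕ → K}
    {k : ℕ} (h : ∀ s < k, a s * b s = d s • 1) :
    revProd a k * ordProd b k = (∏ s ∈ Finset.range k, d s) • 1 := by
  induction k with
  | zero => simp [ordProd, revProd]
  | succ k ih =>
    have : revProd a (k + 1) * ordProd b (k + 1) = a k * (revProd a k * ordProd b k) * b k := by
      rw [ordProd, revProd]; noncomm_ring
    rw [this, ih fun s hs => h s (by omega), mul_smul_comm, mul_one, smul_mul_assoc, h k (by omega),
      smul_smul, Finset.prod_range_succ]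

/-- The operator `∏_j ∏_i R_{ij}` intertwining the products `∏ a_i ∏ b_j` and `∏ b_j ∏ a_i`. -/
def blockR (R : ℕ → ℕ → E) (k l : ℕ) : E := revProd (fun j => ordProd (fun i => R i j) k) l

/-- The product of the same factors as in `blockR` in the opposite order. -/
def blockR' (R : ℕ → ℕ → E) (k l : ℕ) : E := ordProd (fun j => revProd (fun i => R i j) k) l

theorem ordProd_exchange {R a : ℕ → E} {b : E} {k : ℕ}
    (h : ∀ i < k, R i * (a i * b) = b * a i * R i)
    (hc : ∀ i < k, ∀ j < k, i ≠ j → Commute (R i) (a j)) :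
    ordProd R k * (ordProd a k * b) = b * ordProd a k * ordProd R k := by
  induction k with
  | zero => simp [ordProd]
  | succ k ih =>
    have h1 : Commute (R k) (ordProd a k) :=
      ordProd_commute fun j hj => hc k (by omega) j (by omega) (by omega)
    have h2 : Commute (a k) (ordProd R k) :=
      ordProd_commute fun j hj => (hc j (by omega) k (by omega) (by omega)).symm
    have ih' := ih (fun i hi => h i (by omega)) fun i hi j hj => hc i (by omega) j (by omega)
    calc ordProd R (k + 1) * (ordProd a (k + 1) * b)
        = ordProd R k * (R k * ordProd a k) * (a k * b) := by simp only [ordProd, mul_assoc]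
      _ = ordProd R k * ordProd a k * (R k * (a k * b)) := by rw [h1.eq]; simp only [mul_assoc]
      _ = (ordProd R k * (ordProd a k * b)) * a k * R k := by
          rw [h k (by omega)]; simp only [mul_assoc]
      _ = b * ordProd a k * (ordProd R k * a k) * R k := by rw [ih']; simp only [mul_assoc]
      _ = _ := by rw [← h2.eq]; simp only [ordProd, mul_assoc]

/-- One column of R-matrices carries a single b_j through all the a_i. It commutes with the
remaining b's, so the columns can be stacked by induction on l. -/
theorem blockR_exchange {R : ℕ → ℕ → E} {a b : ℕ → E} {k l : ℕ}
    (h : ∀ i < k, ∀ j < l, R i j * (a i * b j) = b j * a i * R i j)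
    (ha : ∀ i < k, ∀ j < l, ∀ s < k, i ≠ s → Commute (R i j) (a s))
    (hb : ∀ i < k, ∀ j < l, ∀ s < l, j ≠ s → Commute (R i j) (b s)) :
    blockR R k l * (ordProd a k * ordProd b l) = ordProd b l * ordProd a k * blockR R k l := by
  induction l with
  | zero => simp [ordProd, blockR, revProd]
  | succ l ih =>
    have ih' := ih (fun i hi j hj => h i hi j (by omega))
      (fun i hi j hj => ha i hi j (by omega))
      (fun i hi j hj s hs => hb i hi j (by omega) s (by omega))
    have h0 := ordProd_exchange (R := fun i => R i l) (a := a) (b := b l) (k := k)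
      (fun i hi => h i hi l (by omega)) fun i hi j hj => ha i hi l (by omega) j hj
    have h1 : Commute (ordProd (fun i => R i l) k) (ordProd b l) :=
      ordProd_commute fun j hj => (ordProd_commute fun i hi =>
        (hb i hi l (by omega) j (by omega) (by omega)).symm).symm
    have h2 : Commute (b l) (blockR R k l) :=
      revProd_commute fun j hj => ordProd_commute fun i hi =>
        (hb i hi j (by omega) l (by omega) (by omega)).symm
    have hB : blockR R k (l + 1) = ordProd (fun i => R i l) k * blockR R k l := rfl
    calc blockR R k (l + 1) * (ordProd a k * ordProd b (l + 1))
        = ordProd (fun i => R i l) k * (blockR R k l * (ordProd a k * ordProd b l)) * b l := by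
          rw [hB]; simp only [ordProd, mul_assoc]
      _ = (ordProd (fun i => R i l) k * ordProd b l) * ordProd a k * (blockR R k l * b l) := by
          rw [ih']; simp only [mul_assoc]
      _ = ordProd b l * (ordProd (fun i => R i l) k * (ordProd a k * b l)) * blockR R k l := by
          rw [h1.eq, ← h2.eq]; simp only [mul_assoc]
      _ = _ := by rw [h0, hB]; simp only [ordProd, mul_assoc]

theorem blockR_mul_blockR' {K : Type*} [CommRing K] [Algebra K E] {R R' : ℕ → ℕ → E}
    {d : ℕ → ℕ → K} {k l : ℕ} (h : ∀ i < k, ∀ j < l, R i j * R' i j = d i j • 1) :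
    blockR R k l * blockR' R' k l =
      (∏ j ∈ Finset.range l, ∏ i ∈ Finset.range k, d i j) • 1 :=
  revProd_mul_ordProd fun j hj => ordProd_mul_revProd fun i hi => h i hi j hj

theorem blockR'_mul_blockR {K : Type*} [CommRing K] [Algebra K E] {R R' : ℕ → ℕ → E}
    {d : ℕ → ℕ → K} {k l : ℕ} (h : ∀ i < k, ∀ j < l, R' i j * R i j = d i j • 1) :
    blockR' R' k l * blockR R k l =
      (∏ j ∈ Finset.range l, ∏ i ∈ Finset.range k, d i j) • 1 :=
  ordProd_mul_revProd fun j hj => revProd_mul_ordProd fun i hi => h i hi j hj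

variable [Algebra ℂ E] {P : E} {R : ℕ → ℕ → E} {k l : ℕ}

theorem Compat.blockR_left (hP : P * P = 1) {i : ℕ} (hi : i + 1 < k)
    (hc : ∀ s < k, ∀ j < l, s ≠ i → s ≠ i + 1 → Commute P (R s j))
    (h : ∀ j < l, Compat P (R i j * R (i + 1) j)) : Compat P (blockR R k l) :=
  .revProd_of_forall hP fun j hj => .ordProd hP hi (fun s hs => hc s hs j hj) (h j hj)

theorem Compat.blockR'_left (hP : P * P = 1) {i : ℕ} (hi : i + 1 < k)
    (hc : ∀ s < k, ∀ j < l, s ≠ i → s ≠ i + 1 → Commute P (R s j))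
    (h : ∀ j < l, Compat P (R (i + 1) j * R i j)) : Compat P (blockR' R k l) :=
  .ordProd_of_forall hP fun j hj => .revProd hP hi (fun s hs => hc s hs j hj) (h j hj)

theorem Compat.blockR_right (hP : P * P = 1) {j : ℕ} (hj : j + 1 < l)
    (hc : ∀ i < k, ∀ t < l, t ≠ j → t ≠ j + 1 → Commute P (R i t))
    (hR : ∀ i < k, ∀ s < k, i ≠ s → Commute (R i (j + 1)) (R s j))
    (h : ∀ i < k, Compat P (R i (j + 1) * R i j)) : Compat P (blockR R k l) := by
  refine .revProd hP hj (fun t ht h1 h2 => ordProd_commute fun i hi => hc i hi t ht h1 h2) ?_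
  rw [ordProd_mul_ordProd hR]
  exact .ordProd_of_forall hP h

theorem Compat.blockR'_right (hP : P * P = 1) {j : ℕ} (hj : j + 1 < l)
    (hc : ∀ i < k, ∀ t < l, t ≠ j → t ≠ j + 1 → Commute P (R i t))
    (hR : ∀ i < k, ∀ s < k, i ≠ s → Commute (R i j) (R s (j + 1)))
    (h : ∀ i < k, Compat P (R i j * R i (j + 1))) : Compat P (blockR' R k l) := by
  refine .ordProd hP hj (fun t ht h1 h2 => revProd_commute fun i hi => hc i hi t ht h1 h2) ?_
  rw [revProd_mul_revProd hR]
  exact .revProd_of_forall hP h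

end Exchange

/-! ### Antisymmetrizers -/

section Alternation

set_option linter.unusedSectionVars false

variable {E : Type*} [Ring E] [Algebra ℂ E]

/-- The image of the antisymmetrizer under a representation of the symmetric group. -/
def altSum {k : ℕ} (ψ : Equiv.Perm (Fin k) →* E) : E :=
  ((k.factorial : ℂ)⁻¹) • ∑ σ : Equiv.Perm (Fin k), (Equiv.Perm.sign σ : ℤ) • ψ σ

theorem altSum_mul {k : ℕ} (ψ : Equiv.Perm (Fin k) →* E) (τ : Equiv.Perm (Fin k)) :
    altSum ψ * ψ τ = (Equiv.Perm.sign τ : ℤ) • altSum ψ := by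
  rw [altSum, smul_mul_assoc, Finset.sum_mul, smul_comm,
    Finset.smul_sum (r := (Equiv.Perm.sign τ : ℤ))]
  congr 1
  refine Fintype.sum_equiv (Equiv.mulRight τ) _ _ fun σ => ?_
  rw [Equiv.coe_mulRight, smul_mul_assoc, ← map_mul, smul_smul, Equiv.Perm.sign_mul, mul_comm]
  push_cast
  rw [mul_assoc, ← Units.val_mul, Int.units_mul_self, Units.val_one, mul_one]

/-- Adjacent transpositions generate the symmetric group, so antisymmetry is only tested on them. -/
theorem mul_map_of_adjacent {k : ℕ} (ψ : Equiv.Perm (Fin (k + 1)) →* E) {F : E}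
    (h : ∀ i : Fin k, F * ψ (Equiv.swap i.castSucc i.succ) = -F) (σ : Equiv.Perm (Fin (k + 1))) :
    F * ψ σ = (Equiv.Perm.sign σ : ℤ) • F := by
  have hσ : σ ∈ Submonoid.closure (Set.range fun i : Fin k => Equiv.swap i.castSucc i.succ) := by
    rw [Equiv.Perm.mclosure_swap_castSucc_succ]; trivial
  induction hσ using Submonoid.closure_induction with
  | mem x hx =>
    obtain ⟨i, rfl⟩ := hx
    rw [h i, Equiv.Perm.sign_swap (Fin.castSucc_lt_succ).ne]
    simp
  | one => simp
  | mul x y _ _ hx hy =>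
    rw [map_mul, ← mul_assoc, hx, smul_mul_assoc, hy, smul_smul, Equiv.Perm.sign_mul]
    push_cast
    rfl

theorem mul_altSum_of_adjacent {k : ℕ} (ψ : Equiv.Perm (Fin (k + 1)) →* E) {F : E}
    (h : ∀ i : Fin k, F * ψ (Equiv.swap i.castSucc i.succ) = -F) : F * altSum ψ = F := by
  rw [altSum, mul_smul_comm, Finset.mul_sum]
  have : ∀ σ : Equiv.Perm (Fin (k + 1)), F * ((Equiv.Perm.sign σ : ℤ) • ψ σ) = F := by
    intro σ
    rw [mul_smul_comm, mul_map_of_adjacent ψ h, smul_smul, ← Units.val_mul, Int.units_mul_self,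
      Units.val_one, one_smul]
  rw [Finset.sum_congr rfl fun σ _ => this σ, Finset.sum_const, Finset.card_univ,
    Fintype.card_perm, Fintype.card_fin, ← Nat.cast_smul_eq_nsmul ℂ, smul_smul,
    inv_mul_cancel₀ (by exact_mod_cast Nat.factorial_ne_zero _), one_smul]

theorem Commute.altSum_right {k : ℕ} {ψ : Equiv.Perm (Fin k) →* E} {z : E}
    (h : ∀ σ, Commute z (ψ σ)) : Commute z (altSum ψ) :=
  .smul_right (.sum_right _ _ _ fun σ _ => (h σ).smul_right _) _

end Alternation

/-! ### Cyclicity of the trace over a noncommutative ring. -/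

section CyclicTrace

variable {ι : Type*} [Fintype ι] {A : Type*} [Ring A]

/-- The operators which may be moved cyclically under the trace. -/
def TraceCommutes (U : Matrix ι ι A) : Prop := ∀ V, (U * V).trace = (V * U).trace

theorem TraceCommutes.mul {U V : Matrix ι ι A} (hU : TraceCommutes U) (hV : TraceCommutes V) :
    TraceCommutes (U * V) := fun W => by
  rw [Matrix.mul_assoc, hU, Matrix.mul_assoc, hV, Matrix.mul_assoc]

theorem TraceCommutes.sub {U V : Matrix ι ι A} (hU : TraceCommutes U) (hV : TraceCommutes V) :
    TraceCommutes (U - V) := fun W => by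
  rw [Matrix.sub_mul, Matrix.mul_sub, Matrix.trace_sub, Matrix.trace_sub, hU, hV]

theorem TraceCommutes.smul {K : Type*} [CommRing K] [Algebra K A] {U : Matrix ι ι A}
    (hU : TraceCommutes U) (c : K) : TraceCommutes (c • U) := fun W => by
  rw [Matrix.smul_mul, Matrix.mul_smul, Matrix.trace_smul, Matrix.trace_smul, hU]

theorem TraceCommutes.sum {α : Type*} {s : Finset α} {U : α → Matrix ι ι A}
    (hU : ∀ x ∈ s, TraceCommutes (U x)) : TraceCommutes (∑ x ∈ s, U x) := fun W => by
  rw [Matrix.sum_mul, Matrix.mul_sum, Matrix.trace_sum, Matrix.trace_sum]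
  exact Finset.sum_congr rfl fun x hx => hU x hx W

theorem TraceCommutes.one [DecidableEq ι] : TraceCommutes (1 : Matrix ι ι A) := fun W => by
  rw [Matrix.one_mul, Matrix.mul_one]

theorem TraceCommutes.ordProd [DecidableEq ι] {a : ℕ → Matrix ι ι A} {k : ℕ}
    (h : ∀ s < k, TraceCommutes (a s)) : TraceCommutes (ordProd a k) := by
  induction k with
  | zero => exact .one
  | succ k ih => exact (ih fun s hs => h s (by omega)).mul (h k (by omega))

theorem TraceCommutes.revProd [DecidableEq ι] {a : ℕ → Matrix ι ι A} {k : ℕ}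
    (h : ∀ s < k, TraceCommutes (a s)) : TraceCommutes (revProd a k) := by
  induction k with
  | zero => exact .one
  | succ k ih => exact (h k (by omega)).mul (ih fun s hs => h s (by omega))

theorem TraceCommutes.altSum [DecidableEq ι] [Algebra ℂ A] {k : ℕ}
    {ψ : Equiv.Perm (Fin k) →* Matrix ι ι A}
    (h : ∀ σ, TraceCommutes (ψ σ)) : TraceCommutes (altSum ψ) :=
  (TraceCommutes.sum fun σ _ => (h σ).smul _).smul _

/-- Conjugate operators have equal traces against a projection compatible with the conjugation. -/
theorem smul_trace_eq_of_exchange [DecidableEq ι] {K : Type*} [CommRing K] [Algebra K A] {d : K}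
    {B R R' U V : Matrix ι ι A} (hex : R * U = V * R) (hRR' : R * R' = d • 1)
    (hR'R : R' * R = d • 1) (hR : B * R * B = B * R) (hR' : B * R' * B = B * R')
    (hU : B * U * B = B * U) (tB : TraceCommutes B) (tR' : TraceCommutes R') :
    d • (B * V).trace = d • (B * U).trace := by
  -- Only B and R' are moved cyclically, since U and V have noncommuting entries. The copies of B
  -- inserted by `hU` and `hR` and absorbed by `hR'` bring R' next to R. The scalar d stays because
  -- it need not be invertible.
  calc d • (B * V).trace = (B * V * (R * R')).trace := by
        rw [hRR', Matrix.mul_smul, Matrix.mul_one, Matrix.trace_smul]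
    _ = (B * (V * R) * R').trace := by simp only [Matrix.mul_assoc]
    _ = (R' * (B * R * U)).trace := by rw [← hex, ← tR', Matrix.mul_assoc B]
    _ = (R' * (B * R * B * U * B)).trace := by
        rw [show B * R * B * U * B = B * R * (B * U * B) by simp only [Matrix.mul_assoc], hU,
          ← Matrix.mul_assoc (B * R), hR]
    _ = (B * (R' * (B * R * B * U))).trace := by rw [tB]; simp only [Matrix.mul_assoc]
    _ = (B * R' * B * (R * B * U)).trace := by simp only [Matrix.mul_assoc]
    _ = (B * (R' * R) * (B * U)).trace := by rw [hR']; simp only [Matrix.mul_assoc]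
    _ = (d • (B * (B * U))).trace := by
        rw [hR'R, Matrix.mul_smul, Matrix.mul_one, Matrix.smul_mul]
    _ = d • (B * U).trace := by rw [Matrix.trace_smul, tB, hU]

end CyclicTrace

/-! ### Permutation operators, antisymmetrizers and R-matrices on tensor factors. -/

section TensorAlternation

variable {ι κ : Type*} [Fintype ι] [DecidableEq ι] [Fintype κ] [DecidableEq κ]
variable {A : Type*} [Ring A] {n : ℕ}

/-- `tensorPerm` as a representation of the symmetric group. -/
def tensorPermHom : Equiv.Perm ι →* Matrix (ι → Fin n) (ι → Fin n) A where
  toFun := tensorPerm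
  map_one' := tensorPerm_one
  map_mul' := tensorPerm_mul

theorem antisymmetrizer_eq_altSum [Algebra ℂ A] (k : ℕ) :
    (antisymmetrizer k : TensorEnd n k A) = altSum tensorPermHom := rfl

theorem traceCommutes_tensorPerm (σ : Equiv.Perm ι) :
    TraceCommutes (tensorPerm σ : Matrix (ι → Fin n) (ι → Fin n) A) :=
  trace_tensorPerm_mul σ

theorem tensorLeft_smul [Algebra ℂ A] (c : ℂ) (F : Matrix (ι → Fin n) (ι → Fin n) A) :
    tensorLeft (κ := κ) (c • F) = c • tensorLeft F := by
  ext I J; simp [tensorLeft_apply]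

theorem tensorRight_smul [Algebra ℂ A] (c : ℂ) (F : Matrix (κ → Fin n) (κ → Fin n) A) :
    tensorRight (ι := ι) (c • F) = c • tensorRight F := by
  ext I J; simp [tensorRight_apply]

theorem tensorLeft_altSum [Algebra ℂ A] {k : ℕ}
    (ψ : Equiv.Perm (Fin k) →* Matrix (ι → Fin n) (ι → Fin n) A) :
    tensorLeft (κ := κ) (altSum ψ) = altSum ((tensorLeft : _ →+* _).toMonoidHom.comp ψ) := by
  simp [altSum, tensorLeft_smul]

theorem tensorRight_altSum [Algebra ℂ A] {k : ℕ}
    (ψ : Equiv.Perm (Fin k) →* Matrix (κ → Fin n) (κ → Fin n) A) :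
    tensorRight (ι := ι) (altSum ψ) = altSum ((tensorRight : _ →+* _).toMonoidHom.comp ψ) := by
  simp [altSum, tensorRight_smul]

theorem tensorPerm_swap_mul_self (s t : ι) :
    (tensorPerm (Equiv.swap s t) * tensorPerm (Equiv.swap s t) :
      Matrix (ι → Fin n) (ι → Fin n) A) = 1 := by
  rw [← tensorPerm_mul, Equiv.swap_mul_self, tensorPerm_one]

theorem commute_tensorPerm_swap {s t s' t' : ι} (h1 : s ≠ s') (h2 : s ≠ t') (h3 : t ≠ s')
    (h4 : t ≠ t') : Commute (tensorPerm (Equiv.swap s t) : Matrix (ι → Fin n) (ι → Fin n) A)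
      (tensorPerm (Equiv.swap s' t')) := by
  have hc : Commute (Equiv.swap s t) (Equiv.swap s' t') := by
    refine Equiv.Perm.Disjoint.commute fun x => ?_
    by_cases hs : x = s
    · subst hs; exact .inr (Equiv.swap_apply_of_ne_of_ne h1 h2)
    by_cases ht : x = t
    · subst ht; exact .inr (Equiv.swap_apply_of_ne_of_ne h3 h4)
    exact .inl (Equiv.swap_apply_of_ne_of_ne hs ht)
  rw [Commute, SemiconjBy, ← tensorPerm_mul, hc.eq, tensorPerm_mul]

theorem commute_tensorPerm_swap_site {s t r : ι} (hs : r ≠ s) (ht : r ≠ t)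
    (M : Matrix (Fin n) (Fin n) A) : Commute (tensorPerm (Equiv.swap s t)) (site r M) := by
  rw [Commute, SemiconjBy, tensorPerm_mul_site, Equiv.swap_apply_of_ne_of_ne hs ht]

theorem compat_tensorPerm_swap {K : Type*} [CommRing K] [Algebra K A] {s s' t : ι} (h1 : s ≠ s')
    (h2 : s ≠ t) (h3 : s' ≠ t) {c c' w : K} (hc : c = c' + w) :
    Compat (tensorPerm (Equiv.swap s s') : Matrix (ι → Fin n) (ι → Fin n) A)
      ((c • 1 - w • tensorPerm (Equiv.swap s t)) * (c' • 1 - w • tensorPerm (Equiv.swap s' t))) := by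
  refine .yangBaxter (tensorPerm_swap_mul_self _ _) (tensorPerm_swap_mul_self _ _) ?_ ?_ c c' w hc
  · rw [← tensorPerm_mul, ← tensorPerm_mul, Equiv.swap_comm s s', Equiv.swap_comm s t,
      Equiv.swap_comm s' t]
    congr 1
    have := Equiv.swap_mul_swap_mul_swap h2.symm h3.symm
    rw [Equiv.swap_comm s s', Equiv.swap_comm s' t] at this
    exact this
  · rw [← tensorPerm_mul, ← tensorPerm_mul, Equiv.swap_comm s s']
    congr 1
    have := Equiv.swap_mul_swap_mul_swap h1.symm h3
    rw [Equiv.swap_comm t s'] at this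
    exact this

theorem commute_smul_one_sub_smul {E K : Type*} [Ring E] [CommRing K] [Algebra K E] {x y : E}
    (h : Commute x y) (c w : K) : Commute (c • 1 - w • x) y :=
  ((Commute.one_left y).smul_left c).sub_left (h.smul_left w)

/-- Unitarity of the R-matrix: R(x)R(-x) is a scalar. -/
theorem smul_one_sub_smul_mul {E K : Type*} [Ring E] [CommRing K] [Algebra K E] {Q : E}
    (hQ : Q * Q = 1) (c w : K) :
    (c • 1 - w • Q) * ((-c) • 1 - w • Q) = (w * w - c * c) • 1 := by
  simp only [sub_mul, mul_sub, smul_mul_assoc, mul_smul_comm, one_mul, mul_one, hQ]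
  module

theorem commute_tensorLeft_tensorRight_perm (σ : Equiv.Perm ι) (τ : Equiv.Perm κ) :
    Commute (tensorLeft (tensorPerm σ : Matrix (ι → Fin n) (ι → Fin n) A))
      (tensorRight (tensorPerm τ)) := by
  rw [tensorLeft_tensorPerm, tensorRight_tensorPerm, Commute, SemiconjBy, ← tensorPerm_mul,
    ← tensorPerm_mul]
  simp [Equiv.Perm.sumCongr_mul]

theorem commute_tensorRight_perm_tensorLeft_site (τ : Equiv.Perm κ) (s : ι)
    (M : Matrix (Fin n) (Fin n) A) :
    Commute (tensorRight (tensorPerm τ)) (tensorLeft (site s M)) := by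
  rw [tensorRight_tensorPerm, tensorLeft_site, Commute, SemiconjBy, tensorPerm_mul_site]
  simp

theorem commute_tensorLeft_perm_tensorRight_site (σ : Equiv.Perm ι) (s : κ)
    (M : Matrix (Fin n) (Fin n) A) :
    Commute (tensorLeft (tensorPerm σ)) (tensorRight (site s M)) := by
  rw [tensorLeft_tensorPerm, tensorRight_site, Commute, SemiconjBy, tensorPerm_mul_site]
  simp

end TensorAlternation

/-! ### Commutation of antisymmetrized traces -/

section TraceCommutation

set_option linter.unusedSectionVars false

variable {A : Type*} [Ring A] [Algebra ℂ A] {n : ℕ}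

theorem antisymTrace_fin_zero (M : Fin 0 → Matrix (Fin n) (Fin n) A) : antisymTrace M = 1 := by
  have h : (permOp 1 : TensorEnd n 0 A) = 1 := tensorPerm_one
  simp [antisymTrace, antisymmetrizer, h]

/-- At equal parameters the R-matrix is 1 - P, so the exchange relation reads (1-P)Z = Z'(1-P), and
(1-P)(1+P) = 0. -/
theorem RTT.compat {ι : Type*} [Fintype ι] [DecidableEq ι] {M N : Matrix (Fin n) (Fin n) A}
    (h : RTT (1 : ℂ) 1 M N) {s t : ι} (hst : s ≠ t) :
    Compat (tensorPerm (Equiv.swap s t)) (site s M * site t N) := by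
  refine .of_exchange (tensorPerm_swap_mul_self _ _) (Z' := site t N * site s M) ?_
  have := h.exchange hst
  rwa [one_smul, one_smul] at this

theorem ordProd_site_inl (k l : ℕ) (M : ℕ → Matrix (Fin n) (Fin n) A) :
    ordProd (fun i => site (Sum.inl (Fin.ofNat (k + 1) i) : Fin (k + 1) ⊕ Fin (l + 1)) (M i))
      (k + 1) = tensorLeft (List.ofFn fun s : Fin (k + 1) => leg s (M s)).prod := by
  rw [ordProd_eq_ofFn, map_list_prod, List.map_ofFn]
  congr 2
  funext s
  simp [leg_eq_site, tensorLeft_site, Fin.ofNat, Nat.mod_eq_of_lt s.isLt]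

theorem ordProd_site_inr (k l : ℕ) (N : ℕ → Matrix (Fin n) (Fin n) A) :
    ordProd (fun i => site (Sum.inr (Fin.ofNat (l + 1) i) : Fin (k + 1) ⊕ Fin (l + 1)) (N i))
      (l + 1) = tensorRight (List.ofFn fun s : Fin (l + 1) => leg s (N s)).prod := by
  rw [ordProd_eq_ofFn, map_list_prod, List.map_ofFn]
  congr 2
  funext s
  simp [leg_eq_site, tensorRight_site, Fin.ofNat, Nat.mod_eq_of_lt s.isLt]

theorem ofNat_ne {k i j : ℕ} (hi : i < k + 1) (hj : j < k + 1) (h : i ≠ j) :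
    Fin.ofNat (k + 1) i ≠ Fin.ofNat (k + 1) j := by
  intro he
  have := congrArg Fin.val he
  simp only [Fin.ofNat, Nat.mod_eq_of_lt hi, Nat.mod_eq_of_lt hj] at this
  exact h this

/-- The scalars left over from inverting the R-matrices are not units, only non-zero-divisors; this
cancels a product of them. -/
theorem regular_prod {K α : Type*} [CommRing K] [Algebra K A] {s : Finset α} {d : α → K}
    (h : ∀ x ∈ s, ∀ z : A, d x • z = 0 → z = 0) (z : A) (hz : (∏ x ∈ s, d x) • z = 0) : z = 0 := by
  classical
  induction s using Finset.induction_on with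
  | empty => simpa using hz
  | insert x s hx ih =>
    rw [Finset.prod_insert hx, mul_smul] at hz
    exact ih (fun y hy => h y (Finset.mem_insert_of_mem hy))
      (h x (Finset.mem_insert_self _ _) _ hz)

/-- Operators on `(ℂⁿ)^{⊗(k+1)} ⊗ (ℂⁿ)^{⊗(l+1)}`. -/
abbrev BlockEnd (n k l : ℕ) (A : Type*) :=
  Matrix (Fin (k + 1) ⊕ Fin (l + 1) → Fin n) (Fin (k + 1) ⊕ Fin (l + 1) → Fin n) A

/-- The tensor factor `i` of the first block. -/
def lpos (k l i : ℕ) : Fin (k + 1) ⊕ Fin (l + 1) := Sum.inl (Fin.ofNat (k + 1) i)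

/-- The tensor factor `j` of the second block. -/
def rpos (k l j : ℕ) : Fin (k + 1) ⊕ Fin (l + 1) := Sum.inr (Fin.ofNat (l + 1) j)

variable {k l : ℕ}

theorem lpos_ne_rpos (i j : ℕ) : lpos k l i ≠ rpos k l j := Sum.inl_ne_inr

theorem rpos_ne_lpos (i j : ℕ) : rpos k l i ≠ lpos k l j := Sum.inr_ne_inl

theorem lpos_ne {i j : ℕ} (hi : i < k + 1) (hj : j < k + 1) (h : i ≠ j) :
    lpos k l i ≠ lpos k l j := fun he => ofNat_ne hi hj h (Sum.inl_injective he)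

theorem rpos_ne {i j : ℕ} (hi : i < l + 1) (hj : j < l + 1) (h : i ≠ j) :
    rpos k l i ≠ rpos k l j := fun he => ofNat_ne hi hj h (Sum.inr_injective he)

/-- The product of the antisymmetrizers of the two blocks. -/
def blockAlt (n k l : ℕ) (A : Type*) [Ring A] [Algebra ℂ A] : BlockEnd n k l A :=
  tensorLeft (antisymmetrizer (k + 1)) * tensorRight (antisymmetrizer (l + 1))

theorem tensorLeft_antisymmetrizer : (tensorLeft (antisymmetrizer (k + 1)) : BlockEnd n k l A) =
    altSum ((tensorLeft : _ →+* BlockEnd n k l A).toMonoidHom.comp tensorPermHom) := by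
  rw [antisymmetrizer_eq_altSum, tensorLeft_altSum]

theorem tensorRight_antisymmetrizer : (tensorRight (antisymmetrizer (l + 1)) : BlockEnd n k l A) =
    altSum ((tensorRight : _ →+* BlockEnd n k l A).toMonoidHom.comp tensorPermHom) := by
  rw [antisymmetrizer_eq_altSum, tensorRight_altSum]

theorem commute_antisymmetrizers :
    Commute (tensorLeft (antisymmetrizer (k + 1)) : BlockEnd n k l A)
      (tensorRight (antisymmetrizer (l + 1))) := by
  rw [tensorLeft_antisymmetrizer, tensorRight_antisymmetrizer]
  exact Commute.altSum_right fun τ => (Commute.altSum_right fun σ =>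
    (commute_tensorLeft_tensorRight_perm σ τ).symm).symm

theorem tensorLeft_swap_adjacent (i : Fin k) :
    (tensorLeft (tensorPerm (Equiv.swap i.castSucc i.succ)) : BlockEnd n k l A) =
      tensorPerm (Equiv.swap (lpos k l i) (lpos k l (i + 1))) := by
  rw [tensorLeft_tensorPerm, Equiv.Perm.sumCongr_swap_one]
  have h1 : Fin.ofNat (k + 1) i = i.castSucc := by
    ext; simp [Fin.ofNat, Nat.mod_eq_of_lt (show (i : ℕ) < k + 1 by omega)]
  have h2 : Fin.ofNat (k + 1) (i + 1) = i.succ := by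
    ext; simp [Fin.ofNat]
  rw [lpos, lpos, h1, h2]

theorem tensorRight_swap_adjacent (j : Fin l) :
    (tensorRight (tensorPerm (Equiv.swap j.castSucc j.succ)) : BlockEnd n k l A) =
      tensorPerm (Equiv.swap (rpos k l j) (rpos k l (j + 1))) := by
  rw [tensorRight_tensorPerm, Equiv.Perm.sumCongr_one_swap]
  have h1 : Fin.ofNat (l + 1) j = j.castSucc := by
    ext; simp [Fin.ofNat, Nat.mod_eq_of_lt (show (j : ℕ) < l + 1 by omega)]
  have h2 : Fin.ofNat (l + 1) (j + 1) = j.succ := by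
    ext; simp [Fin.ofNat]
  rw [rpos, rpos, h1, h2]

theorem blockAlt_mul_left (i : Fin k) :
    blockAlt n k l A * tensorPerm (Equiv.swap (lpos k l i) (lpos k l (i + 1))) =
      -blockAlt n k l A := by
  have h := altSum_mul ((tensorLeft : _ →+* BlockEnd n k l A).toMonoidHom.comp tensorPermHom)
    (Equiv.swap i.castSucc i.succ)
  rw [← tensorLeft_antisymmetrizer, Equiv.Perm.sign_swap (Fin.castSucc_lt_succ).ne] at h
  change _ * tensorLeft (tensorPerm (Equiv.swap i.castSucc i.succ)) = _ at h
  rw [tensorLeft_swap_adjacent] at h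
  rw [blockAlt, commute_antisymmetrizers.eq, mul_assoc, h]
  simp

theorem blockAlt_mul_right (j : Fin l) :
    blockAlt n k l A * tensorPerm (Equiv.swap (rpos k l j) (rpos k l (j + 1))) =
      -blockAlt n k l A := by
  have h := altSum_mul ((tensorRight : _ →+* BlockEnd n k l A).toMonoidHom.comp tensorPermHom)
    (Equiv.swap j.castSucc j.succ)
  rw [← tensorRight_antisymmetrizer, Equiv.Perm.sign_swap (Fin.castSucc_lt_succ).ne] at h
  change _ * tensorRight (tensorPerm (Equiv.swap j.castSucc j.succ)) = _ at h
  rw [tensorRight_swap_adjacent] at h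
  rw [blockAlt, mul_assoc, h]
  simp

/-- Compatibility with each adjacent swap makes `blockAlt * Z` antisymmetric on the right in both
blocks, so each antisymmetrizer is absorbed there. -/
theorem blockAlt_mul_mul_blockAlt {Z : BlockEnd n k l A}
    (h1 : ∀ i < k, Compat (tensorPerm (Equiv.swap (lpos k l i) (lpos k l (i + 1)))) Z)
    (h2 : ∀ j < l, Compat (tensorPerm (Equiv.swap (rpos k l j) (rpos k l (j + 1)))) Z) :
    blockAlt n k l A * Z * blockAlt n k l A = blockAlt n k l A * Z := by
  have e1 : blockAlt n k l A * Z * tensorLeft (antisymmetrizer (k + 1)) = blockAlt n k l A * Z := by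
    rw [tensorLeft_antisymmetrizer]
    refine mul_altSum_of_adjacent _ fun i => ?_
    change blockAlt n k l A * Z * tensorLeft (tensorPerm (Equiv.swap i.castSucc i.succ)) = _
    rw [tensorLeft_swap_adjacent]
    exact (h1 i i.isLt).mul_eq_neg (blockAlt_mul_left i)
  have e2 : blockAlt n k l A * Z * tensorRight (antisymmetrizer (l + 1)) = blockAlt n k l A * Z := by
    rw [tensorRight_antisymmetrizer]
    refine mul_altSum_of_adjacent _ fun i => ?_
    change blockAlt n k l A * Z * tensorRight (tensorPerm (Equiv.swap i.castSucc i.succ)) = _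
    rw [tensorRight_swap_adjacent]
    exact (h2 i i.isLt).mul_eq_neg (blockAlt_mul_right i)
  nth_rw 2 [blockAlt]
  rw [← mul_assoc, e1, e2]

theorem traceCommutes_blockAlt : TraceCommutes (blockAlt n k l A) := by
  refine .mul ?_ ?_
  · rw [tensorLeft_antisymmetrizer]
    refine .altSum fun σ => ?_
    change TraceCommutes (tensorLeft (tensorPerm σ))
    rw [tensorLeft_tensorPerm]
    exact traceCommutes_tensorPerm _
  · rw [tensorRight_antisymmetrizer]
    refine .altSum fun σ => ?_
    change TraceCommutes (tensorRight (tensorPerm σ))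
    rw [tensorRight_tensorPerm]
    exact traceCommutes_tensorPerm _

/-- The `R`-matrix acting in the factor `i` of the first block and the factor `j` of the second. -/
def crossR {K : Type*} [CommRing K] [Algebra K A] (n k l : ℕ) (c : ℕ → ℕ → K) (w : K) (i j : ℕ) :
    BlockEnd n k l A :=
  c i j • 1 - w • tensorPerm (Equiv.swap (lpos k l i) (rpos k l j))

section CrossR

variable {K : Type*} [CommRing K] [Algebra K A] {c : ℕ → ℕ → K} {w : K}

theorem crossR_mul_neg (i j : ℕ) :
    (crossR n k l c w i j * crossR n k l (-c) w i j : BlockEnd n k l A) =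
      (w * w - c i j * c i j) • 1 :=
  smul_one_sub_smul_mul (tensorPerm_swap_mul_self _ _) _ _

theorem neg_mul_crossR (i j : ℕ) :
    (crossR n k l (-c) w i j * crossR n k l c w i j : BlockEnd n k l A) =
      (w * w - c i j * c i j) • 1 := by
  simpa using crossR_mul_neg (n := n) (k := k) (l := l) (A := A) (c := -c) (w := w) i j

theorem commute_crossR_site_left {i s j : ℕ} (hi : i < k + 1) (hs : s < k + 1) (his : i ≠ s)
    (M : Matrix (Fin n) (Fin n) A) :
    Commute (crossR n k l c w i j : BlockEnd n k l A) (site (lpos k l s) M) :=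
  commute_smul_one_sub_smul
    (commute_tensorPerm_swap_site (lpos_ne hs hi his.symm) (lpos_ne_rpos s j) _) _ _

theorem commute_crossR_site_right {i s j : ℕ} (hj : j < l + 1) (hs : s < l + 1) (hjs : j ≠ s)
    (M : Matrix (Fin n) (Fin n) A) :
    Commute (crossR n k l c w i j : BlockEnd n k l A) (site (rpos k l s) M) :=
  commute_smul_one_sub_smul
    (commute_tensorPerm_swap_site (rpos_ne_lpos s i) (rpos_ne hs hj hjs.symm) _) _ _

theorem commute_crossR {i s j t : ℕ} (hi : i < k + 1) (hs : s < k + 1) (his : i ≠ s)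
    (hj : j < l + 1) (ht : t < l + 1) (hjt : j ≠ t) :
    Commute (crossR n k l c w i j : BlockEnd n k l A) (crossR n k l c w s t) :=
  commute_smul_one_sub_smul (commute_smul_one_sub_smul (commute_tensorPerm_swap
    (lpos_ne hs hi his.symm) (lpos_ne_rpos _ _) (rpos_ne_lpos _ _)
    (rpos_ne ht hj hjt.symm)) _ _).symm _ _

theorem commute_swap_left_crossR {i s j : ℕ} (hi : i < k) (hs : s < k + 1) (h1 : s ≠ i)
    (h2 : s ≠ i + 1) : Commute (tensorPerm (Equiv.swap (lpos k l i) (lpos k l (i + 1))))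
      (crossR n k l c w s j : BlockEnd n k l A) :=
  (commute_smul_one_sub_smul (commute_tensorPerm_swap (lpos_ne hs (by omega) h1)
    (lpos_ne hs (by omega) h2) (rpos_ne_lpos _ _) (rpos_ne_lpos _ _)) _ _).symm

theorem commute_swap_right_crossR {i j t : ℕ} (hj : j < l) (ht : t < l + 1) (h1 : t ≠ j)
    (h2 : t ≠ j + 1) : Commute (tensorPerm (Equiv.swap (rpos k l j) (rpos k l (j + 1))))
      (crossR n k l c w i t : BlockEnd n k l A) :=
  (commute_smul_one_sub_smul (commute_tensorPerm_swap (lpos_ne_rpos _ _) (lpos_ne_rpos _ _)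
    (rpos_ne ht (by omega) h1) (rpos_ne ht (by omega) h2)) _ _).symm

/-- Moving to a neighbouring factor in either block changes the spectral parameter by exactly one
unit w, which is what the degenerate Yang–Baxter equation requires. -/
theorem blockAlt_blockR (hc : ∀ i j, c i j = c (i + 1) j + w)
    (hc' : ∀ i j, c i (j + 1) = c i j + w) :
    blockAlt n k l A * blockR (crossR n k l c w) (k + 1) (l + 1) * blockAlt n k l A =
      blockAlt n k l A * blockR (crossR n k l c w) (k + 1) (l + 1) := by
  refine blockAlt_mul_mul_blockAlt (fun i hi => ?_) fun j hj => ?_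
  · refine .blockR_left (tensorPerm_swap_mul_self _ _) (i := i) (by omega)
      (fun s hs j _ h1 h2 => commute_swap_left_crossR hi hs h1 h2) fun j _ => ?_
    exact compat_tensorPerm_swap (lpos_ne (by omega) (by omega) (by omega)) (lpos_ne_rpos _ _)
      (lpos_ne_rpos _ _) (hc i j)
  · refine .blockR_right (tensorPerm_swap_mul_self _ _) (j := j) (by omega)
      (fun i _ t ht h1 h2 => commute_swap_right_crossR hj ht h1 h2)
      (fun i hi s hs his => commute_crossR hi hs his (by omega) (by omega) (by omega))
      fun i _ => ?_
    rw [crossR, crossR, Equiv.swap_comm (rpos k l j), Equiv.swap_comm (lpos k l i),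
      Equiv.swap_comm (lpos k l i)]
    exact compat_tensorPerm_swap (rpos_ne (by omega) (by omega) (by omega)) (rpos_ne_lpos _ _)
      (rpos_ne_lpos _ _) (hc' i j)

/-- The factors now come in the opposite order, so the steps of the spectral parameter must have the
opposite signs; replacing c by -c achieves this. -/
theorem blockAlt_blockR' (hc : ∀ i j, c (i + 1) j = c i j + w)
    (hc' : ∀ i j, c i j = c i (j + 1) + w) :
    blockAlt n k l A * blockR' (crossR n k l c w) (k + 1) (l + 1) * blockAlt n k l A =
      blockAlt n k l A * blockR' (crossR n k l c w) (k + 1) (l + 1) := by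
  refine blockAlt_mul_mul_blockAlt (fun i hi => ?_) fun j hj => ?_
  · refine .blockR'_left (tensorPerm_swap_mul_self _ _) (i := i) (by omega)
      (fun s hs j _ h1 h2 => commute_swap_left_crossR hi hs h1 h2) fun j _ => ?_
    rw [Equiv.swap_comm (lpos k l i)]
    exact compat_tensorPerm_swap (lpos_ne (by omega) (by omega) (by omega)) (lpos_ne_rpos _ _)
      (lpos_ne_rpos _ _) (hc i j)
  · refine .blockR'_right (tensorPerm_swap_mul_self _ _) (j := j) (by omega)
      (fun i _ t ht h1 h2 => commute_swap_right_crossR hj ht h1 h2)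
      (fun i hi s hs his => commute_crossR hi hs his (by omega) (by omega) (by omega))
      fun i _ => ?_
    rw [crossR, crossR, Equiv.swap_comm (lpos k l i), Equiv.swap_comm (lpos k l i)]
    exact compat_tensorPerm_swap (rpos_ne (by omega) (by omega) (by omega)) (rpos_ne_lpos _ _)
      (rpos_ne_lpos _ _) (hc' i j)

end CrossR

theorem blockAlt_ordProd {M N : ℕ → Matrix (Fin n) (Fin n) A}
    (hM : ∀ i, RTT (1 : ℂ) 1 (M i) (M (i + 1))) (hN : ∀ i, RTT (1 : ℂ) 1 (N i) (N (i + 1))) :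
    blockAlt n k l A * (ordProd (fun i => site (lpos k l i) (M i)) (k + 1) *
        ordProd (fun j => site (rpos k l j) (N j)) (l + 1)) * blockAlt n k l A =
      blockAlt n k l A * (ordProd (fun i => site (lpos k l i) (M i)) (k + 1) *
        ordProd (fun j => site (rpos k l j) (N j)) (l + 1)) := by
  refine blockAlt_mul_mul_blockAlt (fun i hi => ?_) fun j hj => ?_
  · exact .mul (.ordProd (tensorPerm_swap_mul_self _ _) (i := i) (by omega) (fun s hs h1 h2 =>
      commute_tensorPerm_swap_site (lpos_ne hs (by omega) h1) (lpos_ne hs (by omega) h2) _)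
      ((hM i).compat (lpos_ne (by omega) (by omega) (by omega))))
      (.of_commute (tensorPerm_swap_mul_self _ _) (ordProd_commute fun s _ =>
        commute_tensorPerm_swap_site (rpos_ne_lpos _ _) (rpos_ne_lpos _ _) _))
  · exact .mul (.of_commute (tensorPerm_swap_mul_self _ _) (ordProd_commute fun s _ =>
      commute_tensorPerm_swap_site (lpos_ne_rpos _ _) (lpos_ne_rpos _ _) _))
      (.ordProd (tensorPerm_swap_mul_self _ _) (i := j) (by omega)
        (fun s hs h1 h2 => commute_tensorPerm_swap_site (rpos_ne hs (by omega) h1)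
          (rpos_ne hs (by omega) h2) _) ((hN j).compat (rpos_ne (by omega) (by omega) (by omega))))

theorem trace_blockAlt_left (M N : ℕ → Matrix (Fin n) (Fin n) A) :
    (blockAlt n k l A * (ordProd (fun i => site (lpos k l i) (M i)) (k + 1) *
        ordProd (fun j => site (rpos k l j) (N j)) (l + 1))).trace =
      antisymTrace (fun s : Fin (k + 1) => M s) * antisymTrace (fun s : Fin (l + 1) => N s) := by
  have hc : Commute (tensorRight (antisymmetrizer (l + 1)) : BlockEnd n k l A)
      (ordProd (fun i => site (lpos k l i) (M i)) (k + 1)) := by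
    rw [tensorRight_antisymmetrizer]
    refine ordProd_commute fun s _ => (Commute.altSum_right fun σ => ?_).symm
    have := (commute_tensorRight_perm_tensorLeft_site (ι := Fin (k + 1)) σ (Fin.ofNat (k + 1) s)
      (M s)).symm
    rwa [tensorLeft_site] at this
  have ha : ordProd (fun i => site (lpos k l i) (M i)) (k + 1) = _ := ordProd_site_inl k l M
  have hb : ordProd (fun i => site (rpos k l i) (N i)) (l + 1) = _ := ordProd_site_inr k l N
  rw [blockAlt, mul_assoc, ← mul_assoc (tensorRight _), hc.eq, mul_assoc, ← mul_assoc, ha, hb,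
    ← map_mul, ← map_mul, trace_tensorLeft_mul_tensorRight]
  rfl

theorem trace_blockAlt_right (M N : ℕ → Matrix (Fin n) (Fin n) A) :
    (blockAlt n k l A * (ordProd (fun j => site (rpos k l j) (N j)) (l + 1) *
        ordProd (fun i => site (lpos k l i) (M i)) (k + 1))).trace =
      antisymTrace (fun s : Fin (l + 1) => N s) * antisymTrace (fun s : Fin (k + 1) => M s) := by
  have hc : Commute (tensorLeft (antisymmetrizer (k + 1)) : BlockEnd n k l A)
      (ordProd (fun i => site (rpos k l i) (N i)) (l + 1)) := by
    rw [tensorLeft_antisymmetrizer]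
    refine ordProd_commute fun s _ => (Commute.altSum_right fun σ => ?_).symm
    have := (commute_tensorLeft_perm_tensorRight_site (κ := Fin (l + 1)) σ (Fin.ofNat (l + 1) s)
      (N s)).symm
    rwa [tensorRight_site] at this
  have ha : ordProd (fun i => site (lpos k l i) (M i)) (k + 1) = _ := ordProd_site_inl k l M
  have hb : ordProd (fun i => site (rpos k l i) (N i)) (l + 1) = _ := ordProd_site_inr k l N
  rw [blockAlt, commute_antisymmetrizers.eq, mul_assoc, ← mul_assoc (tensorLeft _), hc.eq,
    mul_assoc, ← mul_assoc, ha, hb, ← map_mul, ← map_mul, trace_tensorRight_mul_tensorLeft]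
  rfl

/-- Conjugation by the block R-matrix under the antisymmetrized trace turns one order of the two
blocks into the other, up to the scalar ∏(w² - c_{ij}²), which `hreg` cancels. -/
theorem antisymTrace_mul_comm {K : Type*} [CommRing K] [Algebra K A]
    (M N : ℕ → Matrix (Fin n) (Fin n) A) (c : ℕ → ℕ → K) (w : K)
    (hM : ∀ i, RTT (1 : ℂ) 1 (M i) (M (i + 1))) (hN : ∀ i, RTT (1 : ℂ) 1 (N i) (N (i + 1)))
    (hMN : ∀ i j, RTT (c i j) w (M i) (N j)) (hc : ∀ i j, c i j = c (i + 1) j + w)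
    (hc' : ∀ i j, c i (j + 1) = c i j + w)
    (hreg : ∀ i j (z : A), (w * w - c i j * c i j) • z = 0 → z = 0) (k l : ℕ) :
    antisymTrace (fun s : Fin k => M s) * antisymTrace (fun s : Fin l => N s) =
      antisymTrace (fun s : Fin l => N s) * antisymTrace (fun s : Fin k => M s) := by
  -- Block sites are labelled through `Fin.ofNat`, which needs nonempty blocks; an empty block
  -- contributes the trace 1.
  rcases k with - | k
  · rw [antisymTrace_fin_zero, one_mul, mul_one]
  rcases l with - | l
  · rw [antisymTrace_fin_zero, one_mul, mul_one]
  have hexch : blockR (crossR n k l c w) (k + 1) (l + 1) *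
      (ordProd (fun i => site (lpos k l i) (M i)) (k + 1) *
        ordProd (fun j => site (rpos k l j) (N j)) (l + 1)) =
      ordProd (fun j => site (rpos k l j) (N j)) (l + 1) *
        ordProd (fun i => site (lpos k l i) (M i)) (k + 1) *
        blockR (crossR n k l c w) (k + 1) (l + 1) :=
    blockR_exchange (fun i _ j _ => (hMN i j).exchange (lpos_ne_rpos i j))
      (fun i hi j _ s hs his => commute_crossR_site_left hi hs his _)
      (fun i _ j hj s hs hjs => commute_crossR_site_right hj hs hjs _)
  have tR' : TraceCommutes (blockR' (crossR n k l (-c) w) (k + 1) (l + 1) : BlockEnd n k l A) :=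
    .ordProd fun j _ => .revProd fun i _ =>
      (TraceCommutes.one.smul _).sub ((traceCommutes_tensorPerm _).smul _)
  have key := smul_trace_eq_of_exchange (K := K)
    (d := ∏ j ∈ Finset.range (l + 1), ∏ i ∈ Finset.range (k + 1), (w * w - c i j * c i j)) hexch
    (blockR_mul_blockR' fun i _ j _ => crossR_mul_neg i j)
    (blockR'_mul_blockR fun i _ j _ => neg_mul_crossR i j)
    (blockAlt_blockR hc hc')
    (blockAlt_blockR' (fun i j => by simp [hc i j]) fun i j => by simp [hc' i j])
    (blockAlt_ordProd hM hN) traceCommutes_blockAlt tR'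
  rw [trace_blockAlt_left, trace_blockAlt_right, ← sub_eq_zero, ← smul_sub] at key
  symm
  rw [← sub_eq_zero]
  exact regular_prod (fun j _ z hz => regular_prod (fun i _ z hz => hreg i j z hz) z hz) _ key

end TraceCommutation

/-! ### Explicit form of antisymmetrized traces -/

section Explicit

variable {A : Type*} [Ring A] {n : ℕ}

theorem prod_ofFn_succ {r : ℕ} {E : Type*} [Ring E] (f : Fin (r + 1) → E) :
    (List.ofFn f).prod = (List.ofFn fun s : Fin r => f s.castSucc).prod * f (Fin.last r) := by
  rw [List.ofFn_succ', List.concat_eq_append, List.prod_append, List.prod_singleton]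

theorem prod_site_apply {ι : Type*} [Fintype ι] [DecidableEq ι] {r : ℕ} (f : Fin r → ι)
    (hf : Function.Injective f) (M : Fin r → Matrix (Fin n) (Fin n) A) (I J : ι → Fin n) :
    (List.ofFn fun s => site (f s) (M s)).prod I J =
      if ∀ t, t ∉ Set.range f → I t = J t then
        (List.ofFn fun s => M s (I (f s)) (J (f s))).prod else 0 := by
  induction r generalizing J with
  | zero =>
    rw [List.ofFn_zero, List.ofFn_zero, List.prod_nil, List.prod_nil, Matrix.one_apply]
    congr 1
    simp [funext_iff]
  | succ r ih =>
    have hlast : ∀ s : Fin r, f s.castSucc ≠ f (Fin.last r) := fun s h =>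
      (Fin.castSucc_lt_last s).ne (hf h)
    rw [prod_ofFn_succ, mul_site_apply, Finset.sum_eq_single (I (f (Fin.last r)))]
    · rw [ih (fun s => f s.castSucc) (hf.comp (Fin.castSucc_injective r)), ite_mul, zero_mul]
      congr 1
      · apply propext
        constructor
        · intro h t ht
          have htl : t ≠ f (Fin.last r) := fun h => ht ⟨_, h.symm⟩
          simpa [htl] using h t fun ⟨s, hs⟩ => ht ⟨_, hs⟩
        · intro h t ht
          by_cases htl : t = f (Fin.last r)
          · subst htl; simp
          · rw [Function.update_of_ne htl]
            refine h t ?_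
            rintro ⟨s, rfl⟩
            induction s using Fin.lastCases with
            | last => exact htl rfl
            | cast s => exact ht ⟨s, rfl⟩
      · rw [prod_ofFn_succ]
        simp [hlast]
    · intro b _ hb
      rw [ih (fun s => f s.castSucc) (hf.comp (Fin.castSucc_injective r)), if_neg, zero_mul]
      intro h
      refine hb ?_
      have := h (f (Fin.last r)) (fun ⟨s, hs⟩ => hlast s hs)
      simpa using this.symm
    · simp

theorem prod_leg_apply {k : ℕ} (M : Fin k → Matrix (Fin n) (Fin n) A) (I J : Fin k → Fin n) :
    (List.ofFn fun s => leg s (M s)).prod I J = (List.ofFn fun s => M s (I s) (J s)).prod := by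
  simp only [leg_eq_site]
  rw [prod_site_apply (fun s => s) Function.injective_id, if_pos]
  intro t ht
  exact absurd ⟨t, rfl⟩ ht

/-- The entries of `k! A_k M(1)_1 ⋯ M(k)_k`. -/
def altEntry {k : ℕ} (M : Fin k → Matrix (Fin n) (Fin n) A) (I J : Fin k → Fin n) : A :=
  ∑ σ : Equiv.Perm (Fin k), (Equiv.Perm.sign σ : ℤ) • (List.ofFn fun s => M s (I (σ s)) (J s)).prod

theorem antisymmetrizer_mul_apply [Algebra ℂ A] {k : ℕ} (M : Fin k → Matrix (Fin n) (Fin n) A)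
    (I J : Fin k → Fin n) : (antisymmetrizer k * (List.ofFn fun s => leg s (M s)).prod :
      TensorEnd n k A) I J = ((k.factorial : ℂ)⁻¹) • altEntry M I J := by
  rw [antisymmetrizer, Matrix.smul_mul, Matrix.smul_apply, Finset.sum_mul, Matrix.sum_apply,
    altEntry]
  congr 1
  refine Finset.sum_congr rfl fun σ _ => ?_
  rw [Matrix.smul_mul, Matrix.smul_apply, permOp_eq_tensorPerm, tensorPerm_mul_apply,
    prod_leg_apply]
  rfl

theorem antisymTrace_eq [Algebra ℂ A] {k : ℕ} (M : Fin k → Matrix (Fin n) (Fin n) A) :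
    antisymTrace M = ((k.factorial : ℂ)⁻¹) • ∑ I : Fin k → Fin n, altEntry M I I := by
  simp only [antisymTrace, Matrix.trace, Matrix.diag, antisymmetrizer_mul_apply, Finset.smul_sum]

theorem map_antisymTrace {B : Type*} [Ring B] [Algebra ℂ A] [Algebra ℂ B] (φ : A →ₐ[ℂ] B) {k : ℕ}
    (M : Fin k → Matrix (Fin n) (Fin n) A) :
    φ (antisymTrace M) = antisymTrace fun s => (M s).map φ := by
  simp only [antisymTrace_eq, map_smul, map_sum, altEntry, map_zsmul, map_list_prod, List.map_ofFn,
    Matrix.map_apply]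
  rfl

end Explicit

/-! ### The defining relations in terms of generating series -/

section TwoVariables

variable {A : Type*} [Ring A]

/-- Series in `u⁻¹` as series in `u⁻¹` and `v⁻¹`. -/
def inU [Algebra ℂ A] : A⟦X⟧ →ₐ[ℂ] A⟦X⟧⟦X⟧ :=
  AlgHom.ofLinearMap
    { toFun := C
      map_add' := map_add _
      map_smul' := fun c f => by
        ext m : 1
        by_cases h : m = 0 <;> simp [coeff_C, h] }
    (map_one C) (map_mul C)

/-- Series in `v⁻¹` as series in `u⁻¹` and `v⁻¹`. -/
def inV [Algebra ℂ A] : A⟦X⟧ →ₐ[ℂ] A⟦X⟧⟦X⟧ :=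
  AlgHom.ofLinearMap
    { toFun := PowerSeries.map C
      map_add' := map_add _
      map_smul' := fun c f => by
        ext m l
        by_cases h : l = 0 <;> simp [coeff_C, h] }
    (map_one (PowerSeries.map C)) (map_mul (PowerSeries.map C))

theorem inU_apply [Algebra ℂ A] (f : A⟦X⟧) : inU f = C f := rfl

theorem inV_apply [Algebra ℂ A] (f : A⟦X⟧) : inV f = PowerSeries.map C f := rfl

/-- The outer variable is v⁻¹ and the inner one u⁻¹, so s is the exponent of v⁻¹ and r that of u⁻¹.
-/
theorem coeff_inU_mul_inV [Algebra ℂ A] (f g : A⟦X⟧) (r s : ℕ) :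
    coeff r (coeff s (inU f * inV g)) = coeff r f * coeff s g := by
  rw [inU_apply, inV_apply, coeff_C_mul, coeff_map, coeff_mul_C]

theorem coeff_inV_mul_inU [Algebra ℂ A] (f g : A⟦X⟧) (r s : ℕ) :
    coeff r (coeff s (inV g * inU f)) = coeff s g * coeff r f := by
  rw [inU_apply, inV_apply, coeff_mul_C, coeff_map, coeff_C_mul]

theorem C_X_mem_center : (C X : A⟦X⟧⟦X⟧) ∈ Subring.center (A⟦X⟧⟦X⟧) := by
  rw [Subring.mem_center_iff]
  intro g
  ext m : 1
  rw [coeff_mul_C, coeff_C_mul, X_mul]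

theorem X_mem_center : (X : A⟦X⟧) ∈ Subring.center (A⟦X⟧) := by
  rw [Subring.mem_center_iff]
  intro g
  rw [X_mul]

/-- `u⁻¹` as a central element of the ring of series in `u⁻¹` and `v⁻¹`. -/
def uInv (A : Type*) [Ring A] : Subring.center (A⟦X⟧⟦X⟧) := ⟨C X, C_X_mem_center⟩

/-- `v⁻¹` as a central element of the ring of series in `u⁻¹` and `v⁻¹`. -/
def vInv (A : Type*) [Ring A] : Subring.center (A⟦X⟧⟦X⟧) := ⟨X, X_mem_center⟩

/-- `u⁻¹ v⁻¹ (u - v + a)`. -/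
def diffUV (A : Type*) [Ring A] (a : ℤ) : Subring.center (A⟦X⟧⟦X⟧) :=
  vInv A - uInv A + a * (uInv A * vInv A)

theorem uInv_smul (z : A⟦X⟧⟦X⟧) : uInv A • z = C X * z := rfl

theorem vInv_smul (z : A⟦X⟧⟦X⟧) : vInv A • z = X * z := rfl

/-- Induction on the power of v⁻¹: once the previous coefficient of z vanishes, the next coefficient
of the equation is -u⁻¹ times that of z. -/
theorem diffUV_smul_eq_zero {a : ℤ} {z : A⟦X⟧⟦X⟧} (h : diffUV A a • z = 0) : z = 0 := by
  have h' : X * z - C X * z + a • (C X * (X * z)) = 0 := by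
    rw [← h, diffUV, add_smul, sub_smul, ← zsmul_eq_mul, smul_assoc, mul_smul]
    rfl
  ext m : 1
  rw [map_zero]
  induction m with
  | zero =>
    have := congrArg (coeff 0) h'
    rw [map_add, map_sub, map_zsmul, coeff_C_mul, coeff_C_mul, coeff_zero_X_mul] at this
    simp only [mul_zero, smul_zero, add_zero, zero_sub, map_zero, neg_eq_zero] at this
    exact X_mul_cancel (by rw [this, mul_zero])
  | succ m ih =>
    have := congrArg (coeff (m + 1)) h'
    rw [map_add, map_sub, map_zsmul, coeff_C_mul, coeff_C_mul, coeff_succ_X_mul, ih] at this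
    simp only [mul_zero, smul_zero, add_zero, zero_sub, map_zero, neg_eq_zero] at this
    exact X_mul_cancel (by rw [this, mul_zero])

/-- The specialization `v = u`. -/
def diagonal : A⟦X⟧⟦X⟧ →+ A⟦X⟧ where
  toFun f := PowerSeries.mk fun m =>
    ∑ q ∈ Finset.HasAntidiagonal.antidiagonal m, coeff q.1 (coeff q.2 f)
  map_zero' := by ext; simp
  map_add' f g := by ext; simp [Finset.sum_add_distrib]

theorem coeff_diagonal (f : A⟦X⟧⟦X⟧) (m : ℕ) :
    coeff m (diagonal f) =
      ∑ q ∈ Finset.HasAntidiagonal.antidiagonal m, coeff q.1 (coeff q.2 f) := by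
  simp [diagonal]

theorem diagonal_X_mul (f : A⟦X⟧⟦X⟧) : diagonal (X * f) = X * diagonal f := by
  ext m
  cases m with
  | zero => simp [coeff_diagonal]
  | succ m =>
    rw [coeff_succ_X_mul, coeff_diagonal, coeff_diagonal, Finset.Nat.sum_antidiagonal_succ']
    simp [coeff_succ_X_mul]

theorem diagonal_C_X_mul (f : A⟦X⟧⟦X⟧) : diagonal (C X * f) = X * diagonal f := by
  ext m
  cases m with
  | zero => simp [coeff_diagonal]
  | succ m =>
    rw [coeff_succ_X_mul, coeff_diagonal, coeff_diagonal, Finset.Nat.sum_antidiagonal_succ]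
    simp [coeff_succ_X_mul]

theorem diagonal_inU_mul_inV [Algebra ℂ A] (f g : A⟦X⟧) : diagonal (inU f * inV g) = f * g := by
  ext m
  rw [coeff_diagonal, PowerSeries.coeff_mul]
  exact Finset.sum_congr rfl fun q _ => coeff_inU_mul_inV _ _ _ _

theorem diagonal_inV_mul_inU [Algebra ℂ A] (f g : A⟦X⟧) : diagonal (inV g * inU f) = g * f := by
  ext m
  rw [coeff_diagonal, PowerSeries.coeff_mul]
  refine (Finset.sum_congr rfl fun q _ => coeff_inV_mul_inU _ _ _ _).trans ?_
  exact Finset.Nat.sum_antidiagonal_swap (f := fun q => coeff q.1 g * coeff q.2 f)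

end TwoVariables

/-! ### RTT relations for generating series, and commutativity of the series e_k. -/

section YangianRelations

variable {n : ℕ}

theorem yangian_relation (r s : ℕ) (i j k l : Fin n) :
    coeff (r + 1) (T n i j) * coeff s (T n k l) - coeff r (T n i j) * coeff (s + 1) (T n k l)
        - coeff r (T n k j) * coeff s (T n i l) =
      coeff s (T n k l) * coeff (r + 1) (T n i j) - coeff (s + 1) (T n k l) * coeff r (T n i j)
        - coeff s (T n k j) * coeff r (T n i l) := by
  have h := RingQuot.mkAlgHom_rel ℂ (YangianRel.rtt (n := n) r s ![i, k] ![j, l])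
  change Yangian.proj n _ = Yangian.proj n _ at h
  have h01 : (0 : Fin 2) ≠ 1 := by decide
  have hr : ∀ (I J : Fin 2 → Fin n), ∀ r : Fin 2, r ≠ 0 → r ≠ 1 → I r = J r := by
    intro I J r h0 h1; omega
  have hr' : ∀ (I J : Fin 2 → Fin n), ∀ r : Fin 2, r ≠ 1 → r ≠ 0 → I r = J r := by
    intro I J r h0 h1; omega
  rw [mul_assoc] at h
  simp only [leg_eq_site, permOp_eq_tensorPerm, Matrix.sub_apply, tensorPerm_mul_apply,
    mul_tensorPerm_apply, site_mul_site_apply h01, site_mul_site_apply h01.symm, if_pos (hr _ _),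
    if_pos (hr' _ _), map_sub, map_mul] at h
  simpa [T] using h

theorem coeff_zero_T_mul_comm (i j : Fin n) (z : Yangian n) :
    coeff 0 (T n i j) * z = z * coeff 0 (T n i j) := by
  by_cases h : i = j <;> simp [T, freeT, h]

/-- After multiplication by u⁻¹v⁻¹ the coefficient of u^{-r-1}v^{-s-1} is `yangian_relation`. The
boundary coefficients, where an exponent is 0, hold because T^{(0)} = 1 is central. -/
theorem RTT_inU_inV : RTT (diffUV (Yangian n) 0) (uInv _ * vInv _) ((T n).map inU)
    ((T n).map inV) := by
  intro i j k l
  simp only [diffUV, Int.cast_zero, zero_mul, add_zero, sub_smul, mul_smul, uInv_smul, vInv_smul,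
    Matrix.map_apply]
  ext s r
  rcases s with - | s
  · rw [map_sub, coeff_zero_X_mul, coeff_C_mul, coeff_C_mul, coeff_zero_X_mul, mul_zero, map_zero,
      zero_sub, map_neg, neg_eq_zero]
    rcases r with - | r
    · simp
    · rw [coeff_succ_X_mul, map_sub, map_sub, coeff_inU_mul_inV, coeff_inV_mul_inU,
        coeff_zero_T_mul_comm, sub_self]
  · rw [map_sub, coeff_succ_X_mul, coeff_C_mul, coeff_C_mul, coeff_succ_X_mul]
    rcases r with - | r
    · rw [map_sub, coeff_zero_X_mul, coeff_zero_X_mul, sub_zero, map_sub, map_sub,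
        coeff_inU_mul_inV, coeff_inV_mul_inU, coeff_zero_T_mul_comm, sub_self]
    · rw [map_sub, coeff_succ_X_mul, coeff_succ_X_mul, map_sub, map_sub, map_sub, map_sub, map_sub,
        map_sub, coeff_inU_mul_inV, coeff_inV_mul_inU, coeff_inU_mul_inV, coeff_inV_mul_inU,
        coeff_inU_mul_inV, coeff_inV_mul_inU]
      have h := yangian_relation r s i j k l
      rw [sub_eq_iff_eq_add] at h
      rw [sub_eq_iff_eq_add, sub_eq_iff_eq_add] 
      rw [sub_eq_iff_eq_add] at h
      rw [h]
      abel

/-- The shift `u ↦ u + a`, `v ↦ v + b`. -/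
def shiftUV {A : Type*} [Ring A] (a b : ℤ) : A⟦X⟧⟦X⟧ →+* A⟦X⟧⟦X⟧ :=
  (shiftHom b).comp (PowerSeries.map (shiftHom a))

theorem shiftUV_inU {A : Type*} [Ring A] [Algebra ℂ A] (a b : ℤ) (f : A⟦X⟧) :
    shiftUV a b (inU f) = inU (shift a f) := by
  rw [inU_apply, shiftUV, RingHom.comp_apply, map_C]
  exact shiftFun_C b _

theorem shiftUV_inV {A : Type*} [Ring A] [Algebra ℂ A] (a b : ℤ) (f : A⟦X⟧) :
    shiftUV a b (inV f) = inV (shift b f) := by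
  have h : PowerSeries.map (shiftHom a) (PowerSeries.map C f) = PowerSeries.map C f := by
    ext m : 1
    rw [coeff_map, coeff_map]
    exact shiftFun_C a _
  rw [inV_apply, shiftUV, RingHom.comp_apply, h]
  exact shiftFun_map C b f

theorem one_add_mul_shiftUV_X {A : Type*} [Ring A] (a b : ℤ) :
    (1 + (b : A⟦X⟧⟦X⟧) * X) * shiftUV a b X = X := by
  rw [shiftUV, RingHom.comp_apply, map_X]
  exact one_add_mul_shiftFun_X b

theorem one_add_mul_shiftUV_C_X {A : Type*} [Ring A] (a b : ℤ) :
    (1 + (a : A⟦X⟧⟦X⟧) * C X) * shiftUV a b (C X) = C X := by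
  have h := congrArg (C (R := A⟦X⟧)) (one_add_mul_shiftFun_X (A := A) a)
  have h' : shiftUV a b (C X : A⟦X⟧⟦X⟧) = C (shiftFun a X) := by
    rw [shiftUV, RingHom.comp_apply, map_C]
    exact shiftFun_C b _
  rw [h']
  simpa using h

theorem RTT_Tshift (a b : ℤ) : RTT (diffUV (Yangian n) (a - b)) (uInv _ * vInv _)
    ((Tshift n a).map inU) ((Tshift n b).map inV) := by
  intro i j k l
  have h := congrArg (shiftUV a b) (RTT_inU_inV (n := n) i j k l)
  simp only [diffUV, Int.cast_zero, zero_mul, add_zero, sub_smul, mul_smul, uInv_smul, vInv_smul,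
    Matrix.map_apply, map_sub, map_mul, shiftUV_inU, shiftUV_inV] at h
  have hx := one_add_mul_shiftUV_C_X (A := Yangian n) a b
  have hy := one_add_mul_shiftUV_X (A := Yangian n) a b
  rw [diffUV, add_smul, sub_smul, ← zsmul_eq_mul, smul_assoc, mul_smul, mul_smul]
  simp only [uInv_smul, vInv_smul, Tshift, Matrix.map_apply]
  have cx : ∀ z : (YSeries n)⟦X⟧, z * C X = C X * z := Subring.mem_center_iff.mp C_X_mem_center
  have cy : ∀ z : (YSeries n)⟦X⟧, z * X = X * z := Subring.mem_center_iff.mp X_mem_center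
  generalize (C X : (YSeries n)⟦X⟧) = x at *
  generalize (X : (YSeries n)⟦X⟧) = y at *
  generalize shiftUV a b x = x' at *
  generalize shiftUV a b y = y' at *
  generalize inU ((shift a) (T n i j)) * inV ((shift b) (T n k l)) -
    inV ((shift b) (T n k l)) * inU ((shift a) (T n i j)) = L at *
  generalize inU ((shift a) (T n k j)) * inV ((shift b) (T n i l)) -
    inV ((shift b) (T n k j)) * inU ((shift a) (T n i l)) = S at *
  have hcomm : (1 + (a : (YSeries n)⟦X⟧) * x) * (1 + (b : (YSeries n)⟦X⟧) * y) =
      (1 + (b : (YSeries n)⟦X⟧) * y) * (1 + (a : (YSeries n)⟦X⟧) * x) := by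
    refine Commute.eq (Commute.add_left (Commute.one_left _) (Commute.add_right
      (Commute.one_right _) ?_))
    exact ((Int.cast_commute a _).mul_left (cx _).symm)
  -- Here x' and y' are the shifted u⁻¹ and v⁻¹. Multiplying by (1 + ax)(1 + by) clears their
  -- denominators, and the cross terms produce the correction (a-b)xy.
  have h1 : (1 + (a : (YSeries n)⟦X⟧) * x) * (1 + (b : (YSeries n)⟦X⟧) * y) * (y' * L - x' * L) =
      y * L - x * L + (a - b) • (x * (y * L)) := by
    calc (1 + (a : (YSeries n)⟦X⟧) * x) * (1 + (b : (YSeries n)⟦X⟧) * y) * (y' * L - x' * L)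
        = (1 + (a : (YSeries n)⟦X⟧) * x) * ((1 + (b : (YSeries n)⟦X⟧) * y) * y') * L
          - (1 + (a : (YSeries n)⟦X⟧) * x) * (1 + (b : (YSeries n)⟦X⟧) * y) * x' * L := by
          noncomm_ring
      _ = (1 + (a : (YSeries n)⟦X⟧) * x) * y * L - (1 + (b : (YSeries n)⟦X⟧) * y) * x * L := by
          rw [hy, hcomm, mul_assoc _ _ x', hx]
      _ = _ := by
          rw [add_mul, add_mul, add_mul, add_mul, one_mul, one_mul, mul_assoc (b : (YSeries n)⟦X⟧),
            cx y, zsmul_eq_mul]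
          push_cast
          noncomm_ring
  have h2 : (1 + (a : (YSeries n)⟦X⟧) * x) * (1 + (b : (YSeries n)⟦X⟧) * y) * (x' * (y' * S)) =
      x * (y * S) := by
    rw [hcomm, mul_assoc, ← mul_assoc _ x', hx, ← mul_assoc, cx, mul_assoc, ← mul_assoc _ y', hy]
  rw [← h1, ← h2, h]

/-- Setting v = u in the relation for T(u) and T(v-1) turns both scalars into u⁻², which is
cancelled; this is the degenerate point R(1) = 1 - P. -/
theorem RTT_T : RTT (1 : ℂ) 1 (T n) (Tshift n (-1)) := by
  intro i j k l
  have h := congrArg diagonal (RTT_Tshift (n := n) 0 (-1) i j k l)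
  rw [diffUV, add_smul, sub_smul, ← zsmul_eq_mul, smul_assoc, mul_smul, mul_smul] at h
  simp only [uInv_smul, vInv_smul, Matrix.map_apply, map_add, map_sub, diagonal_X_mul,
    diagonal_C_X_mul, diagonal_inU_mul_inV, diagonal_inV_mul_inU, sub_self, zero_add, Tshift_zero,
    zero_sub, neg_neg, one_smul] at h
  rw [one_smul, one_smul]
  exact X_mul_cancel (X_mul_cancel h)

theorem RTT.map {A B K : Type*} [Ring A] [Ring B] [CommRing K] [Algebra K A] [Algebra K B]
    {c w : K} {M N : Matrix (Fin n) (Fin n) A} (h : RTT c w M N) (φ : A →ₐ[K] B) :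
    RTT c w (M.map φ) (N.map φ) := by
  intro i j k l
  simpa using congrArg φ (h i j k l)

theorem RTT_Tshift_succ (i : ℕ) :
    RTT (1 : ℂ) 1 (Tshift n (-(i : ℤ))) (Tshift n (-((i + 1 : ℕ) : ℤ))) := by
  have h := (RTT_T (n := n)).map (shift (-(i : ℤ)))
  rw [Tshift_map_shift] at h
  rwa [show -((i + 1 : ℕ) : ℤ) = -(i : ℤ) + -1 by push_cast; ring]

theorem coeff_e_commute (k l r s : ℕ) : Commute (coeff r (e n k)) (coeff s (e n l)) := by
  have h := antisymTrace_mul_comm (fun i => (Tshift n (-(i : ℤ))).map inU)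
    (fun j => (Tshift n (-(j : ℤ))).map inV) (fun i j => diffUV (Yangian n) (-(i : ℤ) - -(j : ℤ)))
    (uInv _ * vInv _) (fun i => (RTT_Tshift_succ i).map inU) (fun j => (RTT_Tshift_succ j).map inV)
    (fun i j => RTT_Tshift _ _) (fun i j => by simp only [diffUV]; push_cast; ring)
    (fun i j => by simp only [diffUV]; push_cast; ring) ?_ k l
  · have hU : ∀ k, inU (e n k) = _ := fun k =>
      map_antisymTrace (A := YSeries n) (B := (YSeries n)⟦X⟧) inU fun s : Fin k =>
        Tshift n (-(s : ℤ))
    have hV : ∀ k, inV (e n k) = _ := fun k =>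
      map_antisymTrace (A := YSeries n) (B := (YSeries n)⟦X⟧) inV fun s : Fin k =>
        Tshift n (-(s : ℤ))
    rw [← hU, ← hV] at h
    have := congrArg (fun z => coeff r (coeff s z)) h
    simp only [coeff_inU_mul_inV, coeff_inV_mul_inU] at this
    exact this
  · intro i j z hz
    -- With x = u - v - i + j, this is 1 - x² = -(x+1)(x-1) scaled by (u⁻¹v⁻¹)²; neither linear
    -- factor is a zero divisor.
    have hfac : uInv (Yangian n) * vInv _ * (uInv _ * vInv _) -
        diffUV _ (-(i : ℤ) - -(j : ℤ)) * diffUV _ (-(i : ℤ) - -(j : ℤ)) =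
        -(diffUV _ (-(i : ℤ) - -(j : ℤ) + 1) * diffUV _ (-(i : ℤ) - -(j : ℤ) - 1)) := by
      simp only [diffUV]; push_cast; ring
    rw [hfac, neg_smul, neg_eq_zero, mul_smul] at hz
    exact diffUV_smul_eq_zero (diffUV_smul_eq_zero hz)

end YangianRelations

/-! ### Laplace expansion of antisymmetrized traces -/

section Laplace

variable {A : Type*} [Ring A] {n : ℕ}

/-- The tuple `f` extended by the last term `x`. -/
def append {β : Type*} {k : ℕ} (f : Fin k → β) (x : β) : Fin (k + 1) → β :=
  Fin.snoc (α := fun _ => β) f x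

@[simp] theorem append_castSucc {β : Type*} {k : ℕ} (f : Fin k → β) (x : β) (s : Fin k) :
    append f x s.castSucc = f s := by simp [append]

@[simp] theorem append_last {β : Type*} {k : ℕ} (f : Fin k → β) (x : β) :
    append f x (Fin.last k) = x := by simp [append]

theorem append_restrict {β : Type*} {k : ℕ} (f : Fin (k + 1) → β) :
    append (fun s : Fin k => f s.castSucc) (f (Fin.last k)) = f := by
  funext s
  induction s using Fin.lastCases with
  | last => simp
  | cast s => simp

theorem sum_append {β M : Type*} [Fintype β] [AddCommMonoid M] {k : ℕ}
    (F : (Fin (k + 1) → β) → M) : ∑ I, F I = ∑ J : Fin k → β, ∑ a, F (append J a) := by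
  rw [← Fintype.sum_prod_type_right' fun a J => F (append J a)]
  exact (Fintype.sum_equiv (Fin.snocEquiv fun _ => β) _ _ fun _ => rfl).symm

/-- The permutation of `Fin (k + 1)` mapping `last` to `p` and inducing `σ` on the rest. -/
def permLast {k : ℕ} (p : Option (Fin k)) (σ : Equiv.Perm (Fin k)) : Equiv.Perm (Fin (k + 1)) :=
  finSuccEquivLast.symm.permCongr (Equiv.swap none p * Equiv.optionCongr σ)

theorem sum_permLast {M : Type*} [AddCommMonoid M] {k : ℕ} (F : Equiv.Perm (Fin (k + 1)) → M) :
    ∑ σ, F σ = ∑ σ, F (permLast none σ) + ∑ i, ∑ σ, F (permLast (some i) σ) := by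
  rw [← Fintype.sum_option fun p => ∑ σ, F (permLast p σ), ← Fintype.sum_prod_type']
  refine (Fintype.sum_equiv
    (Equiv.Perm.decomposeOption.symm.trans finSuccEquivLast.symm.permCongr) _ _ fun q => ?_).symm
  rfl

theorem permLast_none_castSucc {k : ℕ} (σ : Equiv.Perm (Fin k)) (s : Fin k) :
    permLast none σ s.castSucc = (σ s).castSucc := by
  simp [permLast, Equiv.permCongr_apply]

theorem permLast_none_last {k : ℕ} (σ : Equiv.Perm (Fin k)) :
    permLast none σ (Fin.last k) = Fin.last k := by
  simp [permLast, Equiv.permCongr_apply]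

theorem append_permLast_some {β : Type*} {k : ℕ} (i : Fin k) (σ : Equiv.Perm (Fin k)) (f : Fin k → β)
    (x : β) (s : Fin k) :
    append f x (permLast (some i) σ s.castSucc) = Function.update f i x (σ s) := by
  by_cases h : σ s = i
  · simp [permLast, Equiv.permCongr_apply, h]
  · have : Equiv.swap none (some i) (some (σ s)) = some (σ s) :=
      Equiv.swap_apply_of_ne_of_ne (by simp) (by simpa using h)
    simp [permLast, Equiv.permCongr_apply, h, this]

theorem permLast_some_last {k : ℕ} (i : Fin k) (σ : Equiv.Perm (Fin k)) :
    permLast (some i) σ (Fin.last k) = i.castSucc := by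
  simp [permLast, Equiv.permCongr_apply]

theorem sign_permLast_none {k : ℕ} (σ : Equiv.Perm (Fin k)) :
    Equiv.Perm.sign (permLast none σ) = Equiv.Perm.sign σ := by
  rw [permLast, Equiv.Perm.sign_permCongr]
  simp

theorem sign_permLast_some {k : ℕ} (i : Fin k) (σ : Equiv.Perm (Fin k)) :
    Equiv.Perm.sign (permLast (some i) σ) = -Equiv.Perm.sign σ := by
  rw [permLast, Equiv.Perm.sign_permCongr, Equiv.Perm.sign_mul, Equiv.Perm.sign_swap (by simp),
    Equiv.optionCongr_sign]
  simp

/-- Split by the image of the last position. If it is i, the last matrix reads the row index I i,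
the others see a in its place, and the sign changes. -/
theorem altEntry_append {k : ℕ} (M : Fin k → Matrix (Fin n) (Fin n) A)
    (N : Matrix (Fin n) (Fin n) A) (I J : Fin k → Fin n) (a b : Fin n) :
    altEntry (append M N) (append I a) (append J b) =
      altEntry M I J * N a b - ∑ i, altEntry M (Function.update I i a) J * N (I i) b := by
  rw [altEntry, sum_permLast, sub_eq_add_neg, ← Finset.sum_neg_distrib]
  congr 1
  · rw [altEntry, Finset.sum_mul]
    refine Finset.sum_congr rfl fun σ _ => ?_
    rw [prod_ofFn_succ, sign_permLast_none, permLast_none_last, smul_mul_assoc]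
    simp [permLast_none_castSucc]
  · refine Finset.sum_congr rfl fun i _ => ?_
    rw [altEntry, Finset.sum_mul, ← Finset.sum_neg_distrib]
    refine Finset.sum_congr rfl fun σ _ => ?_
    rw [prod_ofFn_succ, sign_permLast_some, permLast_some_last, smul_mul_assoc]
    simp only [append_permLast_some, append_castSucc, append_last]
    simp

theorem sum_altEntry_append {k : ℕ} (M : Fin k → Matrix (Fin n) (Fin n) A)
    (N : Matrix (Fin n) (Fin n) A) :
    ∑ I, altEntry (append M N) I I = (∑ I, altEntry M I I) * N.trace -
      ∑ i, ∑ I : Fin k → Fin n, ∑ a, altEntry M (Function.update I i a) I * N (I i) a := by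
  rw [sum_append]
  simp only [altEntry_append, Finset.sum_sub_distrib, Matrix.trace, Matrix.diag,
    Finset.sum_mul_sum]
  congr 1
  rw [Finset.sum_comm]
  simp only [Finset.sum_comm (γ := Fin k)]
  rw [Finset.sum_comm]

theorem altEntry_comp_left {k : ℕ} (M : Fin k → Matrix (Fin n) (Fin n) A) (I J : Fin k → Fin n)
    (π : Equiv.Perm (Fin k)) :
    altEntry M (I ∘ π) J = (Equiv.Perm.sign π : ℤ) • altEntry M I J := by
  rw [altEntry, altEntry, Finset.smul_sum]
  refine Fintype.sum_equiv (Equiv.mulLeft π) _ _ fun σ => ?_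
  rw [Equiv.coe_mulLeft, smul_smul, Equiv.Perm.sign_mul, Units.val_mul, ← mul_assoc,
    ← Units.val_mul, Int.units_mul_self, Units.val_one, one_mul]
  rfl

theorem altEntry_eq_zero [Algebra ℂ A] {k : ℕ} (M : Fin k → Matrix (Fin n) (Fin n) A)
    (I J : Fin k → Fin n) {s t : Fin k} (hst : s ≠ t) (h : I s = I t) : altEntry M I J = 0 := by
  have h1 := altEntry_comp_left M I J (Equiv.swap s t)
  have h2 : I ∘ Equiv.swap s t = I := by
    funext r
    by_cases hs : r = s
    · subst hs; simp [h]
    by_cases ht : r = t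
    · subst ht; simp [h]
    simp [Equiv.swap_apply_of_ne_of_ne hs ht]
  rw [h2, Equiv.Perm.sign_swap hst] at h1
  have h3 : (2 : ℂ) • altEntry M I J = 0 := by
    rw [two_smul]
    nth_rw 1 [h1]
    simp
  exact (smul_eq_zero.mp h3).resolve_left two_ne_zero

theorem antisymTrace_eq_zero [Algebra ℂ A] {k : ℕ} (hk : n < k)
    (M : Fin k → Matrix (Fin n) (Fin n) A) : antisymTrace M = 0 := by
  rw [antisymTrace_eq, Finset.sum_eq_zero, smul_zero]
  intro I _
  obtain ⟨s, t, hst, h⟩ := Fintype.exists_ne_map_eq_of_card_lt I (by simpa using hk)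
  exact altEntry_eq_zero M I I hst h

theorem factorial_smul_antisymTrace [Algebra ℂ A] {k : ℕ} (M : Fin k → Matrix (Fin n) (Fin n) A) :
    (k.factorial : ℂ) • antisymTrace M = ∑ I, altEntry M I I := by
  rw [antisymTrace_eq, smul_smul, mul_inv_cancel₀ (by exact_mod_cast k.factorial_ne_zero),
    one_smul]

/-- Partial trace of the antisymmetrizer: the fixed last position contributes n, and each of the k
other images contributes -1. -/
theorem antisymTrace_append_one [Algebra ℂ A] {k : ℕ} (M : Fin k → Matrix (Fin n) (Fin n) A) :
    ((k + 1 : ℕ) : ℂ) • antisymTrace (append M 1) = ((n : ℂ) - k) • antisymTrace M := by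
  have h : ∀ i, ∑ I : Fin k → Fin n, ∑ a, altEntry M (Function.update I i a) I *
      (1 : Matrix (Fin n) (Fin n) A) (I i) a = ∑ I, altEntry M I I := by
    intro i
    refine Finset.sum_congr rfl fun I _ => ?_
    rw [Finset.sum_eq_single (I i)]
    · simp
    · intro a _ ha
      rw [Matrix.one_apply_ne ha.symm, mul_zero]
    · simp
  have h0 := sum_altEntry_append M 1
  rw [Finset.sum_congr rfl fun i _ => h i, ← factorial_smul_antisymTrace,
    ← factorial_smul_antisymTrace, Matrix.trace_one, Finset.sum_const, Finset.card_univ,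
    Fintype.card_fin, Fintype.card_fin, ← Nat.cast_smul_eq_nsmul ℂ, Nat.factorial_succ, mul_comm, Nat.cast_mul,
    mul_smul] at h0
  have h1 : ((k.factorial : ℂ) • antisymTrace M) * ((n : ℕ) : A) =
      (n : ℂ) • (k.factorial : ℂ) • antisymTrace M := by
    rw [← nsmul_eq_mul', Nat.cast_smul_eq_nsmul ℂ n]
  rw [h1, ← sub_smul, smul_comm ((n : ℂ) - k)] at h0
  exact (smul_right_inj (show (k.factorial : ℂ) ≠ 0 from
      by exact_mod_cast k.factorial_ne_zero)).mp h0

/-- The recursion behind Newton's identities: the correction terms of the Laplace expansion merge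
the last two matrices into their product. -/
theorem antisymTrace_append [Algebra ℂ A] {k : ℕ} (M : Fin k → Matrix (Fin n) (Fin n) A)
    (L N : Matrix (Fin n) (Fin n) A)
    (hM : ∀ I J, ∀ π : Equiv.Perm (Fin (k + 1)), altEntry (append M L) I (J ∘ π) =
      (Equiv.Perm.sign π : ℤ) • altEntry (append M L) I J) :
    ((k + 2 : ℕ) : ℂ) • antisymTrace (append (append M L) N) =
      antisymTrace (append M L) * N.trace - ((k + 1 : ℕ) : ℂ) • antisymTrace (append M (L * N)) := by
  -- All k+1 correction terms agree: relabelling by the swap of i with the last position produces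
  -- one sign from the rows and one, by `hM`, from the columns.
  have h1 : ∀ i, ∑ I : Fin (k + 1) → Fin n, ∑ a,
      altEntry (append M L) (Function.update I i a) I * N (I i) a =
      ∑ I : Fin (k + 1) → Fin n, ∑ a,
        altEntry (append M L) (Function.update I (Fin.last k) a) I * N (I (Fin.last k)) a := by
    intro i
    refine Fintype.sum_equiv ((Equiv.swap i (Fin.last k)).arrowCongr (Equiv.refl _)) _ _ fun I => ?_
    refine Finset.sum_congr rfl fun a _ => ?_
    set π := Equiv.swap i (Fin.last k) with hπ
    have e1 : π.arrowCongr (Equiv.refl _) I = I ∘ π := by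
      funext s; simp [hπ]
    have e2 : Function.update (I ∘ π) (Fin.last k) a = Function.update I i a ∘ π := by
      funext s
      by_cases hs : s = Fin.last k
      · subst hs; simp [hπ]
      · have : π s ≠ i := by
          intro h
          apply hs
          have h' := congrArg π h
          rwa [hπ, Equiv.swap_apply_self, Equiv.swap_apply_left] at h'
        simp [hs, this]
    rw [e1, e2, altEntry_comp_left, hM, smul_smul, ← Units.val_mul, Int.units_mul_self,
      Units.val_one, one_smul]
    simp [hπ]
  -- Summing over the contracted last index performs the matrix multiplication L * N.
  have h2 : ∑ I : Fin (k + 1) → Fin n, ∑ a,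
      altEntry (append M L) (Function.update I (Fin.last k) a) I * N (I (Fin.last k)) a =
      ∑ I, altEntry (append M (L * N)) I I := by
    rw [sum_append, sum_append]
    refine Finset.sum_congr rfl fun J _ => ?_
    rw [Finset.sum_comm]
    refine Finset.sum_congr rfl fun a _ => ?_
    have e1 : ∀ b, Function.update (append J b) (Fin.last k) a = append J a := fun b =>
      Fin.update_snoc_last _ _ _
    simp only [e1, append_last, altEntry, Finset.sum_mul]
    rw [Finset.sum_comm]
    refine Finset.sum_congr rfl fun σ _ => ?_
    simp only [prod_ofFn_succ, append_castSucc, append_last, Matrix.mul_apply, Finset.mul_sum,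
      Finset.smul_sum, smul_mul_assoc, mul_assoc]
  have h0 := sum_altEntry_append (append M L) N
  rw [Finset.sum_congr rfl fun i _ => (h1 i).trans h2, ← factorial_smul_antisymTrace,
    ← factorial_smul_antisymTrace, ← factorial_smul_antisymTrace, Finset.sum_const,
    Finset.card_univ, Fintype.card_fin, ← Nat.cast_smul_eq_nsmul ℂ, Nat.factorial_succ (k + 1),
    mul_comm, Nat.cast_mul, mul_smul, smul_mul_assoc, smul_comm ((k + 1 : ℕ) : ℂ), ← smul_sub] at h0
  exact (smul_right_inj (show ((k + 1).factorial : ℂ) ≠ 0 from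
      by exact_mod_cast (k + 1).factorial_ne_zero)).mp h0

/-- Row antisymmetry is built into `altEntry`; column antisymmetry comes from the RTT relations
between consecutive matrices, which make the product compatible with every adjacent swap. -/
theorem altEntry_comp_right [Algebra ℂ A] {k : ℕ} {M : ℕ → Matrix (Fin n) (Fin n) A}
    (hM : ∀ i, RTT (1 : ℂ) 1 (M i) (M (i + 1))) (I J : Fin (k + 1) → Fin n)
    (π : Equiv.Perm (Fin (k + 1))) :
    altEntry (fun s : Fin (k + 1) => M s) I (J ∘ π) =
      (Equiv.Perm.sign π : ℤ) • altEntry (fun s : Fin (k + 1) => M s) I J := by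
  have hX : (List.ofFn fun s : Fin (k + 1) => leg s (M s)).prod =
      ordProd (fun s => site (Fin.ofNat (k + 1) s) (M s)) (k + 1) := by
    rw [ordProd_eq_ofFn]
    congr 2
    funext s
    simp [leg_eq_site, Fin.ofNat, Nat.mod_eq_of_lt s.isLt]
  -- Right multiplication by `tensorPerm σ` composes the column index with `σ.symm`, hence the use
  -- of `π.symm`.
  have hF := mul_map_of_adjacent (k := k)
    (tensorPermHom : _ →* TensorEnd n (k + 1) A)
    (F := antisymmetrizer (k + 1) * (List.ofFn fun s : Fin (k + 1) => leg s (M s)).prod)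
    (fun i => ?_) π.symm
  · have h := congrFun (congrFun hF I) J
    change (_ * tensorPerm π.symm : TensorEnd n (k + 1) A) I J = _ at h
    rw [mul_tensorPerm_apply, Matrix.smul_apply, antisymmetrizer_mul_apply,
      antisymmetrizer_mul_apply, Equiv.symm_symm, Equiv.Perm.sign_symm, smul_comm] at h
    exact (smul_right_inj (show (((k + 1).factorial : ℂ)⁻¹) ≠ 0 from
      inv_ne_zero (by exact_mod_cast (k + 1).factorial_ne_zero))).mp h
  · rw [hX]
    have h1 : Fin.ofNat (k + 1) i = i.castSucc := by
      ext; simp [Fin.ofNat, Nat.mod_eq_of_lt (show (i : ℕ) < k + 1 by omega)]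
    have h2 : Fin.ofNat (k + 1) (i + 1) = i.succ := by
      ext; simp [Fin.ofNat]
    have hA := altSum_mul (tensorPermHom : _ →* TensorEnd n (k + 1) A)
      (Equiv.swap i.castSucc i.succ)
    rw [Equiv.Perm.sign_swap (Fin.castSucc_lt_succ).ne] at hA
    rw [← h1, ← h2] at hA ⊢
    refine Compat.mul_eq_neg (.ordProd (tensorPerm_swap_mul_self _ _) (i := i) (by omega)
      (fun s hs h1 h2 => commute_tensorPerm_swap_site (ofNat_ne hs (by omega) h1)
        (ofNat_ne hs (by omega) h2) _)
      ((hM i).compat (ofNat_ne (by omega) (by omega) (by omega)))) ?_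
    rw [antisymmetrizer_eq_altSum]
    simpa using hA

end Laplace

/-! ### Hessenberg determinants -/

section Hessenberg

/-- The transpose reconciles the conventions M (σ i) i of `Matrix.det` and M i (σ i) of `rdet`;
commutativity upstairs fixes the order of the factors. -/
theorem map_det_eq_rdet {R S : Type*} [CommRing R] [Ring S] (φ : R →+* S) {k : ℕ}
    (M : Matrix (Fin k) (Fin k) R) : φ M.det = rdet (M.map φ) := by
  rw [← Matrix.det_transpose, Matrix.det_apply, map_sum, rdet]
  refine Finset.sum_congr rfl fun σ _ => ?_
  rw [Units.smul_def, map_zsmul, ← List.prod_ofFn, map_list_prod, List.map_ofFn]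
  rfl

variable {R : Type*} [CommRing R]

/-- The leading principal minors of an infinite matrix. -/
def leadingMinor (H : ℕ → ℕ → R) (m : ℕ) : R := (Matrix.of fun i j : Fin m => H i j).det

/-- The leading principal minor of order `m + 1` with the last row replaced by `r`. -/
def borderedMinor (H : ℕ → ℕ → R) (r : ℕ → R) (m : ℕ) : R :=
  (Matrix.of fun i j : Fin (m + 1) => if (i : ℕ) < m then H i j else r j).det

theorem leadingMinor_succ (H : ℕ → ℕ → R) (m : ℕ) :
    leadingMinor H (m + 1) = borderedMinor H (H m) m := by
  rw [leadingMinor, borderedMinor]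
  congr 1
  ext i j
  simp only [Matrix.of_apply]
  split_ifs with h
  · rfl
  · rw [show (i : ℕ) = m by omega]

theorem borderedMinor_zero (H : ℕ → ℕ → R) (r : ℕ → R) : borderedMinor H r 0 = r 0 := by
  simp [borderedMinor]

/-- Expansion along the last column, in which the Hessenberg shape leaves only the last two entries.
-/
theorem borderedMinor_succ {H : ℕ → ℕ → R} (hH : ∀ i j, i + 1 < j → H i j = 0) (r : ℕ → R) (m : ℕ) :
    borderedMinor H r (m + 1) =
      r (m + 1) * leadingMinor H (m + 1) - H m (m + 1) * borderedMinor H r m := by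
  rw [borderedMinor, Matrix.det_succ_column _ (Fin.last (m + 1)), Fin.sum_univ_castSucc,
    Fin.sum_univ_castSucc, Finset.sum_eq_zero, zero_add]
  · have h1 : ∀ j : Fin (m + 1), ((Fin.last m).castSucc.succAbove j : ℕ) =
        if (j : ℕ) < m then (j : ℕ) else m + 1 := by
      intro j
      rw [Fin.succAbove]
      split_ifs with h2 h3 h3
      · simp
      · exact absurd h2 (by simpa [Fin.lt_def] using h3)
      · exact absurd h3 (by simpa [Fin.lt_def] using h2)
      · simp only [Fin.val_succ]; omega
    have e1 : Matrix.submatrix (Matrix.of fun i j : Fin (m + 1 + 1) =>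
        if (i : ℕ) < m + 1 then H i j else r j) (Fin.last m).castSucc.succAbove
        (Fin.last (m + 1)).succAbove =
        Matrix.of fun i j : Fin (m + 1) => if (i : ℕ) < m then H i j else r j := by
      ext i j
      simp only [Matrix.submatrix_apply, Matrix.of_apply, h1, Fin.succAbove_last, Fin.val_castSucc]
      by_cases h : (i : ℕ) < m
      · simp [h, show (i : ℕ) < m + 1 by omega]
      · simp [h]
    have e2 : Matrix.submatrix (Matrix.of fun i j : Fin (m + 1 + 1) =>
        if (i : ℕ) < m + 1 then H i j else r j) (Fin.last (m + 1)).succAbove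
        (Fin.last (m + 1)).succAbove = Matrix.of fun i j : Fin (m + 1) => H i j := by
      ext i j
      simp only [Matrix.submatrix_apply, Matrix.of_apply, Fin.succAbove_last, Fin.val_castSucc]
      rw [if_pos i.isLt]
    rw [e1, e2, leadingMinor, borderedMinor]
    simp only [Matrix.of_apply, Fin.val_castSucc, Fin.val_last, lt_add_iff_pos_right, zero_lt_one,
      if_true, lt_irrefl, if_false]
    have s1 : (-1 : R) ^ (m + (m + 1)) = -1 := Odd.neg_one_pow ⟨m, by ring⟩
    have s2 : (-1 : R) ^ (m + 1 + (m + 1)) = 1 := Even.neg_one_pow ⟨m + 1, rfl⟩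
    rw [s1, s2]
    ring
  · intro i _
    have : (Matrix.of fun i j : Fin (m + 1 + 1) => if (i : ℕ) < m + 1 then H i j else r j)
        i.castSucc.castSucc (Fin.last (m + 1)) = 0 := by
      simp only [Matrix.of_apply, Fin.val_castSucc, Fin.val_last]
      rw [if_pos (by omega), hH _ _ (by omega)]
    rw [this]
    ring

end Hessenberg

/-! ### Elementary, complete and power sum series in a commutative setting -/

section Symmetric

variable {B : Type*} [CommRing B] [Algebra ℂ B]

/-- The matrix expressing the complete symmetric series in terms of the power sums. -/
def powerSumMatrix (p : ℕ → B⟦X⟧) (i j : ℕ) : B⟦X⟧ :=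
  if j ≤ i then shift ((i : ℕ) : ℤ) (p (i - j + 1)) else if j = i + 1 then -((i + 1 : ℕ) : B⟦X⟧)
  else 0

/-- The complete symmetric series associated with the power sums `p`. -/
def complete (p : ℕ → B⟦X⟧) (m : ℕ) : B⟦X⟧ :=
  ((m.factorial : ℂ)⁻¹) • leadingMinor (powerSumMatrix p) m

theorem leadingMinor_powerSumMatrix (p : ℕ → B⟦X⟧) (m : ℕ) :
    leadingMinor (powerSumMatrix p) m = (m.factorial : ℂ) • complete p m := by
  rw [complete, smul_smul, mul_inv_cancel₀ (by exact_mod_cast m.factorial_ne_zero), one_smul]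

theorem complete_zero (p : ℕ → B⟦X⟧) : complete p 0 = 1 := by
  simp [complete, leadingMinor]

/-- The superdiagonal entries -(i+1) cancel the alternating signs of the expansion and accumulate to
the factorial. An arbitrary last row r is kept so that the induction applies. -/
theorem borderedMinor_powerSumMatrix (p r : ℕ → B⟦X⟧) (m : ℕ) :
    borderedMinor (powerSumMatrix p) r m =
      (m.factorial : ℂ) • ∑ j ∈ Finset.range (m + 1), r j * complete p j := by
  induction m with
  | zero => simp [borderedMinor_zero, complete_zero]
  | succ m ih =>
    have hz : ∀ z : B⟦X⟧, ((m + 1 : ℕ) : ℂ) • z = ((m + 1 : ℕ) : B⟦X⟧) * z := fun z => by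
      rw [Nat.cast_smul_eq_nsmul, nsmul_eq_mul]
    rw [borderedMinor_succ, ih, Finset.sum_range_succ _ (m + 1), leadingMinor_powerSumMatrix,
      smul_add, mul_smul_comm, powerSumMatrix, if_neg (by omega), if_pos rfl, Nat.factorial_succ,
      Nat.cast_mul, mul_smul _ _ (∑ j ∈ _, _), hz, neg_mul]
    · abel
    · intro i j hij
      rw [powerSumMatrix, if_neg (by omega), if_neg (by omega)]

theorem nsmul_complete (p : ℕ → B⟦X⟧) (m : ℕ) :
    (m : ℂ) • complete p m =
      ∑ q ∈ Finset.range m, shift ((m : ℤ) - 1) (p (m - q)) * complete p q := by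
  rcases m with - | m
  · simp
  have h := leadingMinor_succ (powerSumMatrix p) m
  rw [borderedMinor_powerSumMatrix, leadingMinor_powerSumMatrix, Nat.factorial_succ, mul_comm,
    Nat.cast_mul, mul_smul] at h
  have h' := (smul_right_inj (show (m.factorial : ℂ) ≠ 0 from
    by exact_mod_cast m.factorial_ne_zero)).mp h
  rw [h']
  refine Finset.sum_congr rfl fun q hq => ?_
  have hq' : q ≤ m := by simpa [Nat.lt_succ_iff] using hq
  rw [powerSumMatrix, if_pos hq', show m - q + 1 = m + 1 - q by omega]
  congr 3
  push_cast
  ring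

variable {e p : ℕ → B⟦X⟧}

/-- Multiply by m = j + (m-j), using Newton for j e_j and `nsmul_complete` for (m-j) h_{m-j}. The
two resulting double sums of terms e·p·h cancel. -/
theorem sum_elementary_mul_complete
    (hN : ∀ j : ℕ, (j : ℂ) • ((-1) ^ j * e j) =
      -∑ t ∈ Finset.range j, (-1) ^ t * e t * shift (-(t : ℤ)) (p (j - t)))
    {m : ℕ} (hm : m ≠ 0) :
    ∑ j ∈ Finset.range (m + 1), (-1) ^ j * e j * shift (1 - (m : ℤ)) (complete p (m - j)) = 0 := by
  have h1 : ∀ j ∈ Finset.range (m + 1),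
      (m : ℂ) • ((-1) ^ j * e j * shift (1 - (m : ℤ)) (complete p (m - j))) =
      -∑ t ∈ Finset.range j, (-1) ^ t * e t * shift (-(t : ℤ)) (p (j - t)) *
          shift (1 - (m : ℤ)) (complete p (m - j)) +
        ∑ q ∈ Finset.range (m - j), (-1) ^ j * e j * shift (-(j : ℤ)) (p (m - j - q)) *
          shift (1 - (m : ℤ)) (complete p q) := by
    intro j hj
    have hj' : j ≤ m := by simpa [Nat.lt_succ_iff] using hj
    have hc := congrArg (shift (1 - (m : ℤ))) (nsmul_complete p (m - j))
    rw [map_smul, map_sum] at hc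
    have hmj : (m : ℂ) = (j : ℂ) + ((m - j : ℕ) : ℂ) := by
      rw [← Nat.cast_add, Nat.add_sub_cancel' hj']
    rw [hmj, add_smul, ← smul_mul_assoc, hN, ← mul_smul_comm, hc, neg_mul, Finset.sum_mul,
      Finset.mul_sum]
    congr 1
    refine Finset.sum_congr rfl fun q _ => ?_
    rw [map_mul, shift_shift, ← mul_assoc]
    congr 4
    push_cast [hj']
    ring
  have h2 : (m : ℂ) • ∑ j ∈ Finset.range (m + 1),
      (-1) ^ j * e j * shift (1 - (m : ℤ)) (complete p (m - j)) = 0 := by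
    rw [Finset.smul_sum, Finset.sum_congr rfl h1, Finset.sum_add_distrib, Finset.sum_neg_distrib,
      neg_add_eq_zero, Finset.sum_sigma', Finset.sum_sigma']
    -- A term is determined by the index of e and the index of h; the index of p is what remains of
    -- m.
    refine Finset.sum_bij' (fun a _ => ⟨a.2, m - a.1⟩) (fun b _ => ⟨m - b.2, b.1⟩) ?_ ?_ ?_ ?_ ?_
    · rintro ⟨j, t⟩ h
      simp only [Finset.mem_sigma, Finset.mem_range] at h ⊢
      omega
    · rintro ⟨t, q⟩ h
      simp only [Finset.mem_sigma, Finset.mem_range] at h ⊢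
      omega
    · rintro ⟨j, t⟩ h
      simp only [Finset.mem_sigma, Finset.mem_range] at h
      simp only [Sigma.mk.injEq, heq_eq_eq, and_true]
      omega
    · rintro ⟨t, q⟩ h
      simp only [Finset.mem_sigma, Finset.mem_range] at h
      simp only [Sigma.mk.injEq, heq_eq_eq, true_and]
      omega
    · rintro ⟨j, t⟩ h
      simp only [Finset.mem_sigma, Finset.mem_range] at h
      simp only
      rw [show m - t - (m - j) = j - t by omega]
  exact (smul_eq_zero.mp h2).resolve_left (by exact_mod_cast hm)

/-- The complete symmetric series with an integer index. -/
def completeInt (p : ℕ → B⟦X⟧) : ℤ → B⟦X⟧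
  | Int.ofNat m => complete p m
  | Int.negSucc _ => 0

theorem completeInt_natCast (p : ℕ → B⟦X⟧) (m : ℕ) : completeInt p (m : ℤ) = complete p m := rfl

theorem completeInt_of_neg (p : ℕ → B⟦X⟧) {m : ℤ} (hm : m < 0) : completeInt p m = 0 := by
  obtain ⟨k, rfl⟩ := Int.eq_negSucc_of_lt_zero hm
  rfl

/-- The transpose of the matrix expressing the elementary series in terms of the complete ones. -/
def completeMatrix (p : ℕ → B⟦X⟧) (i j : ℕ) : B⟦X⟧ :=
  shift (-(i : ℤ)) (completeInt p ((i : ℤ) - j + 1))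

/-- The superdiagonal is h_0 = 1, so the signs alternate. In the transposed matrix all entries of a
row carry the same shift, matching `sum_elementary_mul_complete` when the last row is inserted. -/
theorem borderedMinor_completeMatrix (p r : ℕ → B⟦X⟧) (m : ℕ) :
    borderedMinor (completeMatrix p) r m =
      ∑ j ∈ Finset.range (m + 1), (-1) ^ (m - j) * r j * leadingMinor (completeMatrix p) j := by
  induction m with
  | zero => simp [borderedMinor_zero, leadingMinor]
  | succ m ih =>
    have h1 : completeMatrix p m (m + 1) = 1 := by
      rw [completeMatrix, show (m : ℤ) - ((m + 1 : ℕ) : ℤ) + 1 = ((0 : ℕ) : ℤ) by push_cast; ring,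
        completeInt_natCast, complete_zero, map_one]
    rw [borderedMinor_succ, ih, Finset.sum_range_succ _ (m + 1), h1, Nat.sub_self, pow_zero, one_mul,
      one_mul, sub_eq_neg_add, ← Finset.sum_neg_distrib]
    · congr 1
      refine Finset.sum_congr rfl fun j hj => ?_
      have hj' : j ≤ m := by simpa [Nat.lt_succ_iff] using hj
      rw [Nat.sub_add_comm hj', pow_succ]
      ring
    · intro i j hij
      rw [completeMatrix, completeInt_of_neg p (by omega), map_zero]

theorem elementary_eq_leadingMinor (h0 : e 0 = 1)
    (hN : ∀ j : ℕ, (j : ℂ) • ((-1) ^ j * e j) =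
      -∑ t ∈ Finset.range j, (-1) ^ t * e t * shift (-(t : ℤ)) (p (j - t))) (m : ℕ) :
    e m = leadingMinor (completeMatrix p) m := by
  induction m using Nat.strong_induction_on with
  | _ m ih =>
    rcases m with - | m
    · simp [h0, leadingMinor]
    have h := sum_elementary_mul_complete hN (Nat.succ_ne_zero m)
    rw [Finset.sum_range_succ, Nat.succ_eq_add_one, Nat.sub_self, complete_zero, map_one,
      mul_one] at h
    rw [leadingMinor_succ, borderedMinor_completeMatrix]
    have h2 : ∀ j ∈ Finset.range (m + 1), (-1) ^ (m - j) * completeMatrix p m j *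
        leadingMinor (completeMatrix p) j =
        (-1) ^ m * ((-1) ^ j * e j * shift (1 - ((m + 1 : ℕ) : ℤ)) (complete p (m + 1 - j))) := by
      intro j hj
      have hj' : j ≤ m := by simpa [Nat.lt_succ_iff] using hj
      rw [completeMatrix, ← ih j (by omega),
        show (m : ℤ) - j + 1 = ((m + 1 - j : ℕ) : ℤ) by push_cast [show j ≤ m + 1 by omega]; ring,
        completeInt_natCast, show (1 - ((m + 1 : ℕ) : ℤ)) = -(m : ℤ) by push_cast; ring]
      have hs : (-1 : B⟦X⟧) ^ (m - j) = (-1) ^ m * (-1) ^ j := by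
        have h3 : (-1 : B⟦X⟧) ^ m = (-1) ^ (m - j) * (-1) ^ j := by
          rw [← pow_add, Nat.sub_add_cancel hj']
        have h4 : (-1 : B⟦X⟧) ^ j * (-1) ^ j = 1 := by
          rw [← pow_add, Even.neg_one_pow ⟨j, rfl⟩]
        rw [h3, mul_assoc, h4, mul_one]
      rw [hs]
      ring
    rw [Finset.sum_congr rfl h2, ← Finset.mul_sum, eq_neg_of_add_eq_zero_left h]
    have h4 : (-1 : B⟦X⟧) ^ m * (-1) ^ m = 1 := by
      rw [← pow_add, Even.neg_one_pow ⟨m, rfl⟩]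
    rw [pow_succ]
    linear_combination (-e (m + 1)) * h4

end Symmetric

/-! ### Newton's identities and the Bethe subalgebra -/

section Newton

variable {n : ℕ}

/-- `T(u - a) T(u - a - 1) ⋯ T(u - a - m + 1)`. -/
def shiftedProd (n a m : ℕ) : Matrix (Fin n) (Fin n) (YSeries n) :=
  (List.ofFn fun s : Fin m => Tshift n (-((a + s : ℕ) : ℤ))).prod

theorem shiftedProd_succ (a m : ℕ) :
    shiftedProd n a (m + 1) = Tshift n (-(a : ℤ)) * shiftedProd n (a + 1) m := by
  rw [shiftedProd, List.ofFn_succ, List.prod_cons, shiftedProd]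
  congr 3
  funext s
  rw [Fin.val_succ, add_right_comm, add_assoc]

theorem shiftedProd_one (a : ℕ) : shiftedProd n a 1 = Tshift n (-(a : ℤ)) := by
  simp [shiftedProd]

theorem trace_shiftedProd (a m : ℕ) :
    (shiftedProd n a m).trace = shift (-(a : ℤ)) (pMinus n m) := by
  have h : shiftedProd n a m = (shift (-(a : ℤ)) : YSeries n →ₐ[ℂ] YSeries n).mapMatrix
      (List.ofFn fun s : Fin m => Tshift n (-(s : ℤ))).prod := by
    rw [map_list_prod, List.map_ofFn, shiftedProd]
    congr 2
    funext s
    change _ = (Tshift n (-(s : ℤ))).map (shift (-(a : ℤ)))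
    rw [Tshift_map_shift]
    congr 1
    push_cast
    ring
  rw [h, pMinus, AddMonoidHom.map_trace]
  rfl

theorem append_Tshift (k : ℕ) :
    append (fun s : Fin k => Tshift n (-(s : ℤ))) (Tshift n (-(k : ℤ))) =
      fun s : Fin (k + 1) => Tshift n (-(s : ℤ)) := by
  rw [← append_restrict fun s : Fin (k + 1) => Tshift n (-(s : ℤ))]
  simp

theorem e_zero : e n 0 = 1 := antisymTrace_fin_zero _

theorem e_eq_zero {k : ℕ} (hk : n < k) : e n k = 0 := antisymTrace_eq_zero hk _

/-- Iterating `antisymTrace_append` feeds the factors T(u-k+1), T(u-k+2), … one by one into the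
product in the last slot, each step splitting off a term e·p. -/
theorem antisymTrace_append_shiftedProd (k m : ℕ) :
    ((k + 1 : ℕ) : ℂ) • antisymTrace
        (append (fun s : Fin k => Tshift n (-(s : ℤ))) (shiftedProd n k m)) =
      ∑ i ∈ Finset.range (k + 1),
        (-1) ^ i * e n (k - i) * shift (-((k - i : ℕ) : ℤ)) (pMinus n (m + i)) := by
  induction k generalizing m with
  | zero =>
    have h := sum_altEntry_append (fun s : Fin 0 => Tshift n (-(s : ℤ))) (shiftedProd n 0 m)
    rw [← factorial_smul_antisymTrace, ← factorial_smul_antisymTrace, antisymTrace_fin_zero,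
      trace_shiftedProd] at h
    simpa [e_zero] using h
  | succ k ih =>
    have h := antisymTrace_append (fun s : Fin k => Tshift n (-(s : ℤ))) (Tshift n (-(k : ℤ)))
      (shiftedProd n (k + 1) m) (by
        intro I J π
        rw [append_Tshift]
        exact altEntry_comp_right (M := fun s => Tshift n (-(s : ℤ))) RTT_Tshift_succ I J π)
    rw [← shiftedProd_succ, ih, append_Tshift, trace_shiftedProd] at h
    rw [h, Finset.sum_range_succ' _ (k + 1), sub_eq_neg_add, ← Finset.sum_neg_distrib]
    congr 1
    · refine Finset.sum_congr rfl fun i _ => ?_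
      rw [show k + 1 - (i + 1) = k - i by omega, show m + 1 + i = m + (i + 1) by omega, pow_succ]
      simp
    · simp [e]

/-- The case m = 1 of `antisymTrace_append_shiftedProd`, where the product in the last slot is the
single matrix completing e_{k+1}, with the summation reversed. -/
theorem newton (j : ℕ) : (j : ℂ) • ((-1) ^ j * e n j) =
    -∑ t ∈ Finset.range j, (-1) ^ t * e n t * shift (-(t : ℤ)) (pMinus n (j - t)) := by
  rcases j with - | k
  · simp
  have h := antisymTrace_append_shiftedProd (n := n) k 1
  rw [shiftedProd_one, append_Tshift] at h
  change _ • e n (k + 1) = _ at h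
  rw [← mul_smul_comm, h, ← Finset.sum_range_reflect, Finset.mul_sum, ← Finset.sum_neg_distrib]
  refine Finset.sum_congr rfl fun t ht => ?_
  have ht' : t ≤ k := by simpa [Nat.lt_succ_iff] using ht
  rw [show k + 1 - 1 - t = k - t by omega, show k - (k - t) = t by omega,
    show 1 + (k - t) = k + 1 - t by omega]
  have hs : (-1 : YSeries n) ^ (k + 1) * (-1) ^ (k - t) = -(-1) ^ t := by
    rw [← pow_add, show k + 1 + (k - t) = (k - t) + (k - t) + t + 1 by omega, pow_succ, pow_add,
      Even.neg_one_pow ⟨k - t, rfl⟩]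
    simp
  rw [← mul_assoc, ← mul_assoc, hs]
  simp [mul_assoc]

end Newton

/-! ### The Bethe subalgebra: generators, commutativity and lifts to a commutative model. -/

section Bethe

variable {n : ℕ}

/-- The idle factors are traced out one at a time; the constant is the product of (n-N)/(N+1) over k
≤ N < n, nonzero because N stays below n. -/
theorem exists_betheSeries_eq {k : ℕ} (hk : k ≤ n) :
    ∃ c : ℂ, c ≠ 0 ∧ betheSeries n 1 k = c • e n k := by
  have h : ∀ N, k ≤ N → N ≤ n → ∃ c : ℂ, c ≠ 0 ∧ (antisymTrace fun s : Fin N =>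
      if (s : ℕ) < k then Tshift n (-(s : ℤ)) else (1 : Matrix (Fin n) (Fin n) (YSeries n))) =
        c • e n k := by
    intro N hN
    induction N, hN using Nat.le_induction with
    | base =>
      intro _
      refine ⟨1, one_ne_zero, ?_⟩
      rw [one_smul, e]
      congr 1
      funext s
      rw [if_pos s.isLt]
    | succ N hN ih =>
      intro hNn
      obtain ⟨c, hc, hce⟩ := ih (by omega)
      have h1 := antisymTrace_append_one fun s : Fin N =>
        if (s : ℕ) < k then Tshift n (-(s : ℤ)) else (1 : Matrix (Fin n) (Fin n) (YSeries n))
      have h2 : append (fun s : Fin N =>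
          if (s : ℕ) < k then Tshift n (-(s : ℤ)) else (1 : Matrix (Fin n) (Fin n) (YSeries n))) 1 =
          fun s : Fin (N + 1) =>
            if (s : ℕ) < k then Tshift n (-(s : ℤ)) else 1 := by
        funext s
        induction s using Fin.lastCases with
        | last => simp [show ¬ N < k by omega]
        | cast s => simp
      rw [h2, hce, smul_smul] at h1
      have hN0 : ((N + 1 : ℕ) : ℂ) ≠ 0 := by exact_mod_cast Nat.succ_ne_zero N
      refine ⟨((N + 1 : ℕ) : ℂ)⁻¹ * (((n : ℂ) - N) * c), ?_, ?_⟩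
      · refine mul_ne_zero (inv_ne_zero hN0) (mul_ne_zero (sub_ne_zero.mpr ?_) hc)
        exact_mod_cast (show n ≠ N by omega)
      · rw [mul_smul, ← h1, smul_smul, inv_mul_cancel₀ hN0, one_smul]
  obtain ⟨c, hc, h'⟩ := h n hk le_rfl
  refine ⟨c, hc, ?_⟩
  rw [← h', betheSeries]
  congr 1
  funext s
  rw [Matrix.map_one _ (map_zero _) (map_one _)]

theorem coeff_e_mem (k r : ℕ) : coeff r (e n k) ∈ betheSubalgebra n 1 := by
  rcases Nat.eq_zero_or_pos k with rfl | hk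
  · rw [e_zero, PowerSeries.coeff_one]
    split_ifs
    · exact one_mem _
    · exact zero_mem _
  rcases Nat.lt_or_ge n k with hn | hn
  · rw [e_eq_zero hn, map_zero]
    exact zero_mem _
  obtain ⟨c, hc, h⟩ := exists_betheSeries_eq hn
  have h' : coeff r (e n k) = c⁻¹ • coeff r (betheSeries n 1 k) := by
    rw [h, PowerSeries.coeff_smul, smul_smul, inv_mul_cancel₀ hc, one_smul]
  have hb : coeff r (betheSeries n 1 k) ∈ betheSubalgebra n 1 :=
    Algebra.subset_adjoin ⟨k, r, hk, hn, rfl⟩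
  rw [h']
  exact Subalgebra.smul_mem _ hb _

theorem bethe_generators_commute {a b : Yangian n}
    (ha : a ∈ {y | ∃ k r : ℕ, 1 ≤ k ∧ k ≤ n ∧ y = coeff r (betheSeries n 1 k)})
    (hb : b ∈ {y | ∃ k r : ℕ, 1 ≤ k ∧ k ≤ n ∧ y = coeff r (betheSeries n 1 k)}) :
    a * b = b * a := by
  obtain ⟨k, r, -, hk, rfl⟩ := ha
  obtain ⟨l, s, -, hl, rfl⟩ := hb
  obtain ⟨c, -, hc⟩ := exists_betheSeries_eq hk
  obtain ⟨d, -, hd⟩ := exists_betheSeries_eq hl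
  rw [hc, hd, PowerSeries.coeff_smul, PowerSeries.coeff_smul]
  exact ((coeff_e_commute k l r s).smul_left c).smul_right d

/-- The Bethe subalgebra as an abstract commutative algebra. -/
theorem exists_commutative_model : ∃ (B : Type) (_ : CommRing B) (_ : Algebra ℂ B)
    (ψ : B →ₐ[ℂ] Yangian n), Function.Injective ψ ∧ ψ.range = betheSubalgebra n 1 := by
  have hcomm : IsMulCommutative (betheSubalgebra n 1) :=
    Algebra.isMulCommutative_adjoin ℂ fun a ha b hb => bethe_generators_commute ha hb
  exact ⟨betheSubalgebra n 1,
    { (inferInstance : Ring (betheSubalgebra n 1)) with mul_comm := hcomm.is_comm.comm },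
    (betheSubalgebra n 1).algebra, (betheSubalgebra n 1).val,
    Subtype.val_injective, Subalgebra.range_val _⟩

theorem exists_lift {B : Type*} [CommRing B] [Algebra ℂ B] {ψ : B →ₐ[ℂ] Yangian n} (f : YSeries n)
    (hf : ∀ r, coeff r f ∈ ψ.range) : ∃ g : B⟦X⟧, PowerSeries.map (ψ : B →+* Yangian n) g = f := by
  choose g hg using hf
  exact ⟨PowerSeries.mk g, by ext r; simpa using hg r⟩

theorem map_shift {B : Type*} [CommRing B] [Algebra ℂ B] (ψ : B →ₐ[ℂ] Yangian n) (a : ℤ)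
    (f : B⟦X⟧) : PowerSeries.map (ψ : B →+* Yangian n) (shift a f) =
      shift a (PowerSeries.map (ψ : B →+* Yangian n) f) :=
  (shiftFun_map _ a f).symm

theorem map_smul_series {B : Type*} [CommRing B] [Algebra ℂ B] (ψ : B →ₐ[ℂ] Yangian n) (c : ℂ)
    (f : B⟦X⟧) : PowerSeries.map (ψ : B →+* Yangian n) (c • f) =
      c • PowerSeries.map (ψ : B →+* Yangian n) f := by
  ext r; simp

/-- The term t = 0 of Newton's identity is p⁻_{k+1} with coefficient e_0 = 1, so it is expressed
through the e's and the earlier p⁻'s. The index starts at 1. -/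
theorem exists_lift_pMinus {B : Type*} [CommRing B] [Algebra ℂ B] {ψ : B →ₐ[ℂ] Yangian n}
    (hψ : ψ.range = betheSubalgebra n 1) (k : ℕ) :
    ∃ g : B⟦X⟧, PowerSeries.map (ψ : B →+* Yangian n) g = pMinus n (k + 1) := by
  induction k using Nat.strong_induction_on with
  | _ k ih =>
    have he : ∀ k, ∃ g : B⟦X⟧, PowerSeries.map (ψ : B →+* Yangian n) g = e n k := fun k =>
      exists_lift _ fun r => hψ ▸ coeff_e_mem k r
    choose e' he' using he
    choose! p' hp' using ih
    have h := newton (n := n) (k + 1)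
    rw [Finset.sum_range_succ', pow_zero, e_zero, Nat.cast_zero, neg_zero, shift_zero, Nat.sub_zero,
      one_mul, one_mul, neg_add, eq_neg_add_iff_add_eq, eq_comm, neg_eq_iff_eq_neg] at h
    refine ⟨-(∑ t ∈ Finset.range k, (-1) ^ (t + 1) * e' (t + 1) *
      shift (-((t + 1 : ℕ) : ℤ)) (p' (k + 1 - (t + 1) - 1)) +
        ((k + 1 : ℕ) : ℂ) • ((-1) ^ (k + 1) * e' (k + 1))), ?_⟩
    rw [h, map_neg, map_add, map_sum, map_smul_series]
    simp only [map_mul, map_pow, map_neg, map_one, he', map_shift]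
    congr 2
    refine Finset.sum_congr rfl fun t ht => ?_
    have ht' : t < k := by simpa using ht
    rw [hp' _ (by omega), show k + 1 - (t + 1) - 1 + 1 = k + 1 - (t + 1) by omega]

end Bethe

/-! ### The generating series in `τ⁻¹` -/

section Tau

variable {B : Type*} [Ring B] [Algebra ℂ B] {φ : B →ₐ[ℂ] B}

/-- The series `b y^k`. -/
def monomial (φ : B →ₐ[ℂ] B) (k : ℕ) : B →ₗ[ℂ] SkewSeries φ where
  toFun b := ⟨fun j => if j = k then b else 0⟩
  map_add' a b := by ext j; by_cases h : j = k <;> simp [h]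
  map_smul' c b := by ext j; by_cases h : j = k <;> simp [h]

theorem coeff_monomial (k : ℕ) (b : B) (j : ℕ) :
    (monomial φ k b).coeff j = if j = k then b else 0 := rfl

theorem monomial_mul_monomial (k l : ℕ) (b c : B) :
    monomial φ k b * monomial φ l c = monomial φ (k + l) (b * (φ ^ k) c) := by
  ext j
  rw [SkewSeries.coeff_mul, coeff_monomial]
  split_ifs with h
  · subst h
    rw [Finset.sum_eq_single (k, l)]
    · simp [coeff_monomial]
    · rintro ⟨q1, q2⟩ hq hne
      rw [Finset.HasAntidiagonal.mem_antidiagonal] at hq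
      by_cases h1 : q1 = k
      · have h2 : q2 ≠ l := fun h2 => hne (by rw [h1, h2])
        simp [coeff_monomial, h2]
      · simp [coeff_monomial, h1]
    · simp
  · refine Finset.sum_eq_zero ?_
    rintro ⟨q1, q2⟩ hq
    rw [Finset.HasAntidiagonal.mem_antidiagonal] at hq
    by_cases h1 : q1 = k
    · have h2 : q2 ≠ l := fun h2 => h (by rw [← hq, h1, h2])
      simp [coeff_monomial, h2]
    · simp [coeff_monomial, h1]

theorem const_eq_monomial (b : B) : (SkewSeries.const b : SkewSeries φ) = monomial φ 0 b := rfl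

theorem var_eq_monomial : (SkewSeries.var : SkewSeries φ) = monomial φ 1 1 := rfl

theorem one_eq_monomial : (1 : SkewSeries φ) = monomial φ 0 1 := rfl

theorem var_pow (k : ℕ) : (SkewSeries.var : SkewSeries φ) ^ k = monomial φ k 1 := by
  induction k with
  | zero => rw [pow_zero, one_eq_monomial]
  | succ k ih => rw [pow_succ, ih, var_eq_monomial, monomial_mul_monomial, map_one, mul_one]

theorem prod_const_mul_var {k : ℕ} (f : Fin k → B) :
    (List.ofFn fun s => (SkewSeries.const (f s) : SkewSeries φ) * SkewSeries.var).prod =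
      monomial φ k (List.ofFn fun s : Fin k => (φ ^ (s : ℕ)) (f s)).prod := by
  induction k with
  | zero => simp [one_eq_monomial]
  | succ k ih =>
    rw [prod_ofFn_succ, prod_ofFn_succ, ih, const_eq_monomial, var_eq_monomial,
      monomial_mul_monomial, monomial_mul_monomial]
    simp

theorem antisymTrace_const_mul_var {n k : ℕ} (M : Matrix (Fin n) (Fin n) B) :
    antisymTrace (fun _ : Fin k => Matrix.of fun i j =>
      (SkewSeries.const (M i j) : SkewSeries φ) * SkewSeries.var) =
      monomial φ k (antisymTrace fun s : Fin k => M.map (φ ^ (s : ℕ) : B →ₐ[ℂ] B)) := by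
  simp only [antisymTrace_eq, altEntry, Matrix.of_apply, prod_const_mul_var, map_smul, map_sum,
    map_zsmul, Matrix.map_apply]

variable {n : ℕ}

/-- Moving every τ⁻¹ to the right shifts the s-th copy of T (counted from 0) to T(u-s). -/
theorem eTau_eq (k : ℕ) : eTau n k = monomial _ k (e n k) := by
  rw [eTau, tauInv, antisymTrace_const_mul_var, e]
  congr 2
  funext s
  funext i j
  simp only [Tshift, Matrix.map_apply]
  rw [shift_pow, mul_neg_one]

theorem hTau_eq (m : ℕ) (a : ℤ) :
    hTau n m a = monomial _ m (shift (a - m) (hMinus n m)) := by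
  rw [hTau, tauInv, var_pow, const_eq_monomial, monomial_mul_monomial, shift_pow, shift_shift,
    one_mul, add_zero]
  congr 3
  ring

theorem coeff_HMinus (a : ℤ) (m : ℕ) :
    (HMinus n a).coeff m = shift (a - m) (hMinus n m) := by
  simp only [HMinus, SkewSeries.formalSum, hTau_eq, coeff_monomial]
  rw [Finset.sum_eq_single m]
  · simp
  · intro b _ hb
    rw [if_neg hb.symm]
  · simp

/-- No bound m ≤ n is needed: e_m vanishes for m > n, so the truncation of E is harmless. -/
theorem coeff_E (m : ℕ) : (E n).coeff m = (-1) ^ m * e n m := by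
  have h1 : ∀ k, (-1) ^ k * eTau n k = monomial _ k ((-1) ^ k * e n k) := by
    intro k
    rw [eTau_eq]
    rcases Nat.even_or_odd k with hk | hk <;> simp [hk.neg_one_pow]
  have h2 : E n = ∑ k ∈ Finset.range (n + 1), monomial _ k ((-1) ^ k * e n k) := by
    rw [E]
    exact Finset.sum_congr rfl fun k _ => h1 k
  have h3 : ∀ s : Finset ℕ, (∑ k ∈ s, monomial (shift (A := Yangian n) (-1)) k
      ((-1) ^ k * e n k)).coeff m = ∑ k ∈ s, if m = k then (-1) ^ k * e n k else 0 := by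
    intro s
    induction s using Finset.induction_on with
    | empty => simp
    | insert k s hk ih => rw [Finset.sum_insert hk, Finset.sum_insert hk, SkewSeries.coeff_add, ih,
        coeff_monomial]
  rw [h2, h3, Finset.sum_ite_eq]
  split_ifs with h
  · rfl
  · rw [e_eq_zero (by simpa using h), mul_zero]

end Tau

/-! ### Complete symmetric series of the commutative model and their images. -/

section Lift

variable {n : ℕ} {B : Type*} [CommRing B] [Algebra ℂ B] {ψ : B →ₐ[ℂ] Yangian n}

theorem map_complete {p : ℕ → B⟦X⟧}
    (hp : ∀ k, PowerSeries.map (ψ : B →+* Yangian n) (p (k + 1)) = pMinus n (k + 1)) (m : ℕ) :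
    PowerSeries.map (ψ : B →+* Yangian n) (complete p m) = hMinus n m := by
  rw [complete, map_smul_series, leadingMinor, map_det_eq_rdet, hMinus]
  congr 2
  ext i j : 2
  simp only [Matrix.map_apply, Matrix.of_apply, powerSumMatrix, hessenberg]
  split_ifs
  · rw [map_shift, hp]
  · rw [map_neg, map_natCast]
  · rw [map_zero]

theorem map_completeInt {p : ℕ → B⟦X⟧}
    (hp : ∀ k, PowerSeries.map (ψ : B →+* Yangian n) (p (k + 1)) = pMinus n (k + 1)) (m : ℤ) :
    PowerSeries.map (ψ : B →+* Yangian n) (completeInt p m) = hMinusInt n m := by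
  cases m with
  | ofNat m => exact map_complete hp m
  | negSucc m => exact map_zero _

end Lift

end YangianBethe
end

/-! ### Transfer of the commutative identities to the Yangian. -/

theorem mainTheorem4 (n : ℕ) :
    -- (a) `E(u, τ) H⁻(u + 1, τ) = 1`
    YangianBethe.E n * YangianBethe.HMinus n 1 = 1 ∧
    -- (b) the coefficients of all `h⁻_k(u)` lie in the Bethe subalgebra (with `Z = 1`)
    (∀ k r : ℕ, PowerSeries.coeff r (YangianBethe.hMinus n k) ∈
      YangianBethe.betheSubalgebra n 1) ∧
    -- they commute pairwise
    (∀ k l r s : ℕ, Commute (PowerSeries.coeff r (YangianBethe.hMinus n k))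
      (PowerSeries.coeff s (YangianBethe.hMinus n l))) ∧
    -- `e_k(u) = det (h⁻_{j-i+1}(u-j+1))_{1 ≤ i, j ≤ k}`; here the indices start from `0`
    (∀ k : ℕ, YangianBethe.e n k = YangianBethe.rdet (Matrix.of fun i j : Fin k =>
      YangianBethe.shift (-((j : ℕ) : ℤ))
        (YangianBethe.hMinusInt n (((j : ℕ) : ℤ) - ((i : ℕ) : ℤ) + 1)))) := by
  open YangianBethe PowerSeries in
  obtain ⟨B, _, _, ψ, hinj, hψ⟩ := exists_commutative_model (n := n)
  have he : ∀ k, ∃ g : B⟦X⟧, PowerSeries.map (ψ : B →+* Yangian n) g = e n k := fun k =>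
    exists_lift _ fun r => hψ ▸ coeff_e_mem k r
  choose e' he' using he
  choose p' hp using exists_lift_pMinus hψ
  -- The value at 0 is a dummy: only power sums of positive index occur.
  let p : ℕ → B⟦X⟧ := fun k => p' (k - 1)
  have hp' : ∀ k, PowerSeries.map (ψ : B →+* Yangian n) (p (k + 1)) = pMinus n (k + 1) := hp
  have hinj' : Function.Injective (PowerSeries.map (ψ : B →+* Yangian n)) :=
    PowerSeries.map_injective _ hinj
  -- Newton's identities are pulled back along the injective map of series.
  have hN : ∀ j : ℕ, (j : ℂ) • ((-1) ^ j * e' j) =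
      -∑ t ∈ Finset.range j, (-1) ^ t * e' t * shift (-(t : ℤ)) (p (j - t)) := by
    intro j
    apply hinj'
    rw [map_smul_series, map_neg, map_sum]
    simp only [map_mul, map_pow, map_neg, map_one, he', map_shift]
    rw [newton]
    congr 1
    refine Finset.sum_congr rfl fun t ht => ?_
    have ht' : t < j := by simpa using ht
    obtain ⟨q, hq⟩ : ∃ q, j - t = q + 1 := ⟨j - t - 1, by omega⟩
    rw [hq, hp']
  have h0 : e' 0 = 1 := hinj' (by rw [he', e_zero, map_one])
  have hmem : ∀ k r, coeff r (hMinus n k) = ψ (coeff r (complete p k)) := fun k r => by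
    rw [← map_complete hp' k, PowerSeries.coeff_map]
    rfl
  refine ⟨?_, fun k r => ?_, fun k l r s => ?_, fun k => ?_⟩
  · ext m : 2
    rw [SkewSeries.coeff_mul, Finset.Nat.sum_antidiagonal_eq_sum_range_succ_mk,
      SkewSeries.coeff_one]
    -- Moving τ^{-k} past the coefficient h_{m-k}(u+1-(m-k)) gives h_{m-k}(u+1-m), the same shift
    -- for every k.
    have h : ∀ k ∈ Finset.range (m + 1), (E n).coeff k *
        (shift (A := Yangian n) (-1) ^ k) ((HMinus n 1).coeff (m - k)) =
        PowerSeries.map (ψ : B →+* Yangian n)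
          ((-1) ^ k * e' k * shift (1 - (m : ℤ)) (complete p (m - k))) := by
      intro k hk
      have hk' : k ≤ m := by simpa [Nat.lt_succ_iff] using hk
      rw [coeff_E, coeff_HMinus, shift_pow, shift_shift, map_mul, map_mul, map_shift,
        map_complete hp', he', map_pow, map_neg, map_one]
      congr 3
      push_cast [hk']
      ring
    rw [Finset.sum_congr rfl h, ← map_sum]
    split_ifs with hm
    · subst hm
      simp [h0, complete_zero]
    · rw [sum_elementary_mul_complete hN hm, map_zero]
  · rw [hmem, ← hψ]
    exact ⟨_, rfl⟩
  · rw [hmem, hmem, Commute, SemiconjBy, ← map_mul, mul_comm, map_mul]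
  · rw [← he', elementary_eq_leadingMinor h0 hN, leadingMinor, ← Matrix.det_transpose,
      map_det_eq_rdet]
    congr 1
    ext i j : 2
    simp only [Matrix.map_apply, Matrix.transpose_apply, Matrix.of_apply, completeMatrix]
    rw [map_shift, map_completeInt hp']
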